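/- **Corollary 5 (tractability of $\exists\mathrm{FOIL}^+$ and $\forall\mathrm{FOIL}^+$ over perceptrons).** A *partial instance* of dimension $n\ge 1$ is a tuple in $\{0,1,\bot\}^n$; it is an *instance* if it lies in $\{0,1\}^n$. A partial instance $e$ is *subsumed* by $e'$, written $e\subseteq e'$, if $e[i]=e'[i]$ for every $i$ with $e[i]\neq\bot$. A *perceptron* $\mathcal M=(w,t)$ of dimension $n$ classifies an instance $x\in\{0,1\}^n$ as $\mathcal M(x)=1$ if and only if $w\cdot x\ge t$. First-order formulas (with equality, built with $\neg,\vee,\wedge,\exists,\forall$) over the vocabulary $\{\mathrm{Pos},\subseteq,\mathrm{Full},\mathrm{AllPos},\mathrm{AllNeg}\}$ are interpreted in $\mathcal M$ over the domain $\{0,1,\bot\}^n$: $\subseteq$ is subsumption, $\mathrm{Pos}(e)$ holds if and only if $e$ is an instance with $\mathcal M(e)=1$, and $$\mathrm{Full}(x)=\forall y\,(x\subseteq y\to x=y),\qquad \mathrm{AllPos}(x)=\forall y\,((x\subseteq y\wedge\mathrm{Full}(y))\to\mathrm{Pos}(y)),\qquad \mathrm{AllNeg}(x)=\forall y\,(x\subseteq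 y\to\neg\mathrm{Pos}(y)).$$ The fragment $\exists\mathrm{FOIL}^+$ consists of the formulas over this vocabulary in which no universal quantifier occurs and no existential quantifier appears under a negation; $\forall\mathrm{FOIL}^+$ is defined in the same way with the roles of the two quantifiers exchanged. For a fixed formula $\varphi(x_1,\dots,x_k)$, the problem $\mathrm{Eval}(\varphi,\mathsf{Ptron})$ is: given a perceptron $\mathcal M=(w,t)$ of some dimension $n\ge1$, with rational weights and rational threshold written as fractions in binary, and partial instances $e_1,\dots,e_k$ of dimension $n$, decide whether $\mathcal M\models\varphi(e_1,\dots,e_k)$. 1. For every $\varphi$ in $\exists\mathrm{FOIL}^+$ or in $\forall\mathrm{FOIL}^+$, the problem $\mathrm{Eval}(\varphi,\mathsf{Ptron})$ can be solved in polynomial time: some Turing machine (depending on $\varphi$ only) decides it in a number of steps bounded by a polynomial (depending on $\varphi$ only) in the length of the input. 2. More generally, $\mathrm{Eval}(\varphi,\mathsf{Ptron})$ can be solved in polynomial time for every Boolean combination $\varphi$ (built with $\neg,\vee,\wedge$) of formulas in $\exists\mathrm{FOIL}^+$. -/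

import Mathlib

namespace Foil

/-! ### Instances, partial instances, models, perceptrons -/

/-- Instances of dimension `n`: tuples in `{0,1}^n`. -/
abbrev Inst (n : ℕ) : Type := Fin n → Bool

/-- Partial instances of dimension `n`: tuples in `{0,1,⊥}^n`; `none` is the undefined value `⊥`. -/
abbrev PInst (n : ℕ) : Type := Fin n → Option Bool

/-- Models of dimension `n`: Boolean functions on instances. -/
abbrev Model (n : ℕ) : Type := Inst n → Bool

/-- The partial instance `e₁` is subsumed by `e₂`. -/
def Subsumed {n : ℕ} (e₁ e₂ : PInst n) : Prop :=
  ∀ i, e₁ i ≠ none → e₁ i = e₂ i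

/-- The predicate `Pos`: `e` is an instance (no undefined feature) that `M` classifies as `1`. -/
def Pos {n : ℕ} (M : Model n) (e : PInst n) : Prop :=
  ∃ x : Inst n, (∀ i, e i = some (x i)) ∧ M x = true

/-- The predicate `Full(x) = ∀ y (x ⊆ y → x = y)`. -/
def Full {n : ℕ} (e : PInst n) : Prop :=
  ∀ y : PInst n, Subsumed e y → e = y

/-- The predicate `AllPos(x) = ∀ y ((x ⊆ y ∧ Full(y)) → Pos(y))`. -/
def AllPos {n : ℕ} (M : Model n) (e : PInst n) : Prop :=
  ∀ y : PInst n, Subsumed e y ∧ Full y → Pos M y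

/-- The predicate `AllNeg(x) = ∀ y (x ⊆ y → ¬ Pos(y))`. -/
def AllNeg {n : ℕ} (M : Model n) (e : PInst n) : Prop :=
  ∀ y : PInst n, Subsumed e y → ¬ Pos M y

/-- A perceptron of dimension `n`: a weight vector and a threshold. -/
structure Perceptron (n : ℕ) where
  /-- the weights -/
  w : Fin n → ℝ
  /-- the threshold -/
  t : ℝ

open Classical in
/-- The model given by a perceptron: `x` is classified as `1` iff `w · x ≥ t`. -/
noncomputable def Perceptron.toModel {n : ℕ} (P : Perceptron n) : Model n :=
  fun x => decide (P.w ⬝ᵥ (fun i => if x i then (1 : ℝ) else 0) ≥ P.t)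

/-! ### First-order formulas over `{Pos, ⊆, Full, AllPos, AllNeg}` -/

/-- First-order formulas with equality over the vocabulary `{Pos, ⊆, Full, AllPos, AllNeg}` whose
free variables are among `x_0, …, x_{k-1}`. The quantifiers bind the variable `x_k` of a
formula with free variables among `x_0, …, x_k`. -/
inductive Formula : ℕ → Type
  | eq {k : ℕ} (i j : Fin k) : Formula k
  | sub {k : ℕ} (i j : Fin k) : Formula k
  | pos {k : ℕ} (i : Fin k) : Formula k
  | full {k : ℕ} (i : Fin k) : Formula k
  | allPos {k : ℕ} (i : Fin k) : Formula k
  | allNeg {k : ℕ} (i : Fin k) : Formula k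
  | neg {k : ℕ} (φ : Formula k) : Formula k
  | or {k : ℕ} (φ ψ : Formula k) : Formula k
  | and {k : ℕ} (φ ψ : Formula k) : Formula k
  | ex {k : ℕ} (φ : Formula (k + 1)) : Formula k
  | all {k : ℕ} (φ : Formula (k + 1)) : Formula k

/-- `Sat M φ v`: the model `M` satisfies `φ(v 0, …, v (k-1))`. Quantifiers range over all partial
instances of the dimension of `M`. -/
def Sat {n : ℕ} (M : Model n) : {k : ℕ} → Formula k → (Fin k → PInst n) → Prop
  | _, .eq i j, v => v i = v j
  | _, .sub i j, v => Subsumed (v i) (v j)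
  | _, .pos i, v => Pos M (v i)
  | _, .full i, v => Full (v i)
  | _, .allPos i, v => AllPos M (v i)
  | _, .allNeg i, v => AllNeg M (v i)
  | _, .neg φ, v => ¬ Sat M φ v
  | _, .or φ ψ, v => Sat M φ v ∨ Sat M ψ v
  | _, .and φ ψ, v => Sat M φ v ∧ Sat M ψ v
  | k, .ex φ, v => ∃ a : PInst n, Sat M φ (Fin.snoc (α := fun _ : Fin (k + 1) => PInst n) v a)
  | k, .all φ, v => ∀ a : PInst n, Sat M φ (Fin.snoc (α := fun _ : Fin (k + 1) => PInst n) v a)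

namespace Formula

/-- No existential quantifier occurs. -/
def NoEx : {k : ℕ} → Formula k → Prop
  | _, .eq _ _ => True
  | _, .sub _ _ => True
  | _, .pos _ => True
  | _, .full _ => True
  | _, .allPos _ => True
  | _, .allNeg _ => True
  | _, .neg φ => φ.NoEx
  | _, .or φ ψ => φ.NoEx ∧ ψ.NoEx
  | _, .and φ ψ => φ.NoEx ∧ ψ.NoEx
  | _, .ex _ => False
  | _, .all φ => φ.NoEx

/-- No universal quantifier occurs. -/
def NoAll : {k : ℕ} → Formula k → Prop
  | _, .eq _ _ => True
  | _, .sub _ _ => True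
  | _, .pos _ => True
  | _, .full _ => True
  | _, .allPos _ => True
  | _, .allNeg _ => True
  | _, .neg φ => φ.NoAll
  | _, .or φ ψ => φ.NoAll ∧ ψ.NoAll
  | _, .and φ ψ => φ.NoAll ∧ ψ.NoAll
  | _, .ex φ => φ.NoAll
  | _, .all _ => False

/-- No existential quantifier appears under a negation. -/
def NoExUnderNeg : {k : ℕ} → Formula k → Prop
  | _, .eq _ _ => True
  | _, .sub _ _ => True
  | _, .pos _ => True
  | _, .full _ => True
  | _, .allPos _ => True
  | _, .allNeg _ => True
  | _, .neg φ => φ.NoEx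
  | _, .or φ ψ => φ.NoExUnderNeg ∧ ψ.NoExUnderNeg
  | _, .and φ ψ => φ.NoExUnderNeg ∧ ψ.NoExUnderNeg
  | _, .ex φ => φ.NoExUnderNeg
  | _, .all φ => φ.NoExUnderNeg

/-- No universal quantifier appears under a negation. -/
def NoAllUnderNeg : {k : ℕ} → Formula k → Prop
  | _, .eq _ _ => True
  | _, .sub _ _ => True
  | _, .pos _ => True
  | _, .full _ => True
  | _, .allPos _ => True
  | _, .allNeg _ => True
  | _, .neg φ => φ.NoAll
  | _, .or φ ψ => φ.NoAllUnderNeg ∧ ψ.NoAllUnderNeg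
  | _, .and φ ψ => φ.NoAllUnderNeg ∧ ψ.NoAllUnderNeg
  | _, .ex φ => φ.NoAllUnderNeg
  | _, .all φ => φ.NoAllUnderNeg

/-- The fragment `∃FOIL⁺`. -/
def IsExistsFoilPlus {k : ℕ} (φ : Formula k) : Prop :=
  φ.NoAll ∧ φ.NoExUnderNeg

/-- The fragment `∀FOIL⁺`. -/
def IsForallFoilPlus {k : ℕ} (φ : Formula k) : Prop :=
  φ.NoEx ∧ φ.NoAllUnderNeg

/-- Boolean combinations of `∃FOIL⁺` formulas. -/
inductive IsBoolCombExistsFoilPlus {k : ℕ} : Formula k → Prop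
  | base {φ : Formula k} (h : φ.IsExistsFoilPlus) : IsBoolCombExistsFoilPlus φ
  | neg {φ : Formula k} (h : IsBoolCombExistsFoilPlus φ) : IsBoolCombExistsFoilPlus (.neg φ)
  | or {φ ψ : Formula k} (h₁ : IsBoolCombExistsFoilPlus φ) (h₂ : IsBoolCombExistsFoilPlus ψ) :
      IsBoolCombExistsFoilPlus (.or φ ψ)
  | and {φ ψ : Formula k} (h₁ : IsBoolCombExistsFoilPlus φ) (h₂ : IsBoolCombExistsFoilPlus ψ) :
      IsBoolCombExistsFoilPlus (.and φ ψ)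

end Formula

/-! ### The evaluation problem over perceptrons -/

/-- Inputs of the evaluation problem for a formula with `k` free variables: a dimension `n ≥ 1`, a
perceptron of dimension `n` with rational weights and threshold, and `k` partial instances of
dimension `n`. -/
structure PtronInput (k : ℕ) where
  /-- the dimension -/
  n : ℕ
  one_le_n : 1 ≤ n
  /-- the weights -/
  w : Fin n → ℚ
  /-- the threshold -/
  t : ℚ
  /-- the partial instances -/
  e : Fin k → PInst n

/-- The perceptron of an input. -/
noncomputable def PtronInput.perceptron {k : ℕ} (I : PtronInput k) : Perceptron I.n where
  w := fun i => (I.w i : ℝ)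
  t := (I.t : ℝ)

/-- The input alphabet. -/
inductive Sym : Type
  | bit (b : Bool)
  | minus
  | slash
  | comma
  | semicolon
  | feature (v : Option Bool)
  deriving DecidableEq, Fintype

/-- Natural numbers in binary, least significant bit first. -/
def encNat (m : ℕ) : List Sym :=
  (Computability.encodeNat m).map Sym.bit

/-- Integers: an optional minus sign, followed by the absolute value in binary. -/
def encInt (z : ℤ) : List Sym :=
  (if z < 0 then [Sym.minus] else []) ++ encNat z.natAbs

/-- Rational numbers: reduced fractions `numerator / denominator`, written in binary. -/
def encRat (q : ℚ) : List Sym :=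
  encInt q.num ++ [Sym.slash] ++ encNat q.den

/-- Partial instances: the list of the values of their features. -/
def encPInst {n : ℕ} (e : PInst n) : List Sym :=
  (List.ofFn e).map Sym.feature

/-- The string encoding an input: the threshold and the weights `w_1, …, w_n`, each terminated by a
comma, then a semicolon, and then the partial instances, each terminated by a semicolon. -/
def PtronInput.encode {k : ℕ} (I : PtronInput k) : List Sym :=
  (encRat I.t ++ [Sym.comma]) ++
    (List.ofFn I.w).flatMap (fun q => encRat q ++ [Sym.comma]) ++ [Sym.semicolon] ++
    (List.ofFn I.e).flatMap (fun a => encPInst a ++ [Sym.semicolon])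

/-- The decision problem `P` on the objects of type `α`, given as strings by `enc`, can be solved in
polynomial time: some Turing machine outputs the right answer on every input, in a number of steps
bounded by a polynomial in the length of the string. -/
def SolvableInPolyTime {α Γ : Type} (enc : α → List Γ) (P : α → Prop) : Prop :=
  ∃ f : α → Bool, (∀ a, f a = true ↔ P a) ∧
    Nonempty (Turing.TM2ComputableInPolyTime enc Computability.encodeBool f)

/-- The evaluation problem for the (fixed) formula `φ` over perceptrons: does the given perceptron
satisfy `φ` at the given partial instances? -/
def EvalPtron {k : ℕ} (φ : Formula k) (I : PtronInput k) : Prop :=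
  Sat I.perceptron.toModel φ I.e

/-- The evaluation problem for `φ` over perceptrons can be solved in polynomial time. -/
def EvalPtronInPolyTime {k : ℕ} (φ : Formula k) : Prop :=
  SolvableInPolyTime (PtronInput.encode (k := k)) (EvalPtron φ)

end Foil

/-!
A query is called existential if it asks for finitely many further partial instances such that a
fixed Boolean condition on the atomic facts (`⊆`, `Full`, `AllPos`, `AllNeg`) about the given and
the further ones is satisfied. Every `∃FOIL⁺` formula and the negation of every `∀FOIL⁺` formula
define existential queries (`Formula.IsExistsFoilPlus.isExistential`,
`Formula.IsForallFoilPlus.isExistential_not`), so it is enough to decide existential queries in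
polynomial time (`IsExistential.exists_pt`).

The reason why this is possible is a small witness property (`exists_marks`). View the partial
instances as rows of a matrix, with a column for every feature, and say that two features are of
the same kind if they agree in the given partial instances and in the sign of the weight. Boundedly
many marked columns suffice to witness every failure of an inclusion, of fullness, of `AllPos` and
of `AllNeg`, after adding some rows which witness the last two. All unmarked columns of a kind can
then be replaced by a single column: `AllPos x` says that the least weighted sum over the
completions of `x` reaches the threshold, so a row with this property may take its best value at
every unmarked feature of the kind as soon as it takes it at one of them. Rows with `AllNeg` are
treated dually, and the two classes of rows are disjoint and closed upwards, which preserves the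
inclusions. So there are only finitely many choices for the unmarked columns, and polynomially many
for the marked ones, whose number is bounded. All of them can be tried, and checking the atomic
facts for one of them amounts to comparing sums of weights with the threshold (`checkAtom_encode`).

The machine is obtained from a small structured language of stack programs, `Prog`. It is compiled
to the machines `Turing.FinTM2`, whose running time is the cost in the big step semantics, plus one
(`Run.machine_evals`). On top of it, `PT f` says that `f` is computed in polynomial time by such a
program, on representations by binary stacks. This notion is closed under composition, case
distinction and folding over a list with a polynomial bound on the intermediate results
(`PT.foldl`). Everything else is expressed by these operations: arithmetic in binary, the summation
of fractions over a common denominator (`pt_sumNonneg`), parsing (`pt_cells`) and the search over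
the marks, which iterates the step of trying all ways to mark one symbol of a word
(`PT.iterate_someUpdate`).
-/

namespace Foil

open Function

/-! ### A structured language for stack machines -/

/-- Structured programs over a family of named stacks, the stack `k` having the alphabet `Γ k`.
`case k f` inspects the top of the stack `k` and continues with the corresponding program;
`loop k p` repeats `p` while the stack `k` is nonempty. -/
inductive Prog {K : Type} (Γ : K → Type) : Type
  | skip : Prog Γ
  | push (k : K) (a : Γ k) : Prog Γ
  | pop (k : K) : Prog Γ
  | seq (p q : Prog Γ) : Prog Γ
  | case (k : K) (f : Option (Γ k) → Prog Γ) : Prog Γ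
  | loop (k : K) (p : Prog Γ) : Prog Γ

/-- The contents of all stacks. -/
abbrev Store {K : Type} (Γ : K → Type) : Type := ∀ k, List (Γ k)

/-- `Run p S T t`: the program `p`, started on the stacks `S`, ends with the stacks `T` after `t`
steps. -/
inductive Run {K : Type} [DecidableEq K] {Γ : K → Type} :
    Prog Γ → Store Γ → Store Γ → ℕ → Prop
  | skip (S : Store Γ) : Run .skip S S 1
  | push (S : Store Γ) (k : K) (a : Γ k) : Run (.push k a) S (update S k (a :: S k)) 1
  | pop (S : Store Γ) (k : K) : Run (.pop k) S (update S k (S k).tail) 1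
  | seq {p q : Prog Γ} {S T U : Store Γ} {t u : ℕ} (h₁ : Run p S T t) (h₂ : Run q T U u) :
      Run (.seq p q) S U (t + u)
  | case {k : K} {f : Option (Γ k) → Prog Γ} {S T : Store Γ} {t : ℕ}
      (h : Run (f (S k).head?) S T t) : Run (.case k f) S T (1 + t)
  | loop_done {k : K} {p : Prog Γ} {S : Store Γ} (h : S k = []) : Run (.loop k p) S S 1
  | loop_step {k : K} {p : Prog Γ} {S T U : Store Γ} {t u : ℕ} (h : S k ≠ [])
      (h₁ : Run p S T t) (h₂ : Run (.loop k p) T U u) : Run (.loop k p) S U (1 + (t + u))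

section Compile

variable {K : Type} {Γ : K → Type}

/-- The labels of the machine compiled from a program. -/
def Prog.Lab : Prog Γ → Type
  | .skip => Unit
  | .push _ _ => Unit
  | .pop _ => Unit
  | .seq p q => p.Lab ⊕ q.Lab
  | .case _ f => Option (Σ o, (f o).Lab)
  | .loop _ p => Option p.Lab

/-- The label at which the machine compiled from a program is entered. -/
def Prog.entry : (p : Prog Γ) → p.Lab
  | .skip => ()
  | .push _ _ => ()
  | .pop _ => ()
  | .seq p _ => Sum.inl p.entry
  | .case _ _ => none
  | .loop _ _ => none

/-- Programs over finite alphabets have finitely many labels. -/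
@[reducible]
noncomputable def Prog.labFintype [∀ k, Fintype (Γ k)] : (p : Prog Γ) → Fintype p.Lab
  | .skip => inferInstanceAs (Fintype Unit)
  | .push _ _ => inferInstanceAs (Fintype Unit)
  | .pop _ => inferInstanceAs (Fintype Unit)
  | .seq p q =>
      letI := p.labFintype
      letI := q.labFintype
      inferInstanceAs (Fintype (p.Lab ⊕ q.Lab))
  | .case _ f =>
      letI := fun o => (f o).labFintype
      inferInstanceAs (Fintype (Option (Σ o, (f o).Lab)))
  | .loop _ p =>
      letI := p.labFintype
      inferInstanceAs (Fintype (Option p.Lab))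

variable [DecidableEq K]

/-- The statements of the machine compiled from a program. The labels of the program are embedded
by `emb` into those of the whole machine, which goes on at `exit` when the program ends. The
internal state of the machine remembers the symbol last seen on each stack. -/
def Prog.stmt {Λ : Type} : (p : Prog Γ) → (p.Lab → Λ) → Λ → p.Lab →
    Turing.TM2.Stmt Γ Λ (∀ k, Option (Γ k))
  | .skip, _, exit, _ => .goto fun _ => exit
  | .push k a, _, exit, _ => .push k (fun _ => a) (.goto fun _ => exit)
  | .pop k, _, exit, _ => .pop k (fun s _ => s) (.goto fun _ => exit)
  | .seq p q, emb, exit, l =>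
      match l with
      | .inl l => p.stmt (fun l => emb (.inl l)) (emb (.inr q.entry)) l
      | .inr l => q.stmt (fun l => emb (.inr l)) exit l
  | .case k f, emb, exit, l =>
      match l with
      | none => .peek k (fun s o => update s k o)
          (.goto fun s => emb (some ⟨s k, (f (s k)).entry⟩))
      | some ⟨o, l⟩ => (f o).stmt (fun l => emb (some ⟨o, l⟩)) exit l
  | .loop k p, emb, exit, l =>
      match l with
      | none => .peek k (fun s o => update s k o)
          (.goto fun s => if (s k).isSome then emb (some p.entry) else exit)
      | some l => p.stmt (fun l => emb (some l)) (emb none) l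

/-- The machine `m` goes from `c` to `c'` in `t` steps. -/
def Steps {Λ σ : Type} (m : Λ → Turing.TM2.Stmt Γ Λ σ) (t : ℕ) (c c' : Turing.TM2.Cfg Γ Λ σ) :
    Prop :=
  (flip bind (Turing.TM2.step m))^[t] (some c) = some c'

theorem Steps.trans {Λ σ : Type} {m : Λ → Turing.TM2.Stmt Γ Λ σ} {t u : ℕ}
    {a b c : Turing.TM2.Cfg Γ Λ σ} (h₁ : Steps m t a b) (h₂ : Steps m u b c) :
    Steps m (t + u) a c := by
  unfold Steps at *
  rw [Nat.add_comm, Function.iterate_add_apply, h₁, h₂]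

theorem Steps.one {Λ σ : Type} {m : Λ → Turing.TM2.Stmt Γ Λ σ} {l : Λ} {v : σ} {S : Store Γ}
    {c : Turing.TM2.Cfg Γ Λ σ} (h : Turing.TM2.stepAux (m l) v S = c) :
    Steps m 1 ⟨some l, v, S⟩ c := by
  subst h; rfl

/-- The compiled machine follows the runs of the program, step by step. -/
theorem Run.steps {p : Prog Γ} {S T : Store Γ} {t : ℕ} (h : Run p S T t) :
    ∀ {Λ : Type} (m : Λ → Turing.TM2.Stmt Γ Λ (∀ k, Option (Γ k))) (emb : p.Lab → Λ) (exit : Λ)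
      (_ : ∀ l, m (emb l) = p.stmt emb exit l) (v : ∀ k, Option (Γ k)),
      ∃ v', Steps m t ⟨some (emb p.entry), v, S⟩ ⟨some exit, v', T⟩ := by
  induction h with
  | skip S =>
    intro Λ m emb exit hm v
    exact ⟨v, .one (by rw [hm]; rfl)⟩
  | push S k a =>
    intro Λ m emb exit hm v
    exact ⟨v, .one (by rw [hm]; rfl)⟩
  | pop S k =>
    intro Λ m emb exit hm v
    exact ⟨v, .one (by rw [hm]; rfl)⟩
  | seq h₁ h₂ ih₁ ih₂ =>
    rename_i p q S T U t u
    intro Λ m emb exit hm v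
    obtain ⟨v₁, s₁⟩ := ih₁ m (fun l => emb (.inl l)) (emb (.inr q.entry))
      (fun l => hm (.inl l)) v
    obtain ⟨v₂, s₂⟩ := ih₂ m (fun l => emb (.inr l)) exit (fun l => hm (.inr l)) v₁
    exact ⟨v₂, s₁.trans s₂⟩
  | case h ih =>
    rename_i k f S T t
    intro Λ m emb exit hm v
    obtain ⟨v₁, s₁⟩ := ih m (fun l => emb (some ⟨_, l⟩)) exit (fun l => hm (some ⟨_, l⟩))
      (update v k (S k).head?)
    refine ⟨v₁, Steps.trans (.one ?_) s₁⟩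
    refine (congrArg (fun q => Turing.TM2.stepAux q v S) (hm (Prog.case k f).entry)).trans ?_
    simp only [Prog.stmt, Prog.entry, Turing.TM2.stepAux]
    have : ∀ o o' : Option (Γ k), o = o' →
      (emb (some ⟨o, (f o).entry⟩) : Λ) = emb (some ⟨o', (f o').entry⟩) := by
      rintro o _ rfl; rfl
    rw [this _ _ (update_self k _ v)]
  | loop_done h =>
    rename_i k p S
    intro Λ m emb exit hm v
    refine ⟨update v k none, .one ?_⟩
    refine (congrArg (fun q => Turing.TM2.stepAux q v S) (hm (Prog.loop k p).entry)).trans ?_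
    simp [Prog.stmt, Prog.entry, Turing.TM2.stepAux, h]
  | loop_step h h₁ h₂ ih₁ ih₂ =>
    rename_i k p S T U t u
    intro Λ m emb exit hm v
    obtain ⟨v₁, s₁⟩ := ih₁ m (fun l => emb (some l)) (emb none)
      (fun l => hm (some l)) (update v k (S k).head?)
    obtain ⟨v₂, s₂⟩ := ih₂ m emb exit hm v₁
    refine ⟨v₂, Steps.trans (.one ?_) (s₁.trans s₂)⟩
    refine (congrArg (fun q => Turing.TM2.stepAux q v S) (hm (Prog.loop k p).entry)).trans ?_
    have : (S k).head?.isSome := by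
      cases hS : S k with
      | nil => exact absurd hS h
      | cons a l => rfl
    simp [Prog.stmt, Prog.entry, Turing.TM2.stepAux, this]

/-- The bundled machine compiled from a program. It halts, and forgets its internal state, when the
program ends. -/
noncomputable def Prog.machine [Fintype K] [∀ k, Fintype (Γ k)] (p : Prog Γ) (kin kout : K) :
    Turing.FinTM2 where
  K := K
  k₀ := kin
  k₁ := kout
  Γ := Γ
  Λ := Option p.Lab
  main := some p.entry
  ΛFin := letI := p.labFintype; inferInstance
  σ := ∀ k, Option (Γ k)
  initialState := fun _ => none
  σFin := inferInstance
  m := fun l => match l with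
    | none => .load (fun _ _ => none) .halt
    | some l => p.stmt some none l

theorem Run.machine_evals [Fintype K] [∀ k, Fintype (Γ k)] {p : Prog Γ} {kin kout : K}
    {S T : Store Γ} {t : ℕ} (h : Run p S T t) :
    (flip bind (p.machine kin kout).step)^[t + 1]
      (some ⟨some (some p.entry), fun _ => none, S⟩) = some ⟨none, fun _ => none, T⟩ := by
  obtain ⟨v, hv⟩ := h.steps (p.machine kin kout).m some none (fun l => rfl) (fun _ => none)
  refine hv.trans (.one ?_)
  rfl

end Compile

/-! ### Renaming stacks -/

section Rename

variable {K K' : Type} {Γ : K' → Type}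

/-- The program obtained by renaming the stacks. -/
def Prog.map (ι : K → K') : Prog (fun k => Γ (ι k)) → Prog Γ
  | .skip => .skip
  | .push k a => .push (ι k) a
  | .pop k => .pop (ι k)
  | .seq p q => .seq (p.map ι) (q.map ι)
  | .case k f => .case (ι k) fun o => (f o).map ι
  | .loop k p => .loop (ι k) (p.map ι)

/-- The contents of all stacks after those named by `ι` have been replaced. -/
noncomputable def Store.splice (ι : K → K') (S : Store Γ) (T : Store fun k => Γ (ι k)) : Store Γ :=
  open Classical in fun k' => if h : ∃ k, ι k = k' then h.choose_spec ▸ T h.choose else S k'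

theorem Store.splice_apply {ι : K → K'} (hι : Injective ι) (S : Store Γ)
    (T : Store fun k => Γ (ι k)) (k : K) : Store.splice ι S T (ι k) = T k := by
  have h : ∃ j, ι j = ι k := ⟨k, rfl⟩
  have key : ∀ (j : K) (e : ι j = ι k), (e ▸ T j : List (Γ (ι k))) = T k := by
    intro j e
    obtain rfl := hι e
    rfl
  rw [Store.splice, dif_pos h]
  exact key _ _

theorem Store.splice_of_notMem {ι : K → K'} (S : Store Γ) (T : Store fun k => Γ (ι k)) {k' : K'}
    (h : ∀ k, ι k ≠ k') : Store.splice ι S T k' = S k' := by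
  rw [Store.splice, dif_neg (by simpa using h)]

theorem Store.splice_eq {ι : K → K'} (hι : Injective ι) {S : Store Γ}
    {T : Store fun k => Γ (ι k)} {S' : Store Γ} (h₁ : ∀ k, S' (ι k) = T k)
    (h₂ : ∀ k', (∀ k, ι k ≠ k') → S' k' = S k') : Store.splice ι S T = S' := by
  funext k'
  by_cases h : ∃ k, ι k = k'
  · obtain ⟨k, rfl⟩ := h
    rw [Store.splice_apply hι, h₁]
  · push Not at h
    rw [Store.splice_of_notMem _ _ h, h₂ _ h]

variable [DecidableEq K] [DecidableEq K']

theorem Store.splice_update {ι : K → K'} (hι : Injective ι) (S : Store Γ)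
    (T : Store fun k => Γ (ι k)) (k : K) (l : List (Γ (ι k))) :
    Store.splice ι S (update T k l) = update (Store.splice ι S T) (ι k) l := by
  refine Store.splice_eq hι (fun j => ?_) (fun k' h => ?_)
  · by_cases e : j = k
    · subst e; simp
    · rw [update_of_ne (fun h => e (hι h)), update_of_ne e, Store.splice_apply hι]
  · rw [update_of_ne (h k).symm, Store.splice_of_notMem _ _ h]

theorem Run.map {ι : K → K'} (hι : Injective ι) {p : Prog fun k => Γ (ι k)}
    {S T : Store fun k => Γ (ι k)} {t : ℕ} (h : Run p S T t) (R : Store Γ) :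
    Run (p.map ι) (Store.splice ι R S) (Store.splice ι R T) t := by
  induction h with
  | skip S => exact .skip _
  | push S k a =>
    rw [Store.splice_update hι, ← Store.splice_apply hι R S k]
    exact .push _ _ _
  | pop S k =>
    rw [Store.splice_update hι, ← Store.splice_apply hι R S k]
    exact .pop _ _
  | seq h₁ h₂ ih₁ ih₂ => exact .seq ih₁ ih₂
  | case h ih =>
    refine .case (f := fun o => Prog.map ι _) ?_
    rw [Store.splice_apply hι]
    exact ih
  | loop_done h => exact .loop_done (by rw [Store.splice_apply hι]; exact h)
  | loop_step h h₁ h₂ ih₁ ih₂ =>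
    exact .loop_step (by rw [Store.splice_apply hι]; exact h) ih₁ ih₂

end Rename

/-! ### Polynomial bounds -/

/-- `f` is bounded by a polynomial in `N`. -/
def PolyBdd {X : Type} (N f : X → ℕ) : Prop :=
  ∃ q : Polynomial ℕ, ∀ x, f x ≤ q.eval (N x)

theorem polynomial_eval_mono (q : Polynomial ℕ) {a b : ℕ} (h : a ≤ b) : q.eval a ≤ q.eval b := by
  rw [Polynomial.eval_eq_sum, Polynomial.eval_eq_sum]
  exact Finset.sum_le_sum fun i _ => Nat.mul_le_mul_left _ (Nat.pow_le_pow_left h i)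

namespace PolyBdd

variable {X Y : Type} {N f g : X → ℕ}

theorem of_le (hg : PolyBdd N g) (h : ∀ x, f x ≤ g x) : PolyBdd N f :=
  let ⟨q, hq⟩ := hg
  ⟨q, fun x => (h x).trans (hq x)⟩

theorem self (N : X → ℕ) : PolyBdd N N := ⟨Polynomial.X, fun x => by simp⟩

theorem const (N : X → ℕ) (c : ℕ) : PolyBdd N fun _ => c := ⟨Polynomial.C c, fun x => by simp⟩

theorem add (hf : PolyBdd N f) (hg : PolyBdd N g) : PolyBdd N fun x => f x + g x :=
  let ⟨p, hp⟩ := hf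
  let ⟨q, hq⟩ := hg
  ⟨p + q, fun x => by rw [Polynomial.eval_add]; exact Nat.add_le_add (hp x) (hq x)⟩

theorem mul (hf : PolyBdd N f) (hg : PolyBdd N g) : PolyBdd N fun x => f x * g x :=
  let ⟨p, hp⟩ := hf
  let ⟨q, hq⟩ := hg
  ⟨p * q, fun x => by rw [Polynomial.eval_mul]; exact Nat.mul_le_mul (hp x) (hq x)⟩

theorem reindex (hf : PolyBdd N f) (g : Y → X) : PolyBdd (fun y => N (g y)) fun y => f (g y) :=
  let ⟨q, hq⟩ := hf
  ⟨q, fun y => hq (g y)⟩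

end PolyBdd

/-! ### Families of runs in polynomial time -/

/-- Some program turns, for every `x`, the stacks `s x` into the stacks `s' x` in a number of steps
bounded by a polynomial in `N x`. -/
def Comp {X K : Type} [DecidableEq K] {Γ : K → Type} (N : X → ℕ) (s s' : X → Store Γ) : Prop :=
  ∃ p : Prog Γ, ∃ q : Polynomial ℕ, ∀ x, ∃ t ≤ q.eval (N x), Run p (s x) (s' x) t

namespace Comp

variable {X Y K : Type} [DecidableEq K] {Γ : K → Type} {N : X → ℕ} {s s' s'' : X → Store Γ}

theorem refl (N : X → ℕ) (s : X → Store Γ) : Comp N s s :=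
  ⟨.skip, 1, fun _ => ⟨1, by simp, .skip _⟩⟩

theorem of_eq (h : ∀ x, s x = s' x) : Comp N s s' := by
  obtain rfl : s = s' := funext h
  exact refl N s

theorem trans (h : Comp N s s') (h' : Comp N s' s'') : Comp N s s'' := by
  obtain ⟨p, q, hp⟩ := h
  obtain ⟨p', q', hp'⟩ := h'
  refine ⟨.seq p p', q + q', fun x => ?_⟩
  obtain ⟨t, ht, r⟩ := hp x
  obtain ⟨t', ht', r'⟩ := hp' x
  exact ⟨t + t', by rw [Polynomial.eval_add]; exact Nat.add_le_add ht ht', .seq r r'⟩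

theorem push (N : X → ℕ) (s : X → Store Γ) (k : K) (a : Γ k) :
    Comp N s fun x => update (s x) k (a :: s x k) :=
  ⟨.push k a, 1, fun _ => ⟨1, by simp, .push _ _ _⟩⟩

theorem pop (N : X → ℕ) (s : X → Store Γ) (k : K) :
    Comp N s fun x => update (s x) k (s x k).tail :=
  ⟨.pop k, 1, fun _ => ⟨1, by simp, .pop _ _⟩⟩

theorem reindex (h : Comp N s s') (g : Y → X) :
    Comp (fun y => N (g y)) (fun y => s (g y)) fun y => s' (g y) :=
  let ⟨p, q, hp⟩ := h
  ⟨p, q, fun y => hp (g y)⟩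

theorem mono {M : X → ℕ} (hM : PolyBdd N M) (h : Comp M s s') : Comp N s s' := by
  obtain ⟨p, q, hp⟩ := h
  obtain ⟨r, hr⟩ := hM
  refine ⟨p, q.comp r, fun x => ?_⟩
  obtain ⟨t, ht, run⟩ := hp x
  exact ⟨t, by
    rw [Polynomial.eval_comp]
    exact ht.trans (polynomial_eval_mono q (hr x)), run⟩

theorem pushList (N : X → ℕ) (s : X → Store Γ) (k : K) (l : List (Γ k)) :
    Comp N s fun x => update (s x) k (l ++ s x k) := by
  induction l with
  | nil => exact of_eq fun x => by simp
  | cons a l ih =>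
    refine ih.trans ((push N _ k a).trans (of_eq fun x => ?_))
    simp

/-- A program may branch on the top of a stack with a finite alphabet. -/
theorem case [∀ k, Fintype (Γ k)] (k : K)
    (h : ∀ o : Option (Γ k), Comp (fun x : {x // (s x k).head? = o} => N x) (fun x => s x)
      (fun x => s' x)) : Comp N s s' := by
  choose p q hp using h
  refine ⟨.case k p, 1 + ∑ o, q o, fun x => ?_⟩
  obtain ⟨t, ht, r⟩ := hp _ ⟨x, rfl⟩
  refine ⟨1 + t, ?_, .case r⟩
  rw [Polynomial.eval_add, Polynomial.eval_one, Polynomial.eval_finsetSum]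
  refine Nat.add_le_add_left (ht.trans ?_) 1
  exact Finset.single_le_sum (f := fun o => (q o).eval (N x)) (fun _ _ => Nat.zero_le _)
    (Finset.mem_univ _)

/-- A loop whose number of rounds and whose rounds are polynomially bounded. -/
theorem loop (k : K) {σ : X → ℕ → Store Γ} {len : X → ℕ} (hlen : PolyBdd N len)
    (hne : ∀ x i, i < len x → σ x i k ≠ []) (hnil : ∀ x, σ x (len x) k = [])
    (body : Comp (fun y : {y : X × ℕ // y.2 < len y.1} => N y.1.1) (fun y => σ y.1.1 y.1.2)
      (fun y => σ y.1.1 (y.1.2 + 1))) :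
    Comp N (fun x => σ x 0) (fun x => σ x (len x)) := by
  obtain ⟨p, q, hp⟩ := body
  obtain ⟨r, hr⟩ := hlen
  refine ⟨.loop k p, r * (1 + q) + 1, fun x => ?_⟩
  have key : ∀ j ≤ len x, ∃ t ≤ j * (1 + q.eval (N x)) + 1,
      Run (.loop k p) (σ x (len x - j)) (σ x (len x)) t := by
    intro j
    induction j with
    | zero => exact fun _ => ⟨1, by simp, .loop_done (hnil x)⟩
    | succ j ih =>
      intro hj
      obtain ⟨t, ht, run⟩ := ih (by omega)
      obtain ⟨u, hu, run'⟩ := hp ⟨(x, len x - (j + 1)), by simp; omega⟩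
      refine ⟨1 + (u + t), ?_, .loop_step (hne _ _ (by omega)) run' ?_⟩
      · simp only at hu
        rw [Nat.succ_mul]
        omega
      · simp only
        rwa [show len x - (j + 1) + 1 = len x - j by omega]
  obtain ⟨t, ht, run⟩ := key _ le_rfl
  refine ⟨t, ht.trans ?_, by simpa using run⟩
  simp only [Polynomial.eval_add, Polynomial.eval_mul, Polynomial.eval_one]
  exact Nat.add_le_add_right (Nat.mul_le_mul_right _ (hr x)) 1

theorem map {J : Type} [DecidableEq J] {ι : J → K} (hι : Injective ι)
    {r r' : X → Store fun j => Γ (ι j)} (h : Comp N r r') (h₀ : ∀ x j, s x (ι j) = r x j)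
    (h₁ : ∀ x j, s' x (ι j) = r' x j) (h₂ : ∀ x k, (∀ j, ι j ≠ k) → s' x k = s x k) :
    Comp N s s' := by
  obtain ⟨p, q, hp⟩ := h
  refine ⟨p.map ι, q, fun x => ?_⟩
  obtain ⟨t, ht, run⟩ := hp x
  have := run.map hι (s x)
  rw [Store.splice_eq hι (S' := s x) (h₀ x) (fun _ _ => rfl),
    Store.splice_eq hι (h₁ x) (h₂ x)] at this
  exact ⟨t, ht, this⟩

/-- Emptying a stack. -/
theorem clear (k : K) (hk : PolyBdd N fun x => (s x k).length) :
    Comp N s fun x => update (s x) k [] := by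
  have h := loop (N := N) k (σ := fun x i => update (s x) k ((s x k).drop i))
    (len := fun x => (s x k).length) hk
    (fun x i hi => by simpa using hi) (fun x => by simp)
    ((pop _ _ k).trans (of_eq fun y => by simp [List.tail_drop]))
  refine (of_eq fun x => ?_).trans (h.trans (of_eq fun x => ?_)) <;> simp

/-- Emptying finitely many stacks. -/
theorem clearFinset (J : Finset K) (hJ : ∀ k ∈ J, PolyBdd N fun x => (s x k).length) :
    (∀ x k, k ∈ J → s' x k = []) → (∀ x k, k ∉ J → s' x k = s x k) → Comp N s s' := by
  induction J using Finset.induction_on generalizing s' with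
  | empty => exact fun _ h => of_eq fun x => funext fun k => (h x k (by simp)).symm
  | insert a J ha ih =>
    intro h₁ h₂
    refine (ih (s' := fun x => update (s' x) a (s x a)) (fun k hk => hJ k (by simp [hk]))
      (fun x k hk => ?_) (fun x k hk => ?_)).trans ((clear a ?_).trans (of_eq fun x => ?_))
    · rw [update_of_ne (by rintro rfl; exact ha hk)]
      exact h₁ x k (by simp [hk])
    · by_cases e : k = a
      · subst e; simp
      · rw [update_of_ne e]
        exact h₂ x k (by simp [hk, e])
    · simpa using hJ a (by simp)
    · simp [h₁ x a]

/-- Emptying the stacks named by `b`. -/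
theorem clearFam {J : Type} [Fintype J] (b : J → K)
    (hb : ∀ j, PolyBdd N fun x => (s x (b j)).length) (h₁ : ∀ x j, s' x (b j) = [])
    (h₂ : ∀ x k, (∀ j, b j ≠ k) → s' x k = s x k) : Comp N s s' := by
  refine clearFinset (Finset.univ.image b) (fun k hk => ?_) (fun x k hk => ?_) (fun x k hk => ?_)
  · obtain ⟨j, -, rfl⟩ := Finset.mem_image.1 hk
    exact hb j
  · obtain ⟨j, -, rfl⟩ := Finset.mem_image.1 hk
    exact h₁ x j
  · exact h₂ x k (by simpa using hk)

end Comp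

/-- Binary stacks. -/
abbrev BStore (K : Type) : Type := Store fun _ : K => Bool

namespace Comp

variable {X K : Type} [DecidableEq K] {N : X → ℕ} {s s' : X → BStore K}

/-- Copying a stack to an empty one, by means of an empty auxiliary stack. -/
theorem copy {a b c : K} (hab : a ≠ b) (hac : a ≠ c) (hbc : b ≠ c)
    (ha : PolyBdd N fun x => (s x a).length) (hb : ∀ x, s x b = []) (hc : ∀ x, s x c = []) :
    Comp N s fun x => update (s x) b (s x a) := by
  -- the first loop reverses `a` onto `c`, the second one reverses `c` onto `a` and `b`
  have h₁ := loop (N := N) a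
    (σ := fun x i => update (update (s x) c ((s x a).take i).reverse) a ((s x a).drop i))
    (len := fun x => (s x a).length) ha (fun x i hi => by simpa using hi) (fun x => by simp) (by
      refine case a fun o => ?_
      cases o with
      | none =>
        exact of_eq fun ⟨⟨⟨x, i⟩, h⟩, h'⟩ => by
          exfalso
          simp at h h'
          omega
      | some v =>
        refine (push _ _ c v).trans ((pop _ _ a).trans (of_eq fun ⟨⟨⟨x, i⟩, h⟩, h'⟩ => ?_))
        have hv : (s x a)[i]? = some v := by simpa [List.head?_drop] using h'
        funext k
        by_cases e : k = a
        · subst e; simp [hac, List.tail_drop]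
        by_cases e' : k = c
        · subst e'; simp [hac.symm, List.take_add_one, hv]
        simp [e, e'])
  have h₂ := loop (N := N) c
    (σ := fun x i => update (update (update (s x) c ((s x a).reverse.drop i))
      a ((s x a).reverse.take i).reverse) b ((s x a).reverse.take i).reverse)
    (len := fun x => (s x a).length) ha
    (fun x i hi => by simpa [hbc.symm, hac.symm] using hi)
    (fun x => by simp [hbc.symm, hac.symm]) (by
      refine case c fun o => ?_
      cases o with
      | none =>
        exact of_eq fun ⟨⟨⟨x, i⟩, h⟩, h'⟩ => by
          exfalso
          simp [hbc.symm, hac.symm] at h h'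
          omega
      | some v =>
        refine (push _ _ a v).trans ((push _ _ b v).trans
          ((pop _ _ c).trans (of_eq fun ⟨⟨⟨x, i⟩, h⟩, h'⟩ => ?_)))
        have hv : (s x a).reverse[i]? = some v := by
          rw [update_of_ne hbc.symm, update_of_ne hac.symm, update_self, List.head?_drop] at h'
          exact h'
        funext k
        by_cases e : k = c
        · subst e; simp [hac.symm, hbc.symm, List.tail_drop]
        by_cases e' : k = b
        · subst e'; simp [hab.symm, hbc, List.take_add_one, hv]
        by_cases e'' : k = a
        · subst e''; simp [hab, hac, List.take_add_one, hv]
        simp [e, e', e''])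
  refine (of_eq fun x => ?_).trans (h₁.trans ((of_eq fun x => ?_).trans (h₂.trans
    (of_eq fun x => ?_))))
  · funext k
    by_cases e : k = a
    · subst e; simp
    by_cases e' : k = c
    · subst e'; simp [hac.symm, hc]
    simp [e, e']
  · funext k
    by_cases e : k = a
    · subst e; simp [hab]
    by_cases e' : k = b
    · subst e'; simp [hab.symm, hbc, hb]
    by_cases e'' : k = c
    · subst e''; simp [hac.symm, hbc.symm]
    simp [e, e', e'']
  · funext k
    by_cases e : k = a
    · subst e
      rw [update_of_ne hab, update_self, List.take_of_length_le (by simp), List.reverse_reverse,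
        update_of_ne hab]
    by_cases e' : k = b
    · subst e'
      rw [update_self, update_self, List.take_of_length_le (by simp), List.reverse_reverse]
    by_cases e'' : k = c
    · subst e''; simp [hac.symm, hbc.symm, hc]
    simp [e, e', e'']

/-- Copying the stacks named by `a` to the empty ones named by `b`. -/
theorem copyFam {J : Type} [Fintype J] {a b : J → K} {c : K} (hbi : Injective b)
    (hab : ∀ i j, a i ≠ b j) (hac : ∀ j, a j ≠ c) (hbc : ∀ j, b j ≠ c)
    (ha : ∀ j, PolyBdd N fun x => (s x (a j)).length) (hb : ∀ x j, s x (b j) = [])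
    (hc : ∀ x, s x c = []) (h₁ : ∀ x j, s' x (b j) = s x (a j))
    (h₂ : ∀ x k, (∀ j, b j ≠ k) → s' x k = s x k) : Comp N s s' := by
  classical
  have key : ∀ (J' : Finset J) (s' : X → BStore K),
      (∀ x, ∀ j ∈ J', s' x (b j) = s x (a j)) →
      (∀ x k, (∀ j ∈ J', b j ≠ k) → s' x k = s x k) → Comp N s s' := by
    intro J'
    induction J' using Finset.induction_on with
    | empty => exact fun s' _ h => of_eq fun x => funext fun k => (h x k (by simp)).symm
    | insert i J' hi ih =>
      intro s' h₁ h₂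
      have hbi' : ∀ j ∈ J', b j ≠ b i := fun j hj e => hi (hbi e ▸ hj)
      refine (ih (fun x => update (s' x) (b i) []) (fun x j hj => ?_) (fun x k hk => ?_)).trans
        ((copy (a := a i) (b := b i) (c := c) (hab i i) (hac i) (hbc i) ?_ (by simp) ?_).trans
          (of_eq fun x => ?_))
      · rw [update_of_ne (hbi' j hj), h₁ x j (by simp [hj])]
      · by_cases e : k = b i
        · subst e; simp [hb]
        · rw [update_of_ne e]
          refine h₂ x k fun j hj => ?_
          rcases Finset.mem_insert.1 hj with rfl | hj
          exacts [Ne.symm e, hk j hj]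
      · refine (ha i).of_le fun x => le_of_eq ?_
        rw [update_of_ne (hab i i), h₂ x _ fun j _ => (hab i j).symm]
      · intro x
        rw [update_of_ne (hbc i).symm, h₂ x _ fun j _ => hbc j, hc]
      · rw [update_of_ne (hab i i), h₂ x _ fun j _ => (hab i j).symm,
          ← h₁ x i (by simp)]
        simp
  exact key Finset.univ s' (fun x j _ => h₁ x j) (fun x k hk => h₂ x k fun j => hk j (by simp))

end Comp

theorem Run.length_le {K : Type} [DecidableEq K] {Γ : K → Type} {p : Prog Γ} {S T : Store Γ}
    {t : ℕ} (h : Run p S T t) (k : K) : (T k).length ≤ (S k).length + t := by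
  induction h with
  | skip S => omega
  | push S j a =>
    by_cases e : k = j
    · subst e; simp
    · simp [e]
  | pop S j =>
    by_cases e : k = j
    · subst e; simp; omega
    · simp [e]
  | seq h₁ h₂ ih₁ ih₂ => omega
  | case h ih => omega
  | loop_done h => omega
  | loop_step h h₁ h₂ ih₁ ih₂ => omega

/-! ### Encodings -/

/-- A representation of the elements of `X` by the contents of finitely many binary stacks. -/
class Enc (X : Type) where
  /-- the names of the stacks -/
  Idx : Type
  [fintypeIdx : Fintype Idx]
  [decEqIdx : DecidableEq Idx]
  /-- the contents of the stacks -/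
  enc : X → Idx → List Bool

attribute [reducible, instance] Enc.fintypeIdx Enc.decEqIdx

open Enc (Idx enc)

/-- The total length of the stacks representing `x`. -/
def size {X : Type} [Enc X] (x : X) : ℕ := ∑ k, (enc x k).length

theorem length_enc_le_size {X : Type} [Enc X] (x : X) (k : Idx X) :
    (enc x k).length ≤ size x :=
  Finset.single_le_sum (f := fun k => (enc x k).length) (fun _ _ => Nat.zero_le _)
    (Finset.mem_univ k)

/-- The symbols of a finite alphabet in unary, with an end mark. -/
noncomputable def code {A : Type} [Fintype A] (a : A) : List Bool :=
  List.replicate (Fintype.equivFin A a) false ++ [true]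

/-- Words over a finite alphabet, symbol by symbol. -/
noncomputable def codes {A : Type} [Fintype A] (l : List A) : List Bool := l.flatMap code

noncomputable instance {A : Type} [Fintype A] : Enc (List A) where
  Idx := Unit
  enc l _ := codes l

instance {X Y : Type} [Enc X] [Enc Y] : Enc (X × Y) where
  Idx := Idx X ⊕ Idx Y
  enc p := Sum.elim (enc p.1) (enc p.2)

noncomputable instance : Enc Bool where
  Idx := Unit
  enc b _ := codes [b]

/-- Natural numbers in binary, least significant bit first. -/
noncomputable instance : Enc ℕ where
  Idx := Unit
  enc n _ := codes n.bits

theorem size_prod {X Y : Type} [Enc X] [Enc Y] (p : X × Y) : size p = size p.1 + size p.2 :=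
  Fintype.sum_sum_type _

theorem length_code_le {A : Type} [Fintype A] (a : A) : (code a).length ≤ Fintype.card A := by
  simp only [code, List.length_append, List.length_replicate, List.length_singleton]
  exact (Fintype.equivFin A a).2

theorem length_codes_le {A : Type} [Fintype A] (l : List A) :
    (codes l).length ≤ Fintype.card A * l.length := by
  induction l with
  | nil => simp [codes]
  | cons a l ih =>
    have := length_code_le a
    simp only [codes, List.flatMap_cons, List.length_append, List.length_cons, Nat.mul_succ] at *
    omega

theorem length_le_length_codes {A : Type} [Fintype A] (l : List A) :
    l.length ≤ (codes l).length := by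
  induction l with
  | nil => simp
  | cons a l ih =>
    simp only [codes, List.flatMap_cons, List.length_append, List.length_cons, code] at *
    omega

theorem size_list {A : Type} [Fintype A] (l : List A) : size l = (codes l).length := by
  show ∑ _ : Unit, _ = _
  simp [enc]

theorem size_list_le {A : Type} [Fintype A] (l : List A) :
    size l ≤ Fintype.card A * l.length :=
  (size_list l).trans_le (length_codes_le l)

theorem length_le_size {A : Type} [Fintype A] (l : List A) : l.length ≤ size l :=
  (length_le_length_codes l).trans_eq (size_list l).symm

theorem size_bool_le (b : Bool) : size b ≤ 2 :=
  (size_list [b]).trans_le (length_codes_le [b])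

theorem size_nat_le (n : ℕ) : size n ≤ 2 * n.size := by
  rw [show n.size = n.bits.length from (Nat.size_eq_bits_len n).symm]
  exact (size_list n.bits).trans_le (length_codes_le n.bits)

/-! ### Reading a symbol -/

/-- Read the code of a symbol from the stack `k`, and go on with `g i`, where `i` is its number. -/
def readProg {K : Type} (k : K) (g : ℕ → Prog fun _ : K => Bool) :
    ℕ → ℕ → Prog fun _ : K => Bool
  | 0, _ => .skip
  | n + 1, j => .case k fun o => match o with
    | none => .skip
    | some true => .seq (.pop k) (g j)
    | some false => .seq (.pop k) (readProg k g n (j + 1))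

theorem run_readProg {K : Type} [DecidableEq K] {k : K} {g : ℕ → Prog fun _ : K => Bool}
    {r : List Bool} {T : BStore K} {t : ℕ} (i : ℕ) :
    ∀ {n j : ℕ} {S : BStore K}, S k = List.replicate i false ++ true :: r → i < n →
      Run (g (j + i)) (update S k r) T t → Run (readProg k g n j) S T (2 * (i + 1) + t) := by
  induction i with
  | zero =>
    intro n j S hS hn run
    obtain ⟨n, rfl⟩ : ∃ m, n = m + 1 := ⟨n - 1, by omega⟩
    rw [show 2 * (0 + 1) + t = 1 + (1 + t) by omega]
    refine .case ?_
    rw [hS]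
    refine .seq (.pop _ _) ?_
    rw [hS]
    exact run
  | succ i ih =>
    intro n j S hS hn run
    obtain ⟨n, rfl⟩ : ∃ m, n = m + 1 := ⟨n - 1, by omega⟩
    rw [show 2 * (i + 1 + 1) + t = 1 + (1 + (2 * (i + 1) + t)) by omega]
    refine .case ?_
    rw [hS]
    refine .seq (.pop _ _) (ih ?_ (by omega) ?_)
    · simp [hS, List.replicate_succ]
    · rw [update_idem, show j + 1 + i = j + (i + 1) by omega]
      exact run

namespace Comp

variable {X K : Type} [DecidableEq K] {N : X → ℕ} {s s' : X → BStore K}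

/-- A program may remove the first symbol of a word, and branch on it. -/
theorem read {A : Type} [Fintype A] (k : K) (l : X → List A) (hk : ∀ x, s x k = codes (l x))
    (h : ∀ o : Option A, Comp (fun x : {x // (l x).head? = o} => N x)
      (fun x => update (s x) k (codes (l x).tail)) (fun x => s' x)) : Comp N s s' := by
  choose p q hp using h
  let g : ℕ → Prog fun _ : K => Bool := fun j =>
    if hj : j < Fintype.card A then p (some ((Fintype.equivFin A).symm ⟨j, hj⟩)) else .skip
  refine ⟨.case k fun o => match o with
    | none => p none
    | some _ => readProg k g (Fintype.card A) 0,
    (2 * Fintype.card A + 1 : ℕ) + ∑ o, q o, fun x => ?_⟩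
  obtain ⟨t, ht, run⟩ := hp _ ⟨x, rfl⟩
  have ht' : t ≤ ∑ o, (q o).eval (N x) := ht.trans <|
    Finset.single_le_sum (f := fun o => (q o).eval (N x)) (fun _ _ => Nat.zero_le _)
      (Finset.mem_univ _)
  simp only [Polynomial.eval_add, Polynomial.eval_natCast, Polynomial.eval_finsetSum, Nat.cast_id]
  rcases hl : l x with - | ⟨a, r⟩
  · refine ⟨1 + t, by omega, .case ?_⟩
    have hS : s x k = [] := by rw [hk, hl]; rfl
    simp only [hl, List.head?_nil] at run
    rw [hS]
    have : update (s x) k (codes ([] : List A).tail) = s x := by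
      rw [show codes ([] : List A).tail = s x k by rw [hS]; rfl, update_eq_self]
    rw [this] at run
    exact run
  · have hS : s x k = List.replicate (Fintype.equivFin A a) false ++ true :: codes r := by
      rw [hk, hl]; simp [codes, code]
    have hlt := (Fintype.equivFin A a).2
    refine ⟨1 + (2 * ((Fintype.equivFin A a : ℕ) + 1) + t), by omega, .case ?_⟩
    have hh : ∃ v, (s x k).head? = some v := by
      rw [hS]
      cases (Fintype.equivFin A a : ℕ) <;> simp [List.replicate_succ]
    obtain ⟨v, hv⟩ := hh
    rw [hv]
    refine run_readProg _ hS hlt ?_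
    simp only [hl, List.head?_cons, List.tail_cons] at run
    simpa [g] using run

end Comp

/-! ### Functions computable in polynomial time -/

/-- Stacks for an input, an output and auxiliary data. -/
def ioStore {I J L : Type} (a : I → List Bool) (b : J → List Bool) (c : L → List Bool) :
    BStore (I ⊕ J ⊕ L) :=
  Sum.elim a (Sum.elim b c)

/-- `f` is computed in polynomial time by a program with auxiliary stacks `L`. The program starts
and ends with empty auxiliary stacks, and it preserves its input. -/
def PTWith (L : Type) [DecidableEq L] {X Y : Type} [Enc X] [Enc Y] (f : X → Y) : Prop :=
  Comp size (fun x => ioStore (enc x) (fun _ : Idx Y => []) (fun _ : L => []))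
    (fun x => ioStore (enc x) (enc (f x)) (fun _ : L => []))

/-- `f` is computable in polynomial time. -/
def PT {X Y : Type} [Enc X] [Enc Y] (f : X → Y) : Prop :=
  ∃ (L : Type) (_ : Fintype L) (_ : DecidableEq L), PTWith L f

section Call

variable {X Y : Type} [Enc X] [Enc Y] {f : X → Y}

/-- A program for `f`, called inside a program with more stacks. -/
theorem PTWith.call {L : Type} [DecidableEq L] (hf : PTWith L f) {Z K : Type} [DecidableEq K]
    {N : Z → ℕ} {g : Z → X} (hg : PolyBdd N fun z => size (g z)) {ι : Idx X ⊕ Idx Y ⊕ L → K}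
    (hι : Injective ι) {s s' : Z → BStore K}
    (h₀ : ∀ z j, s z (ι j) = ioStore (enc (g z)) (fun _ : Idx Y => []) (fun _ : L => []) j)
    (h₁ : ∀ z j, s' z (ι j) = ioStore (enc (g z)) (enc (f (g z))) (fun _ : L => []) j)
    (h₂ : ∀ z k, (∀ j, ι j ≠ k) → s' z k = s z k) : Comp N s s' :=
  Comp.map (Γ := fun _ => Bool) hι (Comp.mono hg (Comp.reindex hf g)) h₀ h₁ h₂

theorem PT.size_le (hf : PT f) : PolyBdd size fun x => size (f x) := by
  obtain ⟨L, _, _, p, q, hp⟩ := hf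
  refine ((PolyBdd.const size (Fintype.card (Idx Y))).mul ⟨q, fun x => le_rfl⟩).of_le fun x => ?_
  refine (Finset.sum_le_card_nsmul _ _ (q.eval (size x)) fun k _ => ?_).trans (by simp)
  obtain ⟨t, ht, run⟩ := hp x
  have := run.length_le (.inr (.inl k))
  simp only [ioStore, Sum.elim_inr, Sum.elim_inl, List.length_nil, Nat.zero_add] at this
  exact this.trans ht

end Call

namespace PT

variable {X Y Z : Type} [Enc X] [Enc Y] [Enc Z]

/-- Rearranging the stacks of the input. -/
theorem wire {f : X → Y} (r : Idx Y → Idx X) (h : ∀ x k, enc (f x) k = enc x (r k)) : PT f := by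
  refine ⟨Unit, inferInstance, inferInstance, ?_⟩
  refine Comp.copyFam (a := fun j => .inl (r j)) (b := fun j => .inr (.inl j))
    (c := .inr (.inr ())) (fun i j h => by simpa using h) (by simp) (by simp) (by simp)
    (fun j => (PolyBdd.self _).of_le fun x => length_enc_le_size x _) (fun _ _ => rfl)
    (fun _ => rfl) (fun x j => h x j) ?_
  rintro x (k | k | k) hk
  exacts [rfl, (hk k rfl).elim, rfl]

theorem id : PT (fun x : X => x) := wire (fun k => k) fun _ _ => rfl

theorem fst : PT (fun p : X × Y => p.1) := wire .inl fun _ _ => rfl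

theorem snd : PT (fun p : X × Y => p.2) := wire .inr fun _ _ => rfl

theorem comp {g : Y → Z} {f : X → Y} (hg : PT g) (hf : PT f) : PT fun x => g (f x) := by
  have hfs := hf.size_le
  obtain ⟨L₁, _, _, hf⟩ := hf
  obtain ⟨L₂, _, _, hg⟩ := hg
  refine ⟨Idx Y ⊕ L₁ ⊕ L₂, inferInstance, inferInstance, ?_⟩
  refine Comp.trans (s' := fun x => ioStore (enc x) (fun _ => [])
      (ioStore (enc (f x)) (fun _ => []) (fun _ => [])))
    (hf.call (PolyBdd.self _)
      (ι := Sum.elim .inl (Sum.elim (fun k => .inr (.inr (.inl k)))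
        (fun k => .inr (.inr (.inr (.inl k)))))) ?_ ?_ ?_ ?_) ?_
  · rintro (a | a | a) (b | b | b) h <;> simp_all
  · rintro x (k | k | k) <;> rfl
  · rintro x (k | k | k) <;> rfl
  · rintro x (k | k | k | k | k) hk
    exacts [rfl, rfl, (hk (.inr (.inl k)) rfl).elim, rfl, rfl]
  refine Comp.trans (s' := fun x => ioStore (enc x) (enc (g (f x)))
      (ioStore (enc (f x)) (fun _ => []) (fun _ => [])))
    (hg.call (g := f) hfs
      (ι := Sum.elim (fun k => .inr (.inr (.inl k))) (Sum.elim (fun k => .inr (.inl k))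
        (fun k => .inr (.inr (.inr (.inr k)))))) ?_ ?_ ?_ ?_) ?_
  · rintro (a | a | a) (b | b | b) h <;> simp_all
  · rintro x (k | k | k) <;> rfl
  · rintro x (k | k | k) <;> rfl
  · rintro x (k | k | k | k | k) hk
    exacts [rfl, (hk (.inr (.inl k)) rfl).elim, rfl, rfl, rfl]
  refine Comp.clearFam (fun k : Idx Y => .inr (.inr (.inl k)))
    (fun k => hfs.of_le fun x => length_enc_le_size (f x) k) (fun _ _ => rfl) ?_
  rintro x (k | k | k | k | k) hk
  exacts [rfl, rfl, (hk k rfl).elim, rfl, rfl]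

theorem pair {f : X → Y} {g : X → Z} (hf : PT f) (hg : PT g) : PT fun x => (f x, g x) := by
  obtain ⟨L₁, _, _, hf⟩ := hf
  obtain ⟨L₂, _, _, hg⟩ := hg
  refine ⟨L₁ ⊕ L₂, inferInstance, inferInstance, ?_⟩
  refine Comp.trans (s' := fun x => ioStore (enc x) (Sum.elim (enc (f x)) (fun _ => []))
      (fun _ => []))
    (hf.call (PolyBdd.self _)
      (ι := Sum.elim .inl (Sum.elim (fun k => .inr (.inl (.inl k)))
        (fun k => .inr (.inr (.inl k))))) ?_ ?_ ?_ ?_)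
    (hg.call (PolyBdd.self _)
      (ι := Sum.elim .inl (Sum.elim (fun k => .inr (.inl (.inr k)))
        (fun k => .inr (.inr (.inr k))))) ?_ ?_ ?_ ?_)
  · rintro (a | a | a) (b | b | b) h <;> simp_all
  · rintro x (k | k | k) <;> rfl
  · rintro x (k | k | k) <;> rfl
  · rintro x (k | (k | k) | k | k) hk
    exacts [rfl, (hk (.inr (.inl k)) rfl).elim, rfl, rfl, rfl]
  · rintro (a | a | a) (b | b | b) h <;> simp_all
  · rintro x (k | k | k) <;> rfl
  · rintro x (k | k | k) <;> rfl
  · rintro x (k | (k | k) | k | k) hk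
    exacts [rfl, rfl, (hk (.inr (.inl k)) rfl).elim, rfl, rfl]

theorem nil {A : Type} [Fintype A] : PT fun _ : X => ([] : List A) :=
  ⟨Unit, inferInstance, inferInstance, Comp.of_eq fun x => by
    funext k; rcases k with k | k | k <;> rfl⟩

theorem cons {A : Type} [Fintype A] {l : X → List A} (a : A) (hl : PT l) :
    PT fun x => a :: l x := by
  suffices PT fun l : List A => a :: l from this.comp hl
  refine ⟨Unit, inferInstance, inferInstance, ?_⟩
  refine Comp.trans (s' := fun l => ioStore (enc l) (enc l) (fun _ : Unit => []))
    (Comp.copyFam (J := Unit) (a := .inl) (b := fun j => .inr (.inl j)) (c := .inr (.inr ()))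
    (fun i j h => rfl) (by simp) (by simp) (by simp)
    (fun j => (PolyBdd.self _).of_le fun x => length_enc_le_size x _) (fun _ _ => rfl)
    (fun _ => rfl) (fun x j => rfl) ?_)
    ((Comp.pushList _ _ (.inr (.inl ())) (code a)).trans (Comp.of_eq fun l => ?_))
  · rintro x (k | k | k) hk
    exacts [rfl, (hk k rfl).elim, rfl]
  · funext k
    rcases k with k | k | k <;> rfl

theorem constList {A : Type} [Fintype A] (l : List A) : PT fun _ : X => l := by
  induction l with
  | nil => exact nil
  | cons a l ih => exact ih.cons a

theorem constBool (b : Bool) : PT fun _ : X => b :=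
  ⟨Unit, inferInstance, inferInstance,
    (Comp.pushList _ _ (.inr (.inl ())) (codes [b])).trans (Comp.of_eq fun x => by
      funext k
      rcases k with k | ⟨⟩ | k
      exacts [rfl, List.append_nil _, rfl])⟩

theorem constNat (n : ℕ) : PT fun _ : X => n :=
  ⟨Unit, inferInstance, inferInstance,
    (Comp.pushList _ _ (.inr (.inl ())) (codes n.bits)).trans (Comp.of_eq fun x => by
      funext k
      rcases k with k | ⟨⟩ | k
      exacts [rfl, List.append_nil _, rfl])⟩

theorem bits : PT Nat.bits := wire (fun k => k) fun _ _ => rfl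

/-- A number is represented by the word of its digits, so it is enough to compute this word. -/
theorem of_bits {f : X → ℕ} (h : PT fun x => (f x).bits) : PT f :=
  h

theorem singleton {f : X → Bool} (h : PT f) : PT fun x => [f x] :=
  h

theorem tail {A : Type} [Fintype A] {l : X → List A} (hl : PT l) : PT fun x => (l x).tail := by
  suffices PT fun l : List A => l.tail from this.comp hl
  refine ⟨Unit, inferInstance, inferInstance, ?_⟩
  refine Comp.trans (s' := fun l => ioStore (enc l) (enc l) (fun _ : Unit => []))
    (Comp.copyFam (J := Unit) (a := .inl) (b := fun j => .inr (.inl j)) (c := .inr (.inr ()))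
    (fun i j h => rfl) (by simp) (by simp) (by simp)
    (fun j => (PolyBdd.self _).of_le fun x => length_enc_le_size x _) (fun _ _ => rfl)
    (fun _ => rfl) (fun x j => rfl) ?_)
    (Comp.read (.inr (.inl ())) (fun l => l) (fun _ => rfl) fun o => Comp.of_eq fun l => ?_)
  · rintro x (k | k | k) hk
    exacts [rfl, (hk k rfl).elim, rfl]
  · funext k
    rcases k with k | k | k <;> rfl

/-- Branching on the first symbol of a word. -/
theorem caseHead {A : Type} [Fintype A] {l : X → List A} {f : Option A → X → Y} (hl : PT l)
    (hf : ∀ o, PT (f o)) : PT fun x => f (l x).head? x := by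
  have hls := hl.size_le
  obtain ⟨L₀, _, _, hl⟩ := hl
  choose L hF hD hf using hf
  have hdec : DecidableEq (Σ o, L o) := Classical.decEq _
  refine ⟨Unit ⊕ L₀ ⊕ Σ o, L o, inferInstance, inferInstance, ?_⟩
  refine Comp.trans (s' := fun x => ioStore (enc x) (fun _ => [])
      (ioStore (fun _ => codes (l x)) (fun _ => []) (fun _ => [])))
    (hl.call (PolyBdd.self _)
      (ι := Sum.elim .inl (Sum.elim (fun k => .inr (.inr (.inl k)))
        (fun k => .inr (.inr (.inr (.inl k)))))) ?_ ?_ ?_ ?_) ?_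
  · rintro (a | a | a) (b | b | b) h <;> simp_all
  · rintro x (k | k | k) <;> rfl
  · rintro x (k | k | k) <;> rfl
  · rintro x (k | k | k | k | k) hk
    exacts [rfl, rfl, (hk (.inr (.inl k)) rfl).elim, rfl, rfl]
  refine Comp.read (.inr (.inr (.inl ()))) l (fun _ => rfl) fun o => ?_
  refine Comp.trans (s' := fun x : {x // (l x).head? = o} =>
      ioStore (enc x.1) (enc (f (l x).head? x))
      (ioStore (fun _ => codes (l x).tail) (fun _ => []) (fun _ => [])))
    ((hf o).call (g := fun x : {x // (l x).head? = o} => x.1) (PolyBdd.self _)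
      (ι := Sum.elim .inl (Sum.elim (fun k => .inr (.inl k))
        (fun k => .inr (.inr (.inr (.inr ⟨o, k⟩)))))) ?_ ?_ ?_ ?_) ?_
  · rintro (a | a | a) (b | b | b) h <;> simp_all
  · rintro x (k | k | k) <;> rfl
  · rintro x (k | k | k)
    exacts [rfl, congrArg (fun o => enc (f o x.1) k) x.2, rfl]
  · rintro x (k | k | k | k | k) hk
    exacts [rfl, (hk (.inr (.inl k)) rfl).elim, rfl, rfl, rfl]
  refine Comp.clearFam (fun k : Unit => .inr (.inr (.inl k)))
    (fun k => ?_) (fun _ _ => rfl) ?_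
  · refine (hls.reindex Subtype.val).of_le fun x => ?_
    rw [size_list]
    show (codes (l x).tail).length ≤ _
    cases l x <;> simp [codes]
  rintro x (k | k | k | k | k) hk
  exacts [rfl, rfl, (hk k rfl).elim, rfl, rfl]

theorem ite {c : X → Bool} {f g : X → Y} (hc : PT c) (hf : PT f) (hg : PT g) :
    PT fun x => if c x then f x else g x := by
  have h := caseHead (l := fun x => [c x])
    (f := fun o x => if o = some true then f x else g x) hc.singleton fun o => by
      by_cases h : o = some true <;> simpa [h]
  simpa using h

set_option synthInstance.maxSize 1000 in
/-- Folding over a word. Since the composition of the steps may grow exponentially, the size of the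
intermediate results, after any number of symbols, has to be bounded by a polynomial in the size
of the input. -/
theorem foldl {A : Type} [Fintype A] {l : X → List A} {init : X → Y} {step : A → X × Y → Y}
    (hl : PT l) (hi : PT init) (hs : ∀ a, PT (step a))
    (hb : PolyBdd (fun z : X × ℕ => size z.1) fun z =>
      size (((l z.1).take z.2).foldl (fun y a => step a (z.1, y)) (init z.1))) :
    PT fun x => (l x).foldl (fun y a => step a (x, y)) (init x) := by
  have hls := hl.size_le
  have hss := fun a => (hs a).size_le
  obtain ⟨L₀, _, _, hl⟩ := hl
  obtain ⟨L₁, _, _, hi⟩ := hi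
  choose L hF hD hs using hs
  have hdec : DecidableEq (Σ a, L a) := Classical.decEq _
  let acc : X → ℕ → Y := fun x i => ((l x).take i).foldl (fun y a => step a (x, y)) (init x)
  -- the stacks: input, accumulator, word, new accumulator, one more stack, those of the programs
  refine ⟨Unit ⊕ Idx Y ⊕ Unit ⊕ L₀ ⊕ L₁ ⊕ Σ a, L a, inferInstance, inferInstance, ?_⟩
  let st (x : X) (y : Idx Y → List Bool) (l : List Bool) (y' : Idx Y → List Bool) :
      BStore (Idx X ⊕ Idx Y ⊕ Unit ⊕ Idx Y ⊕ Unit ⊕ L₀ ⊕ L₁ ⊕ Σ a, L a) :=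
    ioStore (enc x) y (ioStore (fun _ => l) y' (ioStore (fun _ => []) (fun _ => [])
      (Sum.elim (fun _ => []) (fun _ => []))))
  have hst : ∀ x : X, ioStore (enc x) (fun _ : Idx Y => [])
      (fun _ : Unit ⊕ Idx Y ⊕ Unit ⊕ L₀ ⊕ L₁ ⊕ Σ a, L a => []) = st x (fun _ => []) []
        (fun _ => []) := by
    intro x; funext k
    rcases k with k | k | k | k | k | k | k | k <;> rfl
  have hst' : ∀ x : X, st x (enc (acc x (l x).length)) [] (fun _ => []) =
      ioStore (enc x) (enc ((l x).foldl (fun y a => step a (x, y)) (init x)))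
      (fun _ : Unit ⊕ Idx Y ⊕ Unit ⊕ L₀ ⊕ L₁ ⊕ Σ a, L a => []) := by
    intro x; funext k
    simp only [acc, List.take_length]
    rcases k with k | k | k | k | k | k | k | k <;> rfl
  refine (Comp.of_eq hst).trans (Comp.trans ?_ (Comp.of_eq hst'))
  refine Comp.trans (s' := fun x => st x (fun _ => []) (codes (l x)) (fun _ => []))
    (hl.call (PolyBdd.self _)
      (ι := Sum.elim .inl (Sum.elim (fun k => .inr (.inr (.inl k)))
        (fun k => .inr (.inr (.inr (.inr (.inr (.inl k)))))))) ?_ ?_ ?_ ?_) ?_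
  · rintro (a | a | a) (b | b | b) h <;> simp_all
  · rintro x (k | k | k) <;> rfl
  · rintro x (k | k | k) <;> rfl
  · rintro x (k | k | k | k | k | k | k | k) hk
    exacts [rfl, rfl, (hk (.inr (.inl k)) rfl).elim, rfl, rfl, rfl, rfl, rfl]
  refine Comp.trans (s' := fun x => st x (enc (acc x 0)) (codes ((l x).drop 0)) (fun _ => []))
    (hi.call (PolyBdd.self _)
      (ι := Sum.elim .inl (Sum.elim (fun k => .inr (.inl k))
        (fun k => .inr (.inr (.inr (.inr (.inr (.inr (.inl k))))))))) ?_ ?_ ?_ ?_) ?_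
  · rintro (a | a | a) (b | b | b) h <;> simp_all
  · rintro x (k | k | k) <;> rfl
  · rintro x (k | k | k) <;> rfl
  · rintro x (k | k | k | k | k | k | k | k) hk
    exacts [rfl, (hk (.inr (.inl k)) rfl).elim, rfl, rfl, rfl, rfl, rfl, rfl]
  have hend : ∀ x, st x (enc (acc x (l x).length)) (codes ((l x).drop (l x).length))
      (fun _ => []) = st x (enc (acc x (l x).length)) [] (fun _ => []) := fun x => by
    simp [codes]
  refine Comp.trans ?_ (Comp.of_eq hend)
  have hacc : PolyBdd (fun y : {y : X × ℕ // y.2 < (l y.1).length} => size y.1.1) fun y =>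
      size (acc y.1.1 y.1.2) := hb.reindex Subtype.val
  have hacc' : PolyBdd (fun y : {y : X × ℕ // y.2 < (l y.1).length} => size y.1.1) fun y =>
      size (acc y.1.1 (y.1.2 + 1)) :=
    hb.reindex fun y : {y : X × ℕ // y.2 < (l y.1).length} => (y.1.1, y.1.2 + 1)
  refine Comp.loop (.inr (.inr (.inl ())))
    (σ := fun x i => st x (enc (acc x i)) (codes ((l x).drop i)) (fun _ => []))
    (len := fun x => (l x).length) (hls.of_le fun x => length_le_size _) (fun x i hi => ?_)
    (fun x => ?_) ?_
  · show codes ((l x).drop i) ≠ []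
    intro h
    have := length_le_length_codes ((l x).drop i)
    simp [h] at this
    omega
  · show codes ((l x).drop (l x).length) = []
    simp [codes]
  refine Comp.read (.inr (.inr (.inl ()))) (fun y => (l y.1.1).drop y.1.2) (fun _ => rfl)
    fun o => ?_
  cases o with
  | none =>
    refine Comp.of_eq fun y => ?_
    have h₁ := y.1.2
    have h₂ := y.2
    rw [List.head?_drop, List.getElem?_eq_none_iff] at h₂
    omega
  | some a =>
    let X' := {y : {y : X × ℕ // y.2 < (l y.1).length} //
      ((l y.1.1).drop y.1.2).head? = some a}
    have hN : PolyBdd (fun y : X' => size y.1.1.1) fun y => size y.1.1.1 := PolyBdd.self _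
    have hstep : ∀ y : X', acc y.1.1.1 (y.1.1.2 + 1) =
        step a (y.1.1.1, acc y.1.1.1 y.1.1.2) := by
      intro y
      have h₂ := y.2
      rw [List.head?_drop] at h₂
      simp [acc, List.take_add_one, h₂]
    have hpair : PolyBdd (fun y : X' => size y.1.1.1) fun y =>
        size (y.1.1.1, acc y.1.1.1 y.1.1.2) := by
      refine (hN.add (hacc.reindex Subtype.val)).of_le fun y => ?_
      rw [size_prod]
    refine Comp.trans (s' := fun y : X' => st y.1.1.1 (enc (acc y.1.1.1 y.1.1.2))
        (codes ((l y.1.1.1).drop (y.1.1.2 + 1))) (enc (acc y.1.1.1 (y.1.1.2 + 1))))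
      ((hs a).call (g := fun y : X' => (y.1.1.1, acc y.1.1.1 y.1.1.2)) hpair
        (ι := Sum.elim (Sum.elim .inl fun k => .inr (.inl k))
          (Sum.elim (fun k => .inr (.inr (.inr (.inl k))))
        (fun k => .inr (.inr (.inr (.inr (.inr (.inr (.inr ⟨a, k⟩))))))))) ?_ ?_ ?_ ?_) ?_
    · rintro ((a | a) | a | a) ((b | b) | b | b) h <;> simp_all
    · rintro x ((k | k) | k | k) <;> rfl
    · rintro y ((k | k) | k | k)
      exacts [rfl, rfl, by rw [← hstep y]; rfl, rfl]
    · rintro x (k | k | k | k | k | k | k | k) hk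
      exacts [rfl, rfl, by simp [st, ioStore, List.tail_drop], (hk (.inr (.inl k)) rfl).elim,
        rfl, rfl, rfl, rfl]
    refine Comp.trans (s' := fun y : X' => st y.1.1.1 (fun _ => [])
        (codes ((l y.1.1.1).drop (y.1.1.2 + 1))) (enc (acc y.1.1.1 (y.1.1.2 + 1))))
      (Comp.clearFam (fun k : Idx Y => .inr (.inl k)) (fun k => ?_) (fun _ _ => rfl) ?_) ?_
    · exact (hacc.reindex Subtype.val).of_le fun y => length_enc_le_size _ k
    · rintro x (k | k | k | k | k | k | k | k) hk
      exacts [rfl, (hk k rfl).elim, rfl, rfl, rfl, rfl, rfl, rfl]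
    refine Comp.trans (s' := fun y : X' => st y.1.1.1 (enc (acc y.1.1.1 (y.1.1.2 + 1)))
        (codes ((l y.1.1.1).drop (y.1.1.2 + 1))) (enc (acc y.1.1.1 (y.1.1.2 + 1))))
      (Comp.copyFam (a := fun k : Idx Y => .inr (.inr (.inr (.inl k))))
        (b := fun k : Idx Y => .inr (.inl k)) (c := .inr (.inr (.inr (.inr (.inl ())))))
        (fun i j h => by simpa using h) (by simp) (by simp) (by simp) (fun k => ?_)
        (fun _ _ => rfl) (fun _ => rfl) (fun _ _ => rfl) ?_) ?_
    · exact (hacc'.reindex Subtype.val).of_le fun y => length_enc_le_size _ k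
    · rintro x (k | k | k | k | k | k | k | k) hk
      exacts [rfl, (hk k rfl).elim, rfl, rfl, rfl, rfl, rfl, rfl]
    refine Comp.clearFam (fun k : Idx Y => .inr (.inr (.inr (.inl k)))) (fun k => ?_)
      (fun _ _ => rfl) ?_
    · exact (hacc'.reindex Subtype.val).of_le fun y => length_enc_le_size _ k
    · rintro x (k | k | k | k | k | k | k | k) hk
      exacts [rfl, rfl, rfl, (hk k rfl).elim, rfl, rfl, rfl, rfl]

end PT

/-! ### Machines from polynomial time functions -/

theorem PT.reverse_list {X A : Type} [Enc X] [Fintype A] {l : X → List A} (hl : PT l) :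
    PT fun x => (l x).reverse := by
  suffices PT fun l : List A => l.reverse from this.comp hl
  have h := PT.foldl (X := List A) (Y := List A) (l := fun l => l) (init := fun _ => [])
    (step := fun a p => a :: p.2) PT.id PT.nil (fun a => PT.snd.cons a) ?_
  · simpa using h
  · refine ((PolyBdd.const _ (Fintype.card A)).mul (PolyBdd.self _)).of_le fun z => ?_
    refine (size_list_le _).trans (Nat.mul_le_mul_left _ ?_)
    refine le_trans ?_ (length_le_size z.1)
    rw [List.foldl_flip_cons_eq_append']
    simp

/-- The alphabets of a machine with binary work stacks `K`, an input stack and an output stack. -/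
abbrev machineAlphabet (K S : Type) : K ⊕ Bool → Type
  | .inl _ => Bool
  | .inr true => S
  | .inr false => Bool

instance {K S : Type} [Fintype S] : ∀ k, Fintype (machineAlphabet K S k)
  | .inl _ => inferInstanceAs (Fintype Bool)
  | .inr true => inferInstanceAs (Fintype S)
  | .inr false => inferInstanceAs (Fintype Bool)

/-- The contents of the stacks of a machine. -/
def machineStore {K S : Type} (w : K → List Bool) (i : List S) (o : List Bool) :
    Store (machineAlphabet K S)
  | .inl k => w k
  | .inr true => i
  | .inr false => o

/-- The code of a truth value can be recognized by its first bit, as there are only two symbols. -/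
theorem code_head_injective {b b' : Bool} (h : (code b).head? = (code b').head?) : b = b' := by
  apply (Fintype.equivFin Bool).injective
  have h₁ : (Fintype.equivFin Bool b : ℕ) < 2 := (Fintype.equivFin Bool b).2
  have h₂ : (Fintype.equivFin Bool b' : ℕ) < 2 := (Fintype.equivFin Bool b').2
  apply Fin.ext
  simp only [code] at h
  generalize (Fintype.equivFin Bool b : ℕ) = m at *
  generalize (Fintype.equivFin Bool b' : ℕ) = n at *
  interval_cases m <;> interval_cases n <;> simp_all [List.replicate_succ]

/-- A program that reads a word from the input stack and leaves the value of `F` on the output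
stack, with all other stacks empty. As encoding the word symbol by symbol reverses it, the program
for the function `fun l => F l.reverse` is called. -/
theorem PT.comp_machineStore {S : Type} [Fintype S] {F : List S → Bool} (hF : PT F) :
    ∃ (K : Type) (_ : Fintype K) (_ : DecidableEq K), Comp (fun l : List S => l.length)
      (fun l => machineStore (K := K) (fun _ => []) l [])
      (fun l => machineStore (K := K) (fun _ => []) [] [F l]) := by
  obtain ⟨L, _, _, hF⟩ : PT fun l : List S => F l.reverse := hF.comp (PT.reverse_list PT.id)
  refine ⟨Unit ⊕ Unit ⊕ L, inferInstance, inferInstance, ?_⟩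
  let w (u v : List Bool) : BStore (Unit ⊕ Unit ⊕ L) :=
    ioStore (fun _ => u) (fun _ => v) (fun _ => [])
  have hw : w [] [] = fun _ => [] := by funext k; rcases k with k | k | k <;> rfl
  rw [← hw]
  refine Comp.trans (s' := fun l => machineStore (w (codes l.reverse) []) [] []) ?_ ?_
  · have h := Comp.loop (N := fun l : List S => l.length) (.inr true)
      (σ := fun l i => machineStore (w (codes (l.take i).reverse) []) (l.drop i) [])
      (len := fun l => l.length) (PolyBdd.self _)
      (fun l i hi => by simpa [machineStore] using hi) (fun l => by simp [machineStore]) (by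
        refine Comp.case (.inr true) fun o => ?_
        cases o with
        | none =>
          refine Comp.of_eq fun y => ?_
          have h₁ := y.1.2
          have h₂ : (y.1.1.1.drop y.1.1.2).head? = none := y.2
          rw [List.head?_drop, List.getElem?_eq_none_iff] at h₂
          omega
        | some a =>
          refine (Comp.pushList _ _ (.inl (.inl ())) (code (A := S) a)).trans
            ((Comp.pop _ _ (.inr true)).trans (Comp.of_eq fun y => ?_))
          have h₂ : (y.1.1.1.drop y.1.1.2).head? = some a := y.2
          rw [List.head?_drop] at h₂
          funext k
          rcases k with (k | k | k) | (k | k)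
          · simp [machineStore, w, ioStore, List.take_add_one, h₂, codes]
          all_goals simp [machineStore, w, ioStore, List.tail_drop])
    refine (Comp.of_eq fun l => ?_).trans (h.trans (Comp.of_eq fun l => ?_))
    · simp [codes]
    · simp
  have hrev : PolyBdd (fun l : List S => l.length) fun l => size l.reverse :=
    ((PolyBdd.const _ (Fintype.card S)).mul (PolyBdd.self _)).of_le fun l => by
      simpa using size_list_le l.reverse
  refine Comp.trans (s' := fun l => machineStore (w (codes l.reverse) (codes [F l])) [] [])
    (Comp.map (Γ := machineAlphabet (Unit ⊕ Unit ⊕ L) S) (ι := Sum.inl) Sum.inl_injective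
      (Comp.mono hrev (Comp.reindex hF List.reverse)) ?_ ?_ ?_) ?_
  · rintro l (k | k | k) <;> rfl
  · rintro l (k | k | k)
    · rfl
    · show codes [F l] = codes [F l.reverse.reverse]
      rw [List.reverse_reverse]
    · rfl
  · rintro l (k | k | k) hk
    exacts [(hk k rfl).elim, rfl, rfl]
  refine Comp.trans (s' := fun l => machineStore (w (codes l.reverse) (codes [F l])) [] [F l])
    (Comp.case (.inl (.inr (.inl ()))) fun o => ?_) ?_
  · by_cases h : ∃ b : Bool, (code b).head? = o
    · obtain ⟨b, hb⟩ := h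
      refine (Comp.push _ _ (.inr false) b).trans (Comp.of_eq fun y => ?_)
      have h₂ : (codes [F y]).head? = o := y.2
      rw [codes, List.flatMap_singleton] at h₂
      replace h₂ := code_head_injective (h₂.trans hb.symm)
      funext k
      rcases k with k | k | k
      · simp [machineStore]
      · simp [machineStore, h₂]
      · simp [machineStore]
    · refine Comp.of_eq fun y => (h ⟨F y, ?_⟩).elim
      have h₂ : (codes [F y]).head? = o := y.2
      rwa [codes, List.flatMap_singleton] at h₂
  refine Comp.clearFinset {.inl (.inl ()), .inl (.inr (.inl ()))} ?_ ?_ ?_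
  · intro k hk
    simp only [Finset.mem_insert, Finset.mem_singleton] at hk
    rcases hk with rfl | rfl
    · exact hrev.of_le fun l => (size_list l.reverse).symm.le
    · exact (PolyBdd.const _ 2).of_le fun l => length_codes_le [F l]
  · intro l k hk
    simp only [Finset.mem_insert, Finset.mem_singleton] at hk
    rcases hk with rfl | rfl <;> rfl
  · intro l k hk
    rcases k with (k | k | k) | k | k <;> first | rfl | simp at hk

/-- A polynomial time function of words solves the decision problem on the words it is given. -/
theorem PT.solvable {α S : Type} [Fintype S] {F : List S → Bool} (hF : PT F) {e : α → List S}
    {P : α → Prop} (h : ∀ a, F (e a) = true ↔ P a) : SolvableInPolyTime e P := by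
  obtain ⟨K, _, _, p, q, hp⟩ := hF.comp_machineStore
  choose t ht run using hp
  refine ⟨fun a => F (e a), h, ⟨⟨⟨p.machine (.inr true) (.inr false), Equiv.refl S,
    Equiv.refl Bool⟩, q + 1, fun a => ⟨⟨t (e a) + 1, ?_⟩, ?_⟩⟩⟩⟩
  · have key := (run (e a)).machine_evals (kin := .inr true) (kout := .inr false)
    have h₀ : Turing.initList (p.machine (.inr true) (.inr false)) (e a) =
        ⟨some (some p.entry), fun _ => none, machineStore (fun _ => []) (e a) []⟩ := by
      unfold Turing.initList
      congr 1
      funext k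
      rcases k with k | k | k
      · exact dif_neg (by rintro ⟨⟩)
      · exact dif_neg (by rintro ⟨⟩)
      · exact dif_pos rfl
    have h₁ : Turing.haltList (p.machine (.inr true) (.inr false)) [F (e a)] =
        ⟨none, fun _ => none, machineStore (fun _ => []) [] [F (e a)]⟩ := by
      unfold Turing.haltList
      congr 1
      funext k
      rcases k with k | k | k
      · exact dif_neg (by rintro ⟨⟩)
      · exact dif_pos rfl
      · exact dif_neg (by rintro ⟨⟩)
    have h₂ : List.map (Equiv.refl S).invFun (e a) = e a := List.map_id _
    refine Eq.trans ?_ (key.trans ?_)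
    · exact congrArg (fun c => (flip bind _)^[t (e a) + 1] (some c))
        ((congrArg _ h₂).trans h₀)
    · exact congrArg some h₁.symm
  · simpa using ht (e a)

/-! ### Polynomial time functions of words -/

theorem PolyBdd.size_list {X A : Type} [Fintype A] {N : X → ℕ} {l : X → List A}
    (h : PolyBdd N fun x => (l x).length) : PolyBdd N fun x => size (l x) :=
  ((PolyBdd.const N (Fintype.card A)).mul h).of_le fun x => size_list_le (l x)

theorem PolyBdd.size_pair {X Y Z : Type} [Enc Y] [Enc Z] {N : X → ℕ} {f : X → Y × Z}
    (h₁ : PolyBdd N fun x => size (f x).1) (h₂ : PolyBdd N fun x => size (f x).2) :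
    PolyBdd N fun x => size (f x) :=
  (h₁.add h₂).of_le fun x => (size_prod (f x)).le

theorem PolyBdd.size_bool {X : Type} {N : X → ℕ} {f : X → Bool} : PolyBdd N fun x => size (f x) :=
  (PolyBdd.const N 2).of_le fun x => size_bool_le (f x)

theorem PolyBdd.size_nat {X : Type} {N : X → ℕ} {f : X → ℕ}
    (h : PolyBdd N fun x => (f x).size) : PolyBdd N fun x => size (f x) :=
  ((PolyBdd.const N 2).mul h).of_le fun x => size_nat_le (f x)

/-- Whether `f i` holds for some `i`. -/
noncomputable def existsB {ι : Type} (f : ι → Bool) : Bool :=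
  open Classical in decide (∃ i, f i = true)

/-- Whether `f i` holds for all `i`. -/
noncomputable def forallB {ι : Type} (f : ι → Bool) : Bool :=
  !existsB fun i => !f i

theorem existsB_eq_true {ι : Type} {f : ι → Bool} : existsB f = true ↔ ∃ i, f i = true := by
  simp [existsB]

theorem forallB_eq_true {ι : Type} {f : ι → Bool} : forallB f = true ↔ ∀ i, f i = true := by
  simp [forallB, existsB]

namespace PT

variable {X Y Z A B C : Type} [Enc X] [Enc Y] [Enc Z] [Fintype A] [Fintype B] [Fintype C]

theorem length_le {l : X → List A} (hl : PT l) : PolyBdd size fun x => (l x).length :=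
  hl.size_le.of_le fun x => length_le_size (l x)

theorem congr {f g : X → Y} (hf : PT f) (h : ∀ x, f x = g x) : PT g :=
  (funext h : f = g) ▸ hf

theorem not {c : X → Bool} (hc : PT c) : PT fun x => !c x :=
  (hc.ite (constBool false) (constBool true)).congr fun x => by cases c x <;> rfl

theorem and {c d : X → Bool} (hc : PT c) (hd : PT d) : PT fun x => c x && d x :=
  (hc.ite hd (constBool false)).congr fun x => by cases c x <;> rfl

theorem or {c d : X → Bool} (hc : PT c) (hd : PT d) : PT fun x => c x || d x :=
  (hc.ite (constBool true) hd).congr fun x => by cases c x <;> rfl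

/-- Polynomial time predicates are closed under quantification over a fixed finite type. -/
theorem existsB {ι : Type} [Fintype ι] {f : ι → X → Bool} (hf : ∀ i, PT (f i)) :
    PT fun x => Foil.existsB fun i => f i x := by
  classical
  have key : ∀ s : Finset ι, PT fun x => decide (∃ i ∈ s, f i x = true) := by
    intro s
    induction s using Finset.induction_on with
    | empty => exact (constBool false).congr fun x => by simp
    | insert a s ha ih => exact ((hf a).or ih).congr fun x => by simp
  exact (key Finset.univ).congr fun x => by rw [Bool.eq_iff_iff, existsB_eq_true]; simp

theorem forallB {ι : Type} [Fintype ι] {f : ι → X → Bool} (hf : ∀ i, PT (f i)) :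
    PT fun x => Foil.forallB fun i => f i x :=
  (existsB fun i => (hf i).not).not

theorem append {l m : X → List A} (hl : PT l) (hm : PT m) : PT fun x => l x ++ m x := by
  have h := foldl (l := fun x => (l x).reverse) (init := m) (step := fun a p => a :: p.2)
    hl.reverse_list hm (fun a => snd.cons a) ?_
  · exact h.congr fun x => by rw [List.foldl_flip_cons_eq_append', List.reverse_reverse]
  · refine PolyBdd.size_list (((hl.length_le.reindex Prod.fst).add
      (hm.length_le.reindex Prod.fst)).of_le fun z => ?_)
    rw [List.foldl_flip_cons_eq_append']
    simp

theorem flatMap (g : A → List B) {l : X → List A} (hl : PT l) : PT fun x => (l x).flatMap g := by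
  have e : ∀ (m : List A) (acc : List B),
      m.foldl (fun acc a => (g a).reverse ++ acc) acc = (m.flatMap g).reverse ++ acc := by
    intro m
    induction m with
    | nil => simp
    | cons a m ih => intro acc; simp [ih]
  have h := foldl (Y := List B) (init := fun _ => []) (step := fun a p => (g a).reverse ++ p.2)
    hl nil (fun a => (constList (g a).reverse).append snd) ?_
  · exact h.reverse_list.congr fun x => by simp [e]
  · refine PolyBdd.size_list (((PolyBdd.const _ (∑ a, (g a).length)).mul
      (hl.length_le.reindex Prod.fst)).of_le fun z => ?_)
    rw [e, List.append_nil, List.length_reverse]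
    refine le_trans ?_ (Nat.mul_le_mul_left _ (List.length_take_le' z.2 (l z.1)))
    induction (l z.1).take z.2 with
    | nil => simp
    | cons a m ih =>
      have : (g a).length ≤ ∑ a, (g a).length :=
        Finset.single_le_sum (f := fun a => (g a).length) (fun _ _ => Nat.zero_le _)
          (Finset.mem_univ a)
      simp only [List.flatMap_cons, List.length_append, List.length_cons, Nat.mul_succ]
      omega

theorem map (g : A → B) {l : X → List A} (hl : PT l) : PT fun x => (l x).map g :=
  (hl.flatMap fun a => [g a]).congr fun x => by
    rw [List.map_eq_flatMap]

theorem all (g : A → Bool) {l : X → List A} (hl : PT l) : PT fun x => (l x).all g := by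
  have h := foldl (Y := Bool) (init := fun _ => true) (step := fun a p => p.2 && g a)
    hl (constBool _) (fun a => snd.and (constBool _)) PolyBdd.size_bool
  refine h.congr fun x => ?_
  have : ∀ (m : List A) (b : Bool), m.foldl (fun b a => b && g a) b = (b && m.all g) := by
    intro m
    induction m with
    | nil => simp
    | cons a m ih => intro b; simp [ih, Bool.and_assoc]
  simp [this]

theorem zipWith (g : A → B → C) {l : X → List A} {m : X → List B} (hl : PT l) (hm : PT m) :
    PT fun x => List.zipWith g (l x) (m x) := by
  have e : ∀ (l : List A) (p : List B × List C),
      l.foldl (fun p a => (p.1.tail, (p.1.head?.elim [] fun b => [g a b]) ++ p.2)) p =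
        (p.1.drop l.length, (List.zipWith g l p.1).reverse ++ p.2) := by
    intro l
    induction l with
    | nil => simp
    | cons a l ih =>
      rintro ⟨m, acc⟩
      rw [List.foldl_cons, ih]
      cases m <;> simp
  have h := foldl (Y := List B × List C) (init := fun x => (m x, []))
    (step := fun a p => (p.2.1.tail, (p.2.1.head?.elim [] fun b => [g a b]) ++ p.2.2))
    hl (hm.pair nil) (fun a => (fst.comp snd).tail.pair
      (caseHead
        (f := fun o (p : X × List B × List C) => (o.elim [] fun b => [g a b]) ++ p.2.2)
        (fst.comp snd) fun o => (constList _).append (m := fun p : X × List B × List C => p.2.2)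
          (snd.comp snd))) ?_
  · exact (snd.comp h).reverse_list.congr fun x => by simp [e]
  · simp only [e]
    refine PolyBdd.size_pair (PolyBdd.size_list ((hm.length_le.reindex Prod.fst).of_le fun z => ?_))
      (PolyBdd.size_list ((hm.length_le.reindex Prod.fst).of_le fun z => ?_))
    · simp
    · simp

end PT

/-! ### Arithmetic in polynomial time -/

/-- The number with the given binary digits, least significant digit first. -/
def digitsVal (l : List Bool) : ℕ := l.foldr Nat.bit 0

@[simp] theorem digitsVal_nil : digitsVal [] = 0 := rfl

@[simp] theorem digitsVal_cons (b : Bool) (l : List Bool) :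
    digitsVal (b :: l) = b.toNat + 2 * digitsVal l := by
  simp only [digitsVal, List.foldr_cons, Nat.bit_val]
  omega

theorem digitsVal_append (l m : List Bool) :
    digitsVal (l ++ m) = digitsVal l + 2 ^ l.length * digitsVal m := by
  induction l with
  | nil => simp
  | cons b l ih => simp [ih, pow_succ]; ring

theorem digitsVal_lt (l : List Bool) : digitsVal l < 2 ^ l.length := by
  induction l with
  | nil => simp
  | cons b l ih =>
    have := Bool.toNat_le b
    simp only [digitsVal_cons, List.length_cons, pow_succ]
    omega

theorem digitsVal_replicate_false (n : ℕ) : digitsVal (List.replicate n false) = 0 := by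
  induction n with
  | zero => rfl
  | succ n ih => simp [List.replicate_succ, ih]

theorem digitsVal_bits (n : ℕ) : digitsVal n.bits = n := by
  induction n using Nat.binaryRec' with
  | zero => simp
  | bit b n h ih =>
    rw [Nat.bits_append_bit n b h]
    simp only [digitsVal_cons, ih, Nat.bit_val]
    omega

/-- The digits of a natural number, padded by at least one leading zero and to more digits than
those of `m`. -/
def paddedBits (n m : ℕ) : List Bool := n.bits ++ (m.bits.map fun _ => false) ++ [false]

theorem digitsVal_paddedBits (n m : ℕ) : digitsVal (paddedBits n m) = n := by
  have : m.bits.map (fun _ => false) = List.replicate m.bits.length false := by simp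
  rw [paddedBits, this]
  simp [digitsVal_append, digitsVal_bits, digitsVal_replicate_false]

theorem length_paddedBits (n m : ℕ) :
    (paddedBits n m).length = n.bits.length + m.bits.length + 1 := by
  simp [paddedBits]; omega

/-- One step of the addition of binary numbers: the remaining digits of the second number, the
carry, and the digits of the sum, most significant first. -/
def addStep (a : Bool) (p : List Bool × Bool × List Bool) : List Bool × Bool × List Bool :=
  (p.1.tail, Bool.carry a (p.1.headD false) p.2.1, ((a ^^ p.1.headD false) ^^ p.2.1) :: p.2.2)

/-- The invariant of the addition: the digits written so far, together with the carry and the digits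
to come, represent the sum. -/
theorem foldl_addStep (l : List Bool) (p : List Bool × Bool × List Bool) :
    let q := l.foldl (fun p a => addStep a p) p
    q.1 = p.1.drop l.length ∧ q.2.2.length = p.2.2.length + l.length ∧
    digitsVal q.2.2.reverse + 2 ^ q.2.2.length * (digitsVal q.1 + q.2.1.toNat) =
      digitsVal p.2.2.reverse +
        2 ^ p.2.2.length * (digitsVal l + digitsVal p.1 + p.2.1.toNat) := by
  induction l generalizing p with
  | nil => simp
  | cons a l ih =>
    obtain ⟨h₁, h₂, h₃⟩ := ih (addStep a p)
    obtain ⟨m, c, out⟩ := p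
    refine ⟨?_, ?_, ?_⟩
    · rw [List.foldl_cons, h₁]
      cases m <;> simp [addStep]
    · rw [List.foldl_cons, h₂]
      simp [addStep]; omega
    · rw [List.foldl_cons, h₃]
      have key : ∀ (a b c : Bool) (x y : ℕ),
          ((a ^^ b) ^^ c).toNat + 2 * (x + y + (Bool.carry a b c).toNat) =
            (a.toNat + 2 * x) + (b.toNat + 2 * y) + c.toNat := by
        rintro (_ | _) (_ | _) (_ | _) x y <;> simp [Bool.carry] <;> omega
      have hm : digitsVal m = (m.headD false).toNat + 2 * digitsVal m.tail := by
        cases m <;> simp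
      simp only [addStep, List.reverse_cons, digitsVal_append, List.length_reverse,
        List.length_cons, digitsVal_cons, digitsVal_nil]
      rw [hm, ← key, pow_succ]
      ring

namespace PT

variable {X : Type} [Enc X]

theorem bit {f : X → ℕ} (b : Bool) (hf : PT f) : PT fun x => Nat.bit b (f x) := by
  refine of_bits ?_
  have h := caseHead (f := fun o x => if o = none ∧ b = false then [] else b :: (f x).bits)
    (bits.comp hf) fun o => by
      by_cases h : o = none ∧ b = false
      · simpa [h] using nil
      · simpa [h] using (bits.comp hf).cons b
  refine h.congr fun x => ?_
  by_cases h0 : f x = 0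
  · cases b <;> simp [h0]
  · rw [Nat.bits_append_bit _ _ fun h => (h0 h).elim, if_neg]
    rintro ⟨h, -⟩
    rw [List.head?_eq_none_iff] at h
    exact h0 (by rw [← digitsVal_bits (f x), h]; rfl)

theorem digitsVal {l : X → List Bool} (hl : PT l) : PT fun x => Foil.digitsVal (l x) := by
  have h := foldl (Y := ℕ) (init := fun _ => 0) (step := fun a p => Nat.bit a p.2)
    hl.reverse_list (constNat 0) (fun a => snd.bit a) ?_
  · exact h.congr fun x => by rw [List.foldl_reverse]; rfl
  · refine PolyBdd.size_nat ((hl.length_le.reindex Prod.fst).of_le fun z => ?_)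
    rw [Nat.size_le, List.take_reverse, List.foldl_reverse]
    refine (digitsVal_lt _).trans_le (Nat.pow_le_pow_right (by omega) ?_)
    simp

theorem paddedBits {f g : X → ℕ} (hf : PT f) (hg : PT g) :
    PT fun x => Foil.paddedBits (f x) (g x) :=
  ((bits.comp hf).append ((bits.comp hg).map _)).append (constList _)

theorem size_bound {f : X → ℕ} (hf : PT f) : PolyBdd size fun x => (f x).size :=
  (bits.comp hf).length_le.of_le fun x => by rw [Nat.size_eq_bits_len]

theorem headD {l : X → List Bool} (hl : PT l) : PT fun x => (l x).headD false :=
  (caseHead (f := fun o _ => o.getD false) hl fun o => constBool _).congr fun x => by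
    cases l x <;> rfl

theorem add {f g : X → ℕ} (hf : PT f) (hg : PT g) : PT fun x => f x + g x := by
  have hstep : ∀ a, PT fun p : X × List Bool × Bool × List Bool => addStep a p.2 := by
    intro a
    have h₁ : PT fun p : X × List Bool × Bool × List Bool => p.2.1 := fst.comp snd
    have h₂ : PT fun p : X × List Bool × Bool × List Bool => p.2.2.1 := (fst.comp snd).comp snd
    have h₃ : PT fun p : X × List Bool × Bool × List Bool => p.2.2.2 := (snd.comp snd).comp snd
    have hc : ∀ (b : Bool → Bool → Bool), PT fun p : X × List Bool × Bool × List Bool =>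
        b (p.2.1.headD false) p.2.2.1 := fun b =>
      (h₁.headD.ite (h₂.ite (constBool (b true true)) (constBool (b true false)))
        (h₂.ite (constBool (b false true)) (constBool (b false false)))).congr fun p => by
          cases p.2.1.headD false <;> cases p.2.2.1 <;> rfl
    refine h₁.tail.pair ((hc fun b c => Bool.carry a b c).pair ?_)
    exact ((hc fun b c => (a ^^ b) ^^ c).ite (h₃.cons true) (h₃.cons false)).congr fun p => by
      cases ((a ^^ p.2.1.headD false) ^^ p.2.2.1) <;> rfl
  have h := foldl (init := fun x => ((g x).bits, false, [])) (step := fun a p => addStep a p.2)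
    (hf.paddedBits hg) ((bits.comp hg).pair ((constBool false).pair nil)) hstep ?_
  · refine (snd.comp (snd.comp h)).reverse_list.digitsVal.congr fun x => ?_
    obtain ⟨h₁, h₂, h₃⟩ := foldl_addStep (Foil.paddedBits (f x) (g x)) ((g x).bits, false, [])
    generalize List.foldl _ _ (Foil.paddedBits (f x) (g x)) = q at *
    have hl := length_paddedBits (f x) (g x)
    rw [List.drop_eq_nil_of_le (by simp only; omega)] at h₁
    simp only [h₁, digitsVal_paddedBits, digitsVal_bits, List.reverse_nil, digitsVal_nil,
      List.length_nil, pow_zero, Bool.toNat_false, Nat.zero_add, Nat.one_mul, Nat.add_zero] at h₂ h₃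
    have hlt : f x + g x < 2 ^ q.2.2.length := by
      have hf := Foil.digitsVal_lt (f x).bits
      have hg := Foil.digitsVal_lt (g x).bits
      rw [digitsVal_bits] at hf hg
      have hf' : 2 ^ (f x).bits.length ≤ 2 ^ ((f x).bits.length + (g x).bits.length) :=
        Nat.pow_le_pow_right (by omega) (by omega)
      have hg' : 2 ^ (g x).bits.length ≤ 2 ^ ((f x).bits.length + (g x).bits.length) :=
        Nat.pow_le_pow_right (by omega) (by omega)
      rw [h₂, hl, pow_succ]
      omega
    cases hq : q.2.1 <;> simp only [hq, Bool.toNat_false, Bool.toNat_true] at h₃ <;> omega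
  · have hb : ∀ z : X × ℕ, _ := fun z => foldl_addStep ((Foil.paddedBits (f z.1) (g z.1)).take z.2)
      ((g z.1).bits, false, [])
    have hN : PolyBdd (fun z : X × ℕ => size z.1) fun z => (g z.1).bits.length :=
      (bits.comp hg).length_le.reindex Prod.fst
    refine PolyBdd.size_pair (PolyBdd.size_list (hN.of_le fun z => ?_))
      (PolyBdd.size_pair PolyBdd.size_bool (PolyBdd.size_list
        (((hf.paddedBits hg).length_le.reindex Prod.fst).of_le fun z => ?_)))
    · rw [(hb z).1]; simp
    · rw [(hb z).2.1]; simp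

theorem mul {f g : X → ℕ} (hf : PT f) (hg : PT g) : PT fun x => f x * g x := by
  -- Horner's scheme, from the most significant digit of `f x`
  have h := foldl (Y := ℕ) (init := fun _ => 0)
    (step := fun a p => if a then Nat.bit false p.2 + g p.1 else Nat.bit false p.2)
    (bits.comp hf).reverse_list (constNat 0) (fun a => by
      cases a
      · simpa using snd.bit false
      · simpa using (snd.bit false).add (hg.comp fst)) ?_
  · refine h.congr fun x => ?_
    rw [List.foldl_reverse]
    conv_rhs => rw [← digitsVal_bits (f x)]
    induction (f x).bits with
    | nil => simp
    | cons b l ih =>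
      rw [List.foldr_cons, ih]
      cases b <;> simp [Nat.bit_val] <;> ring
  · refine PolyBdd.size_nat ((((bits.comp hf).length_le.reindex Prod.fst).add
      (hg.size_bound.reindex Prod.fst)).of_le fun z => ?_)
    have key : ∀ (l : List Bool) (c : ℕ),
        l.foldl (fun y a => if a then Nat.bit false y + g z.1 else Nat.bit false y) c + g z.1 ≤
          2 ^ l.length * (c + g z.1) := by
      intro l
      induction l with
      | nil => simp
      | cons b l ih =>
        intro c
        rw [List.foldl_cons]
        refine (ih _).trans ?_
        rw [List.length_cons, pow_succ, Nat.mul_assoc]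
        refine Nat.mul_le_mul_left _ ?_
        cases b <;> simp [Nat.bit_val] <;> omega
    have h₁ := key ((f z.1).bits.reverse.take z.2) 0
    rw [Nat.size_le, pow_add]
    have h₂ := Nat.lt_size_self (g z.1)
    have h₃ : 2 ^ ((f z.1).bits.reverse.take z.2).length ≤ 2 ^ (f z.1).bits.length :=
      Nat.pow_le_pow_right (by omega) (by simp)
    refine ((Nat.le_of_add_right_le h₁).trans ?_).trans_lt
      (Nat.mul_lt_mul_of_pos_left h₂ (by positivity))
    rw [Nat.zero_add]
    exact Nat.mul_le_mul_right _ h₃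

theorem le {f g : X → ℕ} (hf : PT f) (hg : PT g) : PT fun x => decide (f x ≤ g x) := by
  -- the digits are compared from the least significant one, the last difference being decisive
  have key : ∀ (l m : List Bool) (r : Bool), m.length ≤ l.length →
      (l.foldl (fun (p : List Bool × Bool) a =>
        (p.1.tail, if a = p.1.headD false then p.2 else p.1.headD false)) (m, r)).2 =
      decide (Foil.digitsVal l < Foil.digitsVal m ∨
        Foil.digitsVal l = Foil.digitsVal m ∧ r = true) := by
    intro l
    induction l with
    | nil => intro m r h; obtain rfl : m = [] := by simpa using h
             simp
    | cons a l ih =>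
      intro m r h
      rw [List.foldl_cons, ih _ _ (by simp at h ⊢; omega)]
      have hm : Foil.digitsVal m = (m.headD false).toNat + 2 * Foil.digitsVal m.tail := by
        cases m <;> simp
      simp only [hm, digitsVal_cons]
      generalize m.headD false = b
      congr 1
      apply propext
      cases a <;> cases b <;> cases r <;> simp <;> omega
  have h := foldl (Y := List Bool × Bool) (init := fun x => ((g x).bits, true))
    (step := fun a p => (p.2.1.tail, if a = p.2.1.headD false then p.2.2 else p.2.1.headD false))
    (hf.paddedBits hg) ((bits.comp hg).pair (constBool true)) (fun a => by
      have h₁ : PT fun p : X × List Bool × Bool => p.2.1 := fst.comp snd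
      have h₂ : PT fun p : X × List Bool × Bool => p.2.2 := snd.comp snd
      refine h₁.tail.pair ?_
      cases a
      · exact (h₁.headD.ite (constBool true) h₂).congr fun p => by
          cases p.2.1.headD false <;> simp
      · exact (h₁.headD.ite h₂ (constBool false)).congr fun p => by
          cases p.2.1.headD false <;> simp) ?_
  · refine (snd.comp h).congr fun x => ?_
    rw [key _ _ _ (by rw [length_paddedBits]; omega), digitsVal_paddedBits, digitsVal_bits]
    simp [le_iff_lt_or_eq]
  · refine PolyBdd.size_pair (PolyBdd.size_list
      (((bits.comp hg).length_le.reindex Prod.fst).of_le fun z => ?_)) PolyBdd.size_bool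
    have : ∀ (l : List Bool) (p : List Bool × Bool), (l.foldl (fun (p : List Bool × Bool) a =>
        (p.1.tail, if a = p.1.headD false then p.2 else p.1.headD false)) p).1 =
        p.1.drop l.length := by
      intro l
      induction l with
      | nil => simp
      | cons a l ih => intro p; rw [List.foldl_cons, ih]; simp
    rw [this]
    simp

end PT

/-! ### Threshold sums of the weights -/

/-- The state of a pass through the string that sums up some of the weights: the numerator and the
denominator read so far of the current number, the value of the next digit, whether the digits
belong to the denominator, whether a minus sign has been read; the sum of the numbers before, as
`(plus - minus) / base`; and the coefficients (`0`, `1` or `-1`) of the numbers to come. -/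
structure SumState where
  /-- numerator of the current number -/
  num : ℕ
  /-- denominator of the current number -/
  den : ℕ
  /-- place value of the next digit -/
  pw : ℕ
  /-- whether the denominator is being read -/
  inDen : Bool
  /-- whether the current number is negative -/
  neg : Bool
  /-- numerator of the sum of the positive terms -/
  plus : ℕ
  /-- numerator of the sum of the absolute values of the negative terms -/
  minus : ℕ
  /-- common denominator -/
  base : ℕ
  /-- coefficients of the numbers to come -/
  coef : List (Option Bool)

namespace SumState

/-- The state as a tuple. -/
def tuple (s : SumState) : ℕ × ℕ × ℕ × Bool × Bool × ℕ × ℕ × ℕ × List (Option Bool) :=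
  (s.num, s.den, s.pw, s.inDen, s.neg, s.plus, s.minus, s.base, s.coef)

noncomputable instance : Enc SumState where
  Idx := Idx (ℕ × ℕ × ℕ × Bool × Bool × ℕ × ℕ × ℕ × List (Option Bool))
  enc s := enc s.tuple

/-- Reading one symbol. A comma ends a number, which is then added to the sum. -/
def step : Sym → SumState → SumState
  | .bit b, s =>
    { s with
      num := s.num + if b && !s.inDen then s.pw else 0
      den := s.den + if b && s.inDen then s.pw else 0
      pw := Nat.bit false s.pw }
  | .minus, s => { s with neg := true }
  | .slash, s => { s with inDen := true, pw := 1 }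
  | .comma, s =>
    { num := 0
      den := 0
      pw := 1
      inDen := false
      neg := false
      plus := s.plus * s.den +
        if decide (s.coef.head? = some (some !s.neg)) then s.num * s.base else 0
      minus := s.minus * s.den +
        if decide (s.coef.head? = some (some s.neg)) then s.num * s.base else 0
      base := s.base * s.den
      coef := s.coef.tail }
  | .semicolon, s => s
  | .feature _, s => s

/-- The state between two numbers. -/
def between (p m b : ℕ) (c : List (Option Bool)) : SumState :=
  ⟨0, 0, 1, false, false, p, m, b, c⟩

section PolyTime

variable {X : Type} [Enc X]

theorem pt_mk {f₁ f₂ f₃ : X → ℕ} {f₄ f₅ : X → Bool} {f₆ f₇ f₈ : X → ℕ}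
    {f₉ : X → List (Option Bool)} (h₁ : PT f₁) (h₂ : PT f₂) (h₃ : PT f₃) (h₄ : PT f₄) (h₅ : PT f₅)
    (h₆ : PT f₆) (h₇ : PT f₇) (h₈ : PT f₈) (h₉ : PT f₉) :
    PT fun x => SumState.mk (f₁ x) (f₂ x) (f₃ x) (f₄ x) (f₅ x) (f₆ x) (f₇ x) (f₈ x) (f₉ x) :=
  h₁.pair (h₂.pair (h₃.pair (h₄.pair (h₅.pair (h₆.pair (h₇.pair (h₈.pair h₉)))))))

theorem pt_tuple : PT tuple := PT.wire (fun k => k) fun _ _ => rfl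

theorem size_eq (s : SumState) : size s = size s.num + (size s.den + (size s.pw + (size s.inDen +
    (size s.neg + (size s.plus + (size s.minus + (size s.base + size s.coef))))))) := by
  show size s.tuple = _
  simp only [size_prod, tuple]

theorem pt_step (a : Sym) : PT (step a) := by
  have t₁ := PT.snd.comp pt_tuple
  have t₂ := PT.snd.comp t₁
  have t₃ := PT.snd.comp t₂
  have t₄ := PT.snd.comp t₃
  have t₅ := PT.snd.comp t₄
  have t₆ := PT.snd.comp t₅
  have t₇ := PT.snd.comp t₆
  have num : PT SumState.num := PT.fst.comp pt_tuple
  have den : PT SumState.den := PT.fst.comp t₁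
  have pw : PT SumState.pw := PT.fst.comp t₂
  have inDen : PT SumState.inDen := PT.fst.comp t₃
  have neg : PT SumState.neg := PT.fst.comp t₄
  have plus : PT SumState.plus := PT.fst.comp t₅
  have minus : PT SumState.minus := PT.fst.comp t₆
  have base : PT SumState.base := PT.fst.comp t₇
  have coef : PT SumState.coef := PT.snd.comp t₇
  have zero : PT fun _ : SumState => 0 := PT.constNat 0
  cases a with
  | bit b =>
    exact pt_mk (num.add ((((PT.constBool b).and inDen.not)).ite pw zero))
      (den.add (((PT.constBool b).and inDen).ite pw zero)) (pw.bit false) inDen neg plus minus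
      base coef
  | minus => exact pt_mk num den pw inDen (PT.constBool true) plus minus base coef
  | slash => exact pt_mk num den (PT.constNat 1) (PT.constBool true) neg plus minus base coef
  | comma =>
    have hc : ∀ n : Bool → Bool,
        PT fun s : SumState => decide (s.coef.head? = some (some (n s.neg))) := fun n =>
      PT.caseHead (f := fun o s => decide (o = some (some (n s.neg)))) coef fun o =>
        (neg.ite (PT.constBool (decide (o = some (some (n true)))))
          (PT.constBool (decide (o = some (some (n false)))))).congr fun s => by
            cases s.neg <;> rfl
    exact pt_mk zero zero (PT.constNat 1) (PT.constBool false) (PT.constBool false)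
      ((plus.mul den).add ((hc (fun b => !b)).ite (num.mul base) zero))
      ((minus.mul den).add ((hc (fun b => b)).ite (num.mul base) zero)) (base.mul den) coef.tail
  | semicolon => exact PT.id
  | feature v => exact PT.id

/-- A quantity bounding all numbers of a state, and growing at most fourfold in a step. -/
def pot (s : SumState) : ℕ := (s.plus + s.minus + s.base + 1) * (s.num + s.den + s.pw + 1)

theorem pot_step_le (a : Sym) (s : SumState) : (step a s).pot ≤ 4 * s.pot := by
  obtain ⟨n, d, w, i, ng, p, m, b, c⟩ := s
  have hpos : n + d + w + 1 ≤ (p + m + b + 1) * (n + d + w + 1) :=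
    Nat.le_mul_of_pos_left _ (by omega)
  cases a with
  | bit v =>
    simp only [pot, step]
    rw [Nat.mul_left_comm]
    refine Nat.mul_le_mul_left _ ?_
    rw [Nat.bit_val]
    split_ifs <;> simp <;> omega
  | slash =>
    simp only [pot, step]
    rw [Nat.mul_left_comm]
    exact Nat.mul_le_mul_left _ (by omega)
  | comma =>
    simp only [pot, step]
    have h₁ : ∀ q : Prop, [Decidable q] → (if q then n * b else 0) ≤ n * b := by
      intro q _; split_ifs <;> simp
    have h₂ := h₁ (decide (c.head? = some (some !ng)) = true)
    have h₃ := h₁ (decide (c.head? = some (some ng)) = true)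
    nlinarith [Nat.zero_le (p * n), Nat.zero_le (p * w), Nat.zero_le (m * n), Nat.zero_le (m * w),
      Nat.zero_le (b * w), Nat.zero_le (b * d), Nat.zero_le (p * d), Nat.zero_le (m * d)]
  | _ => simp only [pot, step]; omega

theorem pot_foldl_le (l : List Sym) (s : SumState) :
    (l.foldl (fun s a => step a s) s).pot ≤ 4 ^ l.length * s.pot := by
  induction l generalizing s with
  | nil => simp
  | cons a l ih =>
    rw [List.foldl_cons]
    refine (ih _).trans ?_
    rw [List.length_cons, pow_succ, Nat.mul_assoc]
    exact Nat.mul_le_mul_left _ (pot_step_le a s)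

theorem length_coef_foldl_le (l : List Sym) (s : SumState) :
    (l.foldl (fun s a => step a s) s).coef.length ≤ s.coef.length := by
  induction l generalizing s with
  | nil => simp
  | cons a l ih =>
    rw [List.foldl_cons]
    refine (ih _).trans ?_
    cases a <;> simp [step]

end PolyTime

end SumState

open SumState in
/-- Whether the sum of the numbers in the string, with the given coefficients, is nonnegative. -/
def sumNonneg (s : List Sym) (c : List (Option Bool)) : Bool :=
  let r := s.foldl (fun r a => step a r) (between 0 0 1 c)
  decide (r.minus ≤ r.plus)

open SumState in
theorem pt_sumNonneg : PT fun p : List Sym × List (Option Bool) => sumNonneg p.1 p.2 := by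
  have h := PT.foldl (X := List Sym × List (Option Bool)) (Y := SumState) (l := fun p => p.1)
    (init := fun p => between 0 0 1 p.2) (step := fun a p => step a p.2) PT.fst
    (pt_mk (PT.constNat 0) (PT.constNat 0) (PT.constNat 1) (PT.constBool false)
      (PT.constBool false) (PT.constNat 0) (PT.constNat 0) (PT.constNat 1) PT.snd)
    (fun a => (pt_step a).comp PT.snd) ?_
  · have hp : PT SumState.plus := PT.fst.comp
      (PT.snd.comp (PT.snd.comp (PT.snd.comp (PT.snd.comp (PT.snd.comp pt_tuple)))))
    have hm : PT SumState.minus := PT.fst.comp (PT.snd.comp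
      (PT.snd.comp (PT.snd.comp (PT.snd.comp (PT.snd.comp (PT.snd.comp pt_tuple))))))
    exact (hm.comp h).le (hp.comp h)
  · have hN : ∀ f : SumState → ℕ, (∀ s, f s ≤ s.pot) →
        PolyBdd (fun z : (List Sym × List (Option Bool)) × ℕ => size z.1) fun z =>
          size (f ((z.1.1.take z.2).foldl (fun r a => step a r) (between 0 0 1 z.1.2))) := by
      intro f hf
      have hl : PolyBdd (fun z : (List Sym × List (Option Bool)) × ℕ => size z.1) fun z =>
          z.1.1.length := (PT.fst.length_le (X := List Sym × List (Option Bool))).reindex Prod.fst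
      refine PolyBdd.size_nat ((((PolyBdd.const _ 2).mul hl).add (PolyBdd.const _ 3)).of_le
        fun z => ?_)
      rw [Nat.size_le]
      refine (hf _).trans_lt ((pot_foldl_le _ _).trans_lt ?_)
      have h₁ : 4 ^ (z.1.1.take z.2).length ≤ 4 ^ z.1.1.length :=
        Nat.pow_le_pow_right (by omega) (by simp)
      have h₂ : 2 ^ (2 * z.1.1.length + 3) = 4 ^ z.1.1.length * 8 := by
        rw [pow_add, pow_mul]; norm_num
      have h₃ : (between 0 0 1 z.1.2).pot = 4 := rfl
      have h₄ : 0 < 4 ^ z.1.1.length := by positivity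
      rw [h₂, h₃]
      omega
    have hpos : ∀ s : SumState, s.plus + s.minus + s.base + 1 ≤ s.pot ∧
        s.num + s.den + s.pw + 1 ≤ s.pot := fun s =>
      ⟨Nat.le_mul_of_pos_right _ (by omega), Nat.le_mul_of_pos_left _ (by omega)⟩
    have hc := PolyBdd.size_list (N := fun z : (List Sym × List (Option Bool)) × ℕ => size z.1)
      (l := fun z => ((z.1.1.take z.2).foldl (fun r a => step a r) (between 0 0 1 z.1.2)).coef)
      (((PT.snd.length_le (X := List Sym × List (Option Bool))).reindex Prod.fst).of_le
        fun z => length_coef_foldl_le _ _)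
    have hnum := hN num fun s => by have := hpos s; omega
    have hden := hN den fun s => by have := hpos s; omega
    have hpw := hN pw fun s => by have := hpos s; omega
    have hplus := hN plus fun s => by have := hpos s; omega
    have hminus := hN minus fun s => by have := hpos s; omega
    have hbase := hN base fun s => by have := hpos s; omega
    refine (hnum.add (hden.add (hpw.add ((PolyBdd.const _ 2).add ((PolyBdd.const _ 2).add
      (hplus.add (hminus.add (hbase.add hc)))))))).of_le fun z => ?_
    have h₁ := size_bool_le
      ((z.1.1.take z.2).foldl (fun r a => step a r) (between 0 0 1 z.1.2)).inDen
    have h₂ := size_bool_le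
      ((z.1.1.take z.2).foldl (fun r a => step a r) (between 0 0 1 z.1.2)).neg
    rw [SumState.size_eq]
    dsimp only
    omega

/-! ### Correctness of the sums -/

theorem digitsVal_encodeNat (m : ℕ) : digitsVal (Computability.encodeNat m) = m := by
  have key : ∀ p : PosNum, digitsVal (Computability.encodePosNum p) = (p : ℕ) := by
    intro p
    induction p with
    | one => rfl
    | bit0 p ih =>
      rw [Computability.encodePosNum, digitsVal_cons, ih, PosNum.cast_bit0]
      simp; omega
    | bit1 p ih =>
      rw [Computability.encodePosNum, digitsVal_cons, ih, PosNum.cast_bit1]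
      simp; omega
  rw [Computability.encodeNat]
  conv_rhs => rw [← Num.to_of_nat m]
  cases (m : Num) with
  | zero => rfl
  | pos p => exact key p

namespace SumState

theorem foldl_bits (l : List Bool) (s : SumState) :
    (l.map Sym.bit).foldl (fun s a => step a s) s =
      { s with
        num := s.num + if s.inDen then 0 else s.pw * digitsVal l
        den := s.den + if s.inDen then s.pw * digitsVal l else 0
        pw := s.pw * 2 ^ l.length } := by
  induction l generalizing s with
  | nil => simp
  | cons b l ih =>
    rw [List.map_cons, List.foldl_cons, ih]
    obtain ⟨n, d, w, i, ng, p, m, bs, c⟩ := s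
    cases i <;> cases b <;> simp [step, pow_succ, Nat.bit_val] <;> (try constructor) <;> ring

/-- The pass over a number adds it, with the coefficient at the head of `c`, to the sum. -/
theorem foldl_encRat (q : ℚ) (p m b : ℕ) (c : List (Option Bool)) :
    (encRat q ++ [Sym.comma]).foldl (fun s a => step a s) (between p m b c) =
      between
        (p * q.den + if c.head? = some (some !decide (q < 0)) then q.num.natAbs * b else 0)
        (m * q.den + if c.head? = some (some (decide (q < 0))) then q.num.natAbs * b else 0)
        (b * q.den) c.tail := by
  have hneg : ∀ s : SumState, s.neg = false →
      (if q.num < 0 then [Sym.minus] else []).foldl (fun s a => step a s) s =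
        { s with neg := decide (q < 0) } := by
    intro s hs
    obtain ⟨n, d, w, i, ng, p, m, bs, c⟩ := s
    obtain rfl : ng = false := hs
    by_cases h : q < 0
    · rw [if_pos (Rat.num_neg.2 h)]; simp [step, h]
    · rw [if_neg (fun h' => h (Rat.num_neg.1 h'))]; simp [h]
  have hslash : ∀ s, step .slash s = { s with inDen := true, pw := 1 } := fun _ => rfl
  have hcomma : ∀ n d w i ng p m b c, step .comma ⟨n, d, w, i, ng, p, m, b, c⟩ = between
      (p * d + if c.head? = some (some !ng) then n * b else 0)
      (m * d + if c.head? = some (some ng) then n * b else 0) (b * d) c.tail := by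
    intros
    simp [step, between]
  rw [encRat, encInt, encNat, encNat]
  simp only [List.foldl_append]
  rw [hneg (between p m b c) rfl]
  simp only [foldl_bits, digitsVal_encodeNat, List.foldl_cons, List.foldl_nil, hslash, between,
    Nat.one_mul, Nat.zero_add, if_false, if_true, Bool.false_eq_true, Nat.add_zero]
  rw [hcomma, between]

/-- The rational number that a coefficient stands for. -/
def coefVal : Option Bool → ℚ
  | none => 0
  | some true => 1
  | some false => -1

theorem foldl_flatMap_encRat (qs : List ℚ) :
    ∀ (cs : List (Option Bool)) (p m b : ℕ), cs.length = qs.length → 0 < b →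
      ∃ p' m' b' : ℕ, 0 < b' ∧
        (qs.flatMap fun q => encRat q ++ [Sym.comma]).foldl (fun s a => step a s)
          (between p m b cs) = between p' m' b' [] ∧
        ((p' : ℚ) - m') / b' =
          (p - m) / b + (List.zipWith (fun q c => coefVal c * q) qs cs).sum := by
  induction qs with
  | nil =>
    intro cs p m b h hb
    obtain rfl : cs = [] := by simpa using h
    exact ⟨p, m, b, hb, rfl, by simp⟩
  | cons q qs ih =>
    intro cs p m b h hb
    obtain ⟨c, cs, rfl⟩ : ∃ c cs', cs = c :: cs' := by
      cases cs with
      | nil => simp at h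
      | cons c cs => exact ⟨c, cs, rfl⟩
    obtain ⟨p', m', b', hb', h₁, h₂⟩ := ih cs
      (p * q.den + if (c :: cs).head? = some (some !decide (q < 0)) then q.num.natAbs * b else 0)
      (m * q.den + if (c :: cs).head? = some (some (decide (q < 0))) then q.num.natAbs * b else 0)
      (b * q.den) (by simpa using h) (Nat.mul_pos hb q.den_pos)
    refine ⟨p', m', b', hb', ?_, ?_⟩
    · rw [List.flatMap_cons, List.foldl_append, foldl_encRat]
      exact h₁
    · rw [h₂, List.zipWith_cons_cons, List.sum_cons, ← add_assoc]
      congr 1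
      have hb0 : (b : ℚ) ≠ 0 := by exact_mod_cast hb.ne'
      have hd : (q.den : ℚ) ≠ 0 := by exact_mod_cast q.den_ne_zero
      have hq : q = q.num / q.den := (Rat.num_div_den q).symm
      have hterm : coefVal c * q =
          ((if (c :: cs).head? = some (some !decide (q < 0)) then q.num.natAbs * b else 0 : ℕ) -
            (if (c :: cs).head? = some (some (decide (q < 0))) then q.num.natAbs * b else 0 : ℕ) :
            ℚ) / (b * q.den) := by
        have habs : (q.num.natAbs : ℚ) = |(q.num : ℚ)| := by
          rw [← Int.cast_abs, Int.abs_eq_natAbs]; simp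
        by_cases hlt : q < 0
        · have h0 : (q.num : ℚ) < 0 := by exact_mod_cast Rat.num_neg.2 hlt
          rw [abs_of_neg h0] at habs
          rcases c with - | (- | -) <;> simp [hlt, coefVal, habs] <;> field_simp <;>
            linarith [Rat.mul_den_eq_num q]
        · have h0 : 0 ≤ (q.num : ℚ) := by exact_mod_cast Rat.num_nonneg.2 (not_lt.1 hlt)
          rw [abs_of_nonneg h0] at habs
          rcases c with - | (- | -) <;> simp [hlt, coefVal, habs] <;> field_simp <;>
            linarith [Rat.mul_den_eq_num q]
      rw [hterm]
      push_cast
      field_simp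
      ring

theorem foldl_of_ignored {l : List Sym} (h : ∀ a ∈ l, ∀ s, step a s = s) (s : SumState) :
    l.foldl (fun s a => step a s) s = s := by
  induction l generalizing s with
  | nil => rfl
  | cons a l ih =>
    rw [List.foldl_cons, h a (by simp), ih fun b hb => h b (by simp [hb])]

end SumState

/-! ### Parsing the input -/

section Transduce

variable {A B : Type}

/-- The output of a transducer with two states: `g a q` is the new state and the output when `a`
is read in state `q`. -/
def transduce (g : A → Bool → Bool × List B) : Bool → List A → List B
  | _, [] => []
  | q, a :: l => (g a q).2 ++ transduce g (g a q).1 l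

theorem foldl_transduce (g : A → Bool → Bool × List B) (l : List A) (q : Bool) (acc : List B) :
    (l.foldl (fun p a => ((g a p.1).1, (g a p.1).2.reverse ++ p.2)) (q, acc)).2 =
      (transduce g q l).reverse ++ acc := by
  induction l generalizing q acc with
  | nil => simp [transduce]
  | cons a l ih => rw [List.foldl_cons, ih]; simp [transduce]

theorem length_transduce_le [Fintype A] (g : A → Bool → Bool × List B) (l : List A) (q : Bool) :
    (transduce g q l).length ≤
      (∑ a, ((g a true).2.length + (g a false).2.length)) * l.length := by
  induction l generalizing q with
  | nil => simp [transduce]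
  | cons a l ih =>
    have h₁ := ih (g a q).1
    have h₂ := Finset.single_le_sum (f := fun a => (g a true).2.length + (g a false).2.length)
      (fun _ _ => Nat.zero_le _) (Finset.mem_univ a)
    have h₃ : (g a q).2.length ≤ (g a true).2.length + (g a false).2.length := by
      cases q <;> omega
    simp only [transduce, List.length_append, List.length_cons, Nat.mul_succ]
    omega

theorem PT.transduce [Fintype A] [Fintype B] {X : Type} [Enc X] (g : A → Bool → Bool × List B)
    (q : Bool) {l : X → List A} (hl : PT l) : PT fun x => Foil.transduce g q (l x) := by
  have h := PT.foldl (Y := Bool × List B) (init := fun _ => (q, []))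
    (step := fun a p => ((g a p.2.1).1, (g a p.2.1).2.reverse ++ p.2.2)) hl
    ((PT.constBool q).pair PT.nil) (fun a => by
      have h₁ : PT fun p : X × Bool × List B => p.2.1 := PT.fst.comp PT.snd
      have h₂ : PT fun p : X × Bool × List B => p.2.2 := PT.snd.comp PT.snd
      refine (h₁.ite ((PT.constBool (g a true).1).pair
        ((PT.constList (g a true).2.reverse).append h₂)) ((PT.constBool (g a false).1).pair
        ((PT.constList (g a false).2.reverse).append h₂))).congr fun p => ?_
      cases p.2.1 <;> rfl) ?_
  · exact (PT.snd.comp h).reverse_list.congr fun x => by simp [foldl_transduce]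
  · refine PolyBdd.size_pair PolyBdd.size_bool (PolyBdd.size_list
      (((PolyBdd.const _ (∑ a, ((g a true).2.length + (g a false).2.length))).mul
        (hl.length_le.reindex Prod.fst)).of_le fun z => ?_))
    simp only [foldl_transduce, List.append_nil, List.length_reverse]
    exact (length_transduce_le _ _ _).trans (Nat.mul_le_mul_left _ (List.length_take_le' _ _))

end Transduce

/-- The signs of the numbers in the string. -/
def signs (s : List Sym) : List Bool :=
  transduce (fun a q => match a with
    | .minus => (true, [])
    | .comma => (false, [q])
    | _ => (q, [])) false s

/-- The part of the string after the first semicolon. -/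
def afterSemicolon (s : List Sym) : List Sym :=
  transduce (fun a q => if q then (true, [a]) else (decide (a = .semicolon), [])) false s

/-- The features before the first semicolon of the string. -/
def features (s : List Sym) : List (Option Bool) :=
  transduce (fun a q => match a with
    | .feature v => (q, if q then [] else [v])
    | .semicolon => (true, [])
    | _ => (q, [])) false s

theorem signs_encRat (q : ℚ) (s : List Sym) :
    signs (encRat q ++ [Sym.comma] ++ s) = decide (q < 0) :: signs s := by
  have hbits : ∀ (l : List Bool) (b : Bool) (r : List Sym),
      transduce (fun a q => match a with
        | .minus => (true, [])
        | .comma => (false, [q])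
        | _ => (q, [])) b (l.map Sym.bit ++ r) = transduce (fun a q => match a with
        | .minus => (true, [])
        | .comma => (false, [q])
        | _ => (q, [])) b r := by
    intro l b r
    induction l with
    | nil => rfl
    | cons a l ih => exact ih
  by_cases h : q < 0
  · simp [encRat, encInt, encNat, h, signs, transduce, hbits]
  · simp [encRat, encInt, encNat, h, signs, transduce, hbits]

theorem signs_flatMap (qs : List ℚ) (s : List Sym) :
    signs ((qs.flatMap fun q => encRat q ++ [Sym.comma]) ++ s) =
      (qs.map fun q => decide (q < 0)) ++ signs s := by
  induction qs with
  | nil => rfl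
  | cons q qs ih => rw [List.flatMap_cons, List.append_assoc, signs_encRat, ih]; rfl

theorem signs_eq_nil {s : List Sym} (h : ∀ a ∈ s, a = .semicolon ∨ ∃ v, a = .feature v) :
    signs s = [] := by
  induction s with
  | nil => rfl
  | cons a s ih =>
    have ih := ih fun b hb => h b (by simp [hb])
    rcases h a (by simp) with rfl | ⟨v, rfl⟩ <;> exact ih

theorem afterSemicolon_append {l : List Sym} (h : ∀ a ∈ l, a ≠ .semicolon) (s : List Sym) :
    afterSemicolon (l ++ .semicolon :: s) = s := by
  induction l with
  | nil =>
    have : ∀ s : List Sym, transduce (fun a q => if q then (true, [a]) else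
        (decide (a = .semicolon), [])) true s = s := by
      intro s
      induction s with
      | nil => rfl
      | cons a s ih => simpa [transduce] using ih
    simpa [afterSemicolon, transduce] using this s
  | cons a l ih =>
    have ih := ih fun b hb => h b (by simp [hb])
    have ha := h a (by simp)
    simpa [afterSemicolon, transduce, ha] using ih

theorem features_append (l : List (Option Bool)) (s : List Sym) :
    features (l.map Sym.feature ++ .semicolon :: s) = l := by
  induction l with
  | nil =>
    have : ∀ s : List Sym, transduce (fun a q => match a with
        | .feature v => (q, if q then [] else [v])
        | .semicolon => (true, [])
        | _ => (q, [])) true s = ([] : List (Option Bool)) := by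
      intro s
      induction s with
      | nil => rfl
      | cons a s ih => cases a <;> simpa [transduce] using ih
    simpa [features, transduce] using this s
  | cons a l ih => simpa [features, transduce] using ih

/-- The features of the partial instance number `j`. -/
def column (j : ℕ) (s : List Sym) : List (Option Bool) := features (afterSemicolon^[j + 1] s)

theorem pt_column (j : ℕ) : PT (column j) := by
  have h : ∀ j, PT (afterSemicolon^[j]) := by
    intro j
    induction j with
    | zero => exact PT.id
    | succ j ih => exact ih.comp (PT.id.transduce _ _)
  exact (h (j + 1)).transduce _ _

section Encode

variable {k : ℕ} (I : PtronInput k)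

/-- The numbers of an input: the threshold, and the weights. -/
def PtronInput.numbers : List ℚ := I.t :: List.ofFn I.w

theorem PtronInput.encode_eq : I.encode =
    (I.numbers.flatMap fun q => encRat q ++ [Sym.comma]) ++ .semicolon ::
      (List.ofFn I.e).flatMap fun a => encPInst a ++ [Sym.semicolon] := by
  simp [PtronInput.encode, PtronInput.numbers]

theorem mem_encode_tail {a : Sym}
    (h : a ∈ Sym.semicolon :: (List.ofFn I.e).flatMap fun a => encPInst a ++ [Sym.semicolon]) :
    a = .semicolon ∨ ∃ v, a = .feature v := by
  simp only [List.mem_cons, List.mem_flatMap, List.mem_append, encPInst, List.mem_map,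
    List.not_mem_nil, or_false] at h
  rcases h with rfl | ⟨e, -, ⟨v, -, rfl⟩ | rfl⟩
  exacts [.inl rfl, .inr ⟨v, rfl⟩, .inl rfl]

theorem signs_encode : signs I.encode = I.numbers.map fun q => decide (q < 0) := by
  rw [I.encode_eq, signs_flatMap, signs_eq_nil fun a => mem_encode_tail I, List.append_nil]

theorem afterSemicolon_encode : afterSemicolon I.encode =
    (List.ofFn I.e).flatMap fun a => encPInst a ++ [Sym.semicolon] := by
  rw [I.encode_eq]
  refine afterSemicolon_append (fun a ha => ?_) _
  simp only [List.mem_flatMap, List.mem_append, encRat, encInt, encNat, List.mem_map,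
    List.mem_singleton] at ha
  rcases ha with ⟨q, -, (((h | ⟨b, -, rfl⟩) | rfl) | ⟨b, -, rfl⟩) | rfl⟩ <;> try simp
  split_ifs at h <;> simp at h
  simp [h]

theorem column_encode (j : Fin k) : column j I.encode = List.ofFn (I.e j) := by
  have key : ∀ (j : ℕ) (es : List (PInst I.n)) (h : j < es.length),
      features (afterSemicolon^[j] (es.flatMap fun a => encPInst a ++ [Sym.semicolon])) =
        List.ofFn es[j] := by
    intro j
    induction j with
    | zero =>
      intro es h
      obtain ⟨e, es, rfl⟩ := List.exists_cons_of_length_pos h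
      simpa [encPInst] using features_append (List.ofFn e) _
    | succ j ih =>
      intro es h
      obtain ⟨e, es, rfl⟩ := List.exists_cons_of_length_pos (Nat.zero_lt_of_lt h)
      rw [iterate_succ_apply, List.flatMap_cons, List.append_assoc, List.singleton_append,
        afterSemicolon_append, ih es (by simpa using h)]
      · rfl
      · simp [encPInst]
  rw [column, iterate_succ_apply, afterSemicolon_encode, key j _ (by simp)]
  simp

end Encode

/-! ### Cells -/

/-- What is recorded about a feature: its values in the given partial instances, whether its weight
is negative, and possibly a mark. -/
abbrev Cell (k : ℕ) (V : Type) : Type := (Fin k → Option Bool) × Bool × Option V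

section Cells

variable {k : ℕ} {V : Type}

/-- The unmarked cells of an input, with the values in the partial instances of the list `js`. -/
def cells (V : Type) : List (Fin k) → List Sym → List (Cell k V)
  | [], s => (signs s).tail.map fun b => (fun _ => none, b, none)
  | j :: js, s => List.zipWith (fun c v => (update c.1 j v, c.2)) (cells V js s) (column j s)

theorem pt_cells [Fintype V] (js : List (Fin k)) : PT (cells V js) := by
  induction js with
  | nil => exact (PT.id.transduce _ _).tail.map _
  | cons j js ih => exact ih.zipWith _ (pt_column j)

theorem cells_encode (I : PtronInput k) (js : List (Fin k)) :
    cells V js I.encode = List.ofFn fun i =>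
      (fun j => if j ∈ js then I.e j i else none, decide (I.w i < 0), none) := by
  induction js with
  | nil =>
    rw [cells, signs_encode]
    simp [PtronInput.numbers, List.map_ofFn, Function.comp_def]
  | cons j js ih =>
    rw [cells, ih, column_encode]
    refine List.ext_getElem (by simp) fun i h₁ h₂ => ?_
    simp only [List.getElem_zipWith, List.getElem_ofFn, List.mem_cons, Prod.mk.injEq, and_true]
    funext j'
    by_cases e : j' = j
    · subst e; simp
    · simp [e]

end Cells

/-! ### Searching for marks -/

section Search

variable {X C V : Type}

open Classical in
/-- Whether `D` accepts the word itself or the word with one symbol changed by some `upd v`. -/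
noncomputable def someUpdate (upd : V → C → C) (D : X × List C → Bool) (p : X × List C) : Bool :=
  D p || decide (∃ i v, i < p.2.length ∧ D (p.1, p.2.modify i (upd v)) = true)

theorem someUpdate_eq_true {upd : V → C → C} {D : X × List C → Bool} {p : X × List C} :
    someUpdate upd D p = true ↔
      D p = true ∨ ∃ i v, i < p.2.length ∧ D (p.1, p.2.modify i (upd v)) = true := by
  simp [someUpdate]

/-- If the search succeeds, then `D` accepts some word that differs from the given one only by
updates. -/
theorem exists_of_iterate_someUpdate {upd : V → C → C} {D : X × List C → Bool} {B : Type}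
    {π : C → B} (hπ : ∀ v a, π (upd v a) = π a) (c : ℕ) :
    ∀ {x : X} {l : List C}, (someUpdate upd)^[c] D (x, l) = true →
      ∃ l' : List C, l'.map π = l.map π ∧ D (x, l') = true := by
  induction c with
  | zero => exact fun {x l} h => ⟨l, rfl, h⟩
  | succ c ih =>
    intro x l h
    rw [iterate_succ_apply', someUpdate_eq_true] at h
    rcases h with h | ⟨i, v, -, h⟩
    · exact ih h
    · obtain ⟨l', h₁, h₂⟩ := ih h
      refine ⟨l', h₁.trans ?_, h₂⟩
      refine List.ext_getElem? fun j => ?_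
      simp only [List.getElem?_map, List.getElem?_modify]
      by_cases e : i = j
      · cases hj : l[j]? <;> simp [e, hπ]
      · simp [e]

/-- The search succeeds if `D` accepts a word that results from updates at no more positions than
there are rounds. -/
theorem iterate_someUpdate_of_finset {upd : V → C → C} {D : X × List C → Bool} {n : ℕ}
    (m : Fin n → V) (W : Finset (Fin n)) :
    ∀ {c : ℕ} {x : X} {f : Fin n → C}, W.card ≤ c →
      D (x, List.ofFn fun i => if i ∈ W then upd (m i) (f i) else f i) = true →
      (someUpdate upd)^[c] D (x, List.ofFn f) = true := by
  induction W using Finset.induction_on with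
  | empty =>
    intro c x f _ h
    induction c with
    | zero => simpa using h
    | succ c ih =>
      rw [iterate_succ_apply', someUpdate, ih (by simp)]
      rfl
  | insert a W ha ih =>
    intro c x f hc h
    rw [Finset.card_insert_of_notMem ha] at hc
    obtain ⟨c, rfl⟩ : ∃ d, c = d + 1 := ⟨c - 1, by omega⟩
    rw [iterate_succ_apply', someUpdate_eq_true]
    refine .inr ⟨a, m a, by simp, ?_⟩
    have hmod : (List.ofFn f).modify a (upd (m a)) =
        List.ofFn (update f a (upd (m a) (f a))) := by
      refine List.ext_getElem (by simp) fun j h₁ h₂ => ?_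
      simp only [List.getElem_modify, List.getElem_ofFn, update_apply, Fin.ext_iff]
      by_cases e : (a : ℕ) = j
      · subst e; simp
      · simp [e, Ne.symm e]
    show (someUpdate upd)^[c] D (x, (List.ofFn f).modify a (upd (m a))) = true
    rw [hmod]
    refine ih (by omega) ?_
    convert h using 4 with i
    funext i
    by_cases e : i = a
    · subst e; simp [ha]
    · simp [e]

variable [Enc X] [Fintype C]

/-- There are as many words to be tried as positions in the word, up to a constant factor, and a
single pass over the word produces all of them. -/
theorem PT.someUpdate [Fintype V] (upd : V → C → C) {D : X × List C → Bool} (hD : PT D) :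
    PT (someUpdate upd D) := by
  -- the state: the symbols passed, in reverse order, those to come, and whether `D` has accepted
  let step : C → (X × List C) × List C × List C × Bool → List C × List C × Bool := fun a p =>
    (a :: p.2.1, p.2.2.1.tail, p.2.2.2 ||
      Foil.existsB fun v => D (p.1.1, p.2.1.reverse ++ upd v a :: p.2.2.1.tail))
  have hstep : ∀ a, PT (step a) := by
    intro a
    have h₁ : PT fun p : (X × List C) × List C × List C × Bool => p.2.1 := PT.fst.comp PT.snd
    have h₂ : PT fun p : (X × List C) × List C × List C × Bool => p.2.2.1 :=
      PT.fst.comp (PT.snd.comp PT.snd)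
    have h₃ : PT fun p : (X × List C) × List C × List C × Bool => p.2.2.2 :=
      PT.snd.comp (PT.snd.comp PT.snd)
    have h₄ : PT fun p : (X × List C) × List C × List C × Bool => p.1.1 := PT.fst.comp PT.fst
    exact (h₁.cons a).pair (h₂.tail.pair (h₃.or (PT.existsB fun v =>
      hD.comp (h₄.pair (h₁.reverse_list.append (h₂.tail.cons (upd v a)))))))
  have key₁ : ∀ (p : X × List C) (l : List C) (y : List C × List C × Bool),
      (l.foldl (fun y a => step a (p, y)) y).1 = l.reverse ++ y.1 ∧
      (l.foldl (fun y a => step a (p, y)) y).2.1 = y.2.1.drop l.length := by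
    intro p l
    induction l with
    | nil => simp
    | cons a l ih =>
      intro y
      rw [List.foldl_cons, (ih _).1, (ih _).2]
      simp [step]
  have key₂ : ∀ (p : X × List C) (l left : List C) (r : Bool),
      (l.foldl (fun y a => step a (p, y)) (left, l, r)).2.2 = true ↔ r = true ∨
        ∃ i v, i < l.length ∧ D (p.1, left.reverse ++ l.modify i (upd v)) = true := by
    intro p l
    induction l with
    | nil => simp
    | cons a l ih =>
      intro left r
      rw [List.foldl_cons]
      refine (ih (a :: left) _).trans ?_
      simp only [List.tail_cons, Bool.or_eq_true, existsB_eq_true, or_assoc]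
      refine or_congr_right ?_
      constructor
      · rintro (⟨v, h⟩ | ⟨i, v, hi, h⟩)
        · exact ⟨0, v, by simp, by simpa using h⟩
        · exact ⟨i + 1, v, by simpa using hi, by simpa using h⟩
      · rintro ⟨i, v, hi, h⟩
        cases i with
        | zero => exact .inl ⟨v, by simpa using h⟩
        | succ i => exact .inr ⟨i, v, by simpa using hi, by simpa using h⟩
  have h := PT.foldl (X := X × List C) (Y := List C × List C × Bool) (l := fun p => p.2)
    (init := fun p => ([], p.2, D p)) (step := step) PT.snd (PT.nil.pair (PT.snd.pair hD)) hstep ?_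
  · refine (PT.snd.comp (PT.snd.comp h)).congr fun p => ?_
    rw [Bool.eq_iff_iff, key₂, someUpdate_eq_true]
    simp
  · have hl : PolyBdd (fun z : (X × List C) × ℕ => size z.1) fun z => z.1.2.length :=
      (PT.snd.length_le (X := X × List C)).reindex Prod.fst
    refine PolyBdd.size_pair (PolyBdd.size_list (hl.of_le fun z => ?_))
      (PolyBdd.size_pair (PolyBdd.size_list (hl.of_le fun z => ?_)) PolyBdd.size_bool)
    · rw [(key₁ _ _ _).1]; simp
    · rw [(key₁ _ _ _).2]; simp

theorem PT.iterate_someUpdate [Fintype V] (upd : V → C → C) {D : X × List C → Bool} (hD : PT D)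
    (c : ℕ) : PT ((Foil.someUpdate upd)^[c] D) := by
  induction c with
  | zero => exact hD
  | succ c ih => rw [iterate_succ_apply']; exact ih.someUpdate upd

end Search

/-! ### Atomic facts -/

/-- The atomic facts about partial instances named by the elements of `V`. -/
inductive Atom (V : Type) : Type
  | sub (x y : V) : Atom V
  | full (x : V) : Atom V
  | allPos (x : V) : Atom V
  | allNeg (x : V) : Atom V
  deriving Fintype

/-- Renaming the names in an atomic fact. -/
def Atom.map {V V' : Type} (f : V → V') : Atom V → Atom V'
  | .sub x y => .sub (f x) (f y)
  | .full x => .full (f x)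
  | .allPos x => .allPos (f x)
  | .allNeg x => .allNeg (f x)

/-- The truth of an atomic fact, in the model `M`, about the partial instances `s x`. -/
def Holds {n : ℕ} {V : Type} (M : Model n) (s : V → PInst n) : Atom V → Prop
  | .sub x y => Subsumed (s x) (s y)
  | .full x => Full (s x)
  | .allPos x => AllPos M (s x)
  | .allNeg x => AllNeg M (s x)

theorem holds_map {n : ℕ} {V V' : Type} (M : Model n) (s : V' → PInst n) (f : V → V')
    (a : Atom V) : Holds M s (a.map f) ↔ Holds M (s ∘ f) a := by
  cases a <;> rfl

theorem Subsumed.refl {n : ℕ} (e : PInst n) : Subsumed e e := fun _ _ => rfl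

theorem Subsumed.trans {n : ℕ} {e₁ e₂ e₃ : PInst n} (h₁ : Subsumed e₁ e₂) (h₂ : Subsumed e₂ e₃) :
    Subsumed e₁ e₃ := fun i hi => (h₁ i hi).trans (h₂ i (h₁ i hi ▸ hi))

theorem eq_iff_subsumed {n : ℕ} {e₁ e₂ : PInst n} :
    e₁ = e₂ ↔ Subsumed e₁ e₂ ∧ Subsumed e₂ e₁ := by
  refine ⟨fun h => h ▸ ⟨.refl _, .refl _⟩, fun ⟨h₁, h₂⟩ => funext fun i => ?_⟩
  by_cases h : e₁ i = none
  · by_cases h' : e₂ i = none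
    · rw [h, h']
    · exact (h₂ i h').symm
  · exact h₁ i h

theorem full_iff {n : ℕ} {e : PInst n} : Full e ↔ ∀ i, e i ≠ none := by
  refine ⟨fun h i hi => ?_, fun h y hy => funext fun i => hy i (h i)⟩
  have := congrFun (h (fun i => some ((e i).getD true)) fun j hj => by
    obtain ⟨b, hb⟩ := Option.ne_none_iff_exists'.1 hj
    simp [hb]) i
  simp [hi] at this

theorem full_some {n : ℕ} (x : Inst n) : Full fun i => some (x i) := full_iff.2 fun _ => nofun

theorem Full.exists_inst {n : ℕ} {e : PInst n} (h : Full e) :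
    ∃ x : Inst n, e = fun i => some (x i) :=
  ⟨fun i => (e i).get (Option.isSome_iff_ne_none.2 (full_iff.1 h i)), by simp⟩

theorem pos_some {n : ℕ} {M : Model n} {x : Inst n} : Pos M (fun i => some (x i)) ↔ M x = true := by
  refine ⟨fun ⟨y, h, hy⟩ => ?_, fun h => ⟨x, fun _ => rfl, h⟩⟩
  rwa [show x = y from funext fun i => Option.some.inj (h i)]

theorem Pos.full {n : ℕ} {M : Model n} {e : PInst n} (h : Pos M e) : Full e :=
  full_iff.2 fun i => by obtain ⟨x, hx, -⟩ := h; simp [hx]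

theorem pos_iff {n : ℕ} {M : Model n} {e : PInst n} : Pos M e ↔ Full e ∧ AllPos M e :=
  ⟨fun h => ⟨h.full, fun y hy => h.full y hy.1 ▸ h⟩, fun h => h.2 e ⟨.refl _, h.1⟩⟩

theorem allPos_iff {n : ℕ} {M : Model n} {e : PInst n} :
    AllPos M e ↔ ∀ x : Inst n, Subsumed e (fun i => some (x i)) → M x = true := by
  refine ⟨fun h x hx => pos_some.1 (h _ ⟨hx, full_some x⟩), fun h y ⟨hy, hf⟩ => ?_⟩
  obtain ⟨x, rfl⟩ := hf.exists_inst
  exact pos_some.2 (h x hy)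

theorem allNeg_iff {n : ℕ} {M : Model n} {e : PInst n} :
    AllNeg M e ↔ ∀ x : Inst n, Subsumed e (fun i => some (x i)) → M x = false := by
  refine ⟨fun h x hx => ?_, fun h y hy hp => ?_⟩
  · simpa using fun hM => h _ hx (pos_some.2 hM)
  · obtain ⟨x, rfl⟩ := hp.full.exists_inst
    simpa [h x hy] using pos_some.1 hp

theorem AllPos.mono {n : ℕ} {M : Model n} {e e' : PInst n} (h : AllPos M e) (he : Subsumed e e') :
    AllPos M e' := fun y hy => h y ⟨he.trans hy.1, hy.2⟩

theorem AllNeg.mono {n : ℕ} {M : Model n} {e e' : PInst n} (h : AllNeg M e) (he : Subsumed e e') :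
    AllNeg M e' := fun y hy => h y (he.trans hy)

theorem AllPos.not_allNeg {n : ℕ} {M : Model n} {e : PInst n} (h : AllPos M e) :
    ¬ AllNeg M e := fun h' => by
  have he : Subsumed e fun i => some ((e i).getD true) := fun j hj => by
    obtain ⟨b, hb⟩ := Option.ne_none_iff_exists'.1 hj
    simp [hb]
  exact h' _ he (h _ ⟨he, full_some _⟩)

theorem Full.allPos_or_allNeg {n : ℕ} (M : Model n) {e : PInst n} (h : Full e) :
    AllPos M e ∨ AllNeg M e := by
  by_cases hp : Pos M e
  · exact .inl (pos_iff.1 hp).2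
  · exact .inr fun y hy => h y hy ▸ hp

/-! ### Existential queries -/

/-- A query on `k` partial instances is existential if it asks for finitely many further partial
instances such that the atomic facts about all of them satisfy a fixed condition. -/
def IsExistential {k : ℕ} (Q : ∀ ⦃n : ℕ⦄, Model n → (Fin k → PInst n) → Prop) : Prop :=
  ∃ (ι : Type) (_ : Fintype ι) (T : (Atom (Fin k ⊕ ι) → Prop) → Prop),
    ∀ (n : ℕ) (M : Model n) (v : Fin k → PInst n),
      Q M v ↔ ∃ u : ι → PInst n, T (Holds M (Sum.elim v u))

section Existential

variable {k : ℕ}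

theorem exists_of_quantifierFree (φ : Formula k) (h₁ : φ.NoEx) (h₂ : φ.NoAll) :
    ∃ T : (Atom (Fin k) → Prop) → Prop, ∀ (n : ℕ) (M : Model n) (v : Fin k → PInst n),
      Sat M φ v ↔ T (Holds M v) := by
  induction φ with
  | eq i j => exact ⟨fun h => h (.sub i j) ∧ h (.sub j i), fun _ _ _ => eq_iff_subsumed⟩
  | sub i j => exact ⟨fun h => h (.sub i j), fun _ _ _ => .rfl⟩
  | pos i => exact ⟨fun h => h (.full i) ∧ h (.allPos i), fun _ _ _ => pos_iff⟩
  | full i => exact ⟨fun h => h (.full i), fun _ _ _ => .rfl⟩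
  | allPos i => exact ⟨fun h => h (.allPos i), fun _ _ _ => .rfl⟩
  | allNeg i => exact ⟨fun h => h (.allNeg i), fun _ _ _ => .rfl⟩
  | neg φ ih =>
    obtain ⟨T, hT⟩ := ih h₁ h₂
    exact ⟨fun h => ¬ T h, fun n M v => not_congr (hT n M v)⟩
  | or φ ψ ih₁ ih₂ =>
    obtain ⟨T₁, hT₁⟩ := ih₁ h₁.1 h₂.1
    obtain ⟨T₂, hT₂⟩ := ih₂ h₁.2 h₂.2
    exact ⟨fun h => T₁ h ∨ T₂ h, fun n M v => or_congr (hT₁ n M v) (hT₂ n M v)⟩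
  | and φ ψ ih₁ ih₂ =>
    obtain ⟨T₁, hT₁⟩ := ih₁ h₁.1 h₂.1
    obtain ⟨T₂, hT₂⟩ := ih₂ h₁.2 h₂.2
    exact ⟨fun h => T₁ h ∧ T₂ h, fun n M v => and_congr (hT₁ n M v) (hT₂ n M v)⟩
  | ex φ => exact h₁.elim
  | all φ => exact h₂.elim

theorem IsExistential.congr {Q Q' : ∀ ⦃n : ℕ⦄, Model n → (Fin k → PInst n) → Prop}
    (h : IsExistential Q) (hQ : ∀ ⦃n : ℕ⦄ (M : Model n) v, Q M v ↔ Q' M v) : IsExistential Q' := by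
  obtain ⟨ι, _, T, hT⟩ := h
  exact ⟨ι, ‹_›, T, fun n M v => (hQ M v).symm.trans (hT n M v)⟩

theorem isExistential_of_forall_iff {Q : ∀ ⦃n : ℕ⦄, Model n → (Fin k → PInst n) → Prop}
    (T : (Atom (Fin k) → Prop) → Prop) (h : ∀ n (M : Model n) v, Q M v ↔ T (Holds M v)) :
    IsExistential Q := by
  refine ⟨Empty, inferInstance, fun h => T fun a => h (a.map Sum.inl), fun n M v => ?_⟩
  simp only [holds_map, Sum.elim_comp_inl]
  rw [h]
  exact ⟨fun h => ⟨nofun, h⟩, fun ⟨_, h⟩ => h⟩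

theorem IsExistential.combine (op : Prop → Prop → Prop)
    (hop : ∀ {α β : Type} [Nonempty α] [Nonempty β] (A : α → Prop) (B : β → Prop),
      op (∃ x, A x) (∃ y, B y) ↔ ∃ x y, op (A x) (B y))
    {Q₁ Q₂ : ∀ ⦃n : ℕ⦄, Model n → (Fin k → PInst n) → Prop}
    (h₁ : IsExistential Q₁) (h₂ : IsExistential Q₂) :
    IsExistential fun _ M v => op (Q₁ M v) (Q₂ M v) := by
  obtain ⟨ι₁, _, T₁, hT₁⟩ := h₁
  obtain ⟨ι₂, _, T₂, hT₂⟩ := h₂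
  refine ⟨ι₁ ⊕ ι₂, inferInstance, fun h => op (T₁ fun a => h (a.map (Sum.map id Sum.inl)))
    (T₂ fun a => h (a.map (Sum.map id Sum.inr))), fun n M v => ?_⟩
  simp only [holds_map, Sum.elim_comp_map, comp_id, hT₁, hT₂]
  rw [hop]
  exact ⟨fun ⟨u₁, u₂, h⟩ => ⟨Sum.elim u₁ u₂, h⟩, fun ⟨u, h⟩ => ⟨u ∘ Sum.inl, u ∘ Sum.inr, h⟩⟩

theorem IsExistential.or {Q₁ Q₂ : ∀ ⦃n : ℕ⦄, Model n → (Fin k → PInst n) → Prop}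
    (h₁ : IsExistential Q₁) (h₂ : IsExistential Q₂) :
    IsExistential fun _ M v => Q₁ M v ∨ Q₂ M v :=
  .combine Or (fun _ _ => by simp only [exists_or, exists_const]) h₁ h₂

theorem IsExistential.and {Q₁ Q₂ : ∀ ⦃n : ℕ⦄, Model n → (Fin k → PInst n) → Prop}
    (h₁ : IsExistential Q₁) (h₂ : IsExistential Q₂) :
    IsExistential fun _ M v => Q₁ M v ∧ Q₂ M v :=
  .combine And (fun _ _ => by simp) h₁ h₂

theorem IsExistential.ex {Q : ∀ ⦃n : ℕ⦄, Model n → (Fin (k + 1) → PInst n) → Prop}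
    (h : IsExistential Q) :
    IsExistential fun n M v =>
      ∃ a, Q M (Fin.snoc (α := fun _ : Fin (k + 1) => PInst n) v a) := by
  obtain ⟨ι, _, T, hT⟩ := h
  let f : Fin (k + 1) ⊕ ι → Fin k ⊕ Option ι :=
    Sum.elim (Fin.snoc (α := fun _ => Fin k ⊕ Option ι) Sum.inl (Sum.inr none)) (Sum.inr ∘ some)
  refine ⟨Option ι, inferInstance, fun h => T fun a => h (a.map f), fun n M v => ?_⟩
  have key : ∀ u : Option ι → PInst n, Sum.elim v u ∘ f =
      Sum.elim (Fin.snoc (α := fun _ : Fin (k + 1) => PInst n) v (u none)) (u ∘ some) := by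
    intro u
    funext x
    rcases x with x | x
    · refine Fin.lastCases ?_ (fun x => ?_) x <;> simp [f]
    · rfl
  simp only [holds_map, key, hT]
  exact ⟨fun ⟨a, u, h⟩ => ⟨fun o => o.elim a u, h⟩, fun ⟨u, h⟩ => ⟨u none, u ∘ some, h⟩⟩

theorem Formula.IsExistsFoilPlus.isExistential {φ : Formula k} (h : φ.IsExistsFoilPlus) :
    IsExistential fun _ M v => Sat M φ v := by
  induction φ with
  | eq | sub | pos | full | allPos | allNeg =>
    obtain ⟨T, hT⟩ := exists_of_quantifierFree _ (by trivial) h.1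
    exact isExistential_of_forall_iff T hT
  | neg φ =>
    obtain ⟨T, hT⟩ := exists_of_quantifierFree (.neg φ) h.2 h.1
    exact isExistential_of_forall_iff T hT
  | or φ ψ ih₁ ih₂ => exact (ih₁ ⟨h.1.1, h.2.1⟩).or (ih₂ ⟨h.1.2, h.2.2⟩)
  | and φ ψ ih₁ ih₂ => exact (ih₁ ⟨h.1.1, h.2.1⟩).and (ih₂ ⟨h.1.2, h.2.2⟩)
  | ex φ ih => exact (ih ⟨h.1, h.2⟩).ex
  | all φ => exact h.1.elim

theorem Formula.IsForallFoilPlus.isExistential_not {φ : Formula k} (h : φ.IsForallFoilPlus) :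
    IsExistential fun _ M v => ¬ Sat M φ v := by
  induction φ with
  | eq | sub | pos | full | allPos | allNeg =>
    obtain ⟨T, hT⟩ := exists_of_quantifierFree _ h.1 (by trivial)
    exact isExistential_of_forall_iff (fun h => ¬ T h) fun n M v => not_congr (hT n M v)
  | neg φ =>
    obtain ⟨T, hT⟩ := exists_of_quantifierFree (.neg φ) h.1 h.2
    exact isExistential_of_forall_iff (fun h => ¬ T h) fun n M v => not_congr (hT n M v)
  | or φ ψ ih₁ ih₂ =>
    exact ((ih₁ ⟨h.1.1, h.2.1⟩).and (ih₂ ⟨h.1.2, h.2.2⟩)).congr fun _ _ _ => not_or.symm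
  | and φ ψ ih₁ ih₂ =>
    exact ((ih₁ ⟨h.1.1, h.2.1⟩).or (ih₂ ⟨h.1.2, h.2.2⟩)).congr fun _ _ _ => not_and_or.symm
  | ex φ => exact h.1.elim
  | all φ ih => exact (ih ⟨h.1, h.2⟩).ex.congr fun _ _ _ => not_forall.symm

end Existential

/-! ### Perceptrons -/

/-- The least contribution of a feature of weight `w` to `w · x`, over the instances `x` that
subsume a partial instance with the value `o` there. -/
def lo (w : ℝ) : Option Bool → ℝ
  | some b => if b then w else 0
  | none => min w 0

/-- The greatest contribution of a feature of weight `w` to `w · x`, over the instances `x` that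
subsume a partial instance with the value `o` there. -/
def hi (w : ℝ) : Option Bool → ℝ
  | some b => if b then w else 0
  | none => max w 0

section Perceptron

variable {n : ℕ} (P : Perceptron n)

theorem toModel_eq_true (x : Inst n) :
    P.toModel x = true ↔ P.t ≤ ∑ i, if x i then P.w i else 0 := by
  simp [Perceptron.toModel, dotProduct]

theorem allPos_toModel (e : PInst n) : AllPos P.toModel e ↔ P.t ≤ ∑ i, lo (P.w i) (e i) := by
  simp only [allPos_iff, toModel_eq_true]
  constructor
  · intro h
    refine (h (fun i => (e i).getD (decide (P.w i < 0))) fun i hi => ?_).trans_eq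
      (Finset.sum_congr rfl fun i _ => ?_)
    · obtain ⟨b, hb⟩ := Option.ne_none_iff_exists'.1 hi
      simp [hb]
    · cases e i with
      | some b => rfl
      | none =>
        rcases lt_or_ge (P.w i) 0 with hw | hw
        · simp [lo, hw, hw.le]
        · simp [lo, hw, hw.not_gt]
  · refine fun h x hx => h.trans (Finset.sum_le_sum fun i _ => ?_)
    cases he : e i with
    | some b =>
      have := hx i (by simp [he])
      rw [he, Option.some.injEq] at this
      rw [this, lo]
    | none => simp only [lo]; split_ifs <;> simp

theorem allNeg_toModel (e : PInst n) : AllNeg P.toModel e ↔ ∑ i, hi (P.w i) (e i) < P.t := by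
  simp only [allNeg_iff, ← Bool.not_eq_true, toModel_eq_true, not_le]
  constructor
  · intro h
    refine (h (fun i => (e i).getD (!decide (P.w i < 0))) fun i hi => ?_).trans_eq'
      (Finset.sum_congr rfl fun i _ => ?_)
    · obtain ⟨b, hb⟩ := Option.ne_none_iff_exists'.1 hi
      simp [hb]
    · cases e i with
      | some b => rfl
      | none =>
        rcases lt_or_ge (P.w i) 0 with hw | hw
        · simp [hi, hw, hw.le]
        · simp [hi, hw, hw.not_gt]
  · refine fun h x hx => (Finset.sum_le_sum fun i _ => ?_).trans_lt h
    cases he : e i with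
    | some b =>
      have := hx i (by simp [he])
      rw [he, Option.some.injEq] at this
      rw [this, hi]
    | none => simp only [hi]; split_ifs <;> simp

end Perceptron

/-! ### Small witnesses -/

section Pick

variable {n : ℕ} {S : Set (Fin n)} {d d' : Option Bool} {f f' : PInst n} {b : Bool}

open Classical in
/-- One value standing for all values of `f` on `S`: the preferred value `d`, if `f` takes it; else
the value of `f`, if it is constant; else `⊥`. -/
noncomputable def pick (d : Option Bool) (S : Set (Fin n)) (f : PInst n) : Option Bool :=
  if ∃ b, d = some b ∧ ∃ i ∈ S, f i = some b then d
  else if ∀ i ∈ S, f i = some true then some true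
  else if ∀ i ∈ S, f i = some false then some false
  else none

theorem pick_of_mem {i : Fin n} (hi : i ∈ S) (h : f i = some b) : pick (some b) S f = some b :=
  if_pos ⟨b, rfl, i, hi, h⟩

theorem pick_of_const {i : Fin n} (hi : i ∈ S) {o : Option Bool} (h : ∀ j ∈ S, f j = o) :
    pick d S f = o := by
  rw [pick]
  split_ifs with h₁ h₂ h₃
  · obtain ⟨b, rfl, j, hj, hb⟩ := h₁
    rw [← hb, h j hj]
  · rw [← h₂ i hi, h i hi]
  · rw [← h₃ i hi, h i hi]
  · rcases o with _ | _ | _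
    exacts [rfl, (h₃ h).elim, (h₂ h).elim]

theorem eq_or_const_of_pick (h : pick d S f = some b) :
    (d = some b ∧ ∃ i ∈ S, f i = some b) ∨ ∀ i ∈ S, f i = some b := by
  rw [pick] at h
  split_ifs at h with h₁ h₂ h₃
  · obtain ⟨b', rfl, hb⟩ := h₁
    obtain rfl := Option.some.inj h
    exact .inl ⟨rfl, hb⟩
  · obtain rfl := Option.some.inj h
    exact .inr h₂
  · obtain rfl := Option.some.inj h
    exact .inr h₃

theorem pick_mono {i : Fin n} (hi : i ∈ S) (hf : Subsumed f f') (hd : d ≠ none → d = d')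
    (h : pick d S f ≠ none) : pick d S f = pick d' S f' := by
  obtain ⟨b, hb⟩ := Option.ne_none_iff_exists'.1 h
  have hs : ∀ j, f j = some b → f' j = some b := fun j hj => by rw [← hf j (by simp [hj]), hj]
  rw [hb]
  rcases eq_or_const_of_pick hb with ⟨rfl, j, hj, hjb⟩ | hc
  · rw [← hd nofun, pick_of_mem hj (hs j hjb)]
  · rw [pick_of_const hi fun j hj => hs j (hc j hj)]

theorem pick_ne_none {i : Fin n} (hi : i ∈ S) (hd : d ≠ none) (hf : ∀ j ∈ S, f j ≠ none) :
    pick d S f ≠ none := by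
  obtain ⟨b, rfl⟩ := Option.ne_none_iff_exists'.1 hd
  by_cases h : ∃ j ∈ S, f j = some b
  · obtain ⟨j, hj, hb⟩ := h
    simp [pick_of_mem hj hb]
  · rw [pick_of_const (o := some !b) hi fun j hj => ?_]
    · simp
    · have h₁ := hf j hj
      have h₂ : f j ≠ some b := fun hb => h ⟨j, hj, hb⟩
      rcases hfj : f j with _ | _ | _ <;> cases b <;> simp_all

/-- Replacing the values of an `AllPos` row by one that prefers what increases the weighted sum
keeps the least weighted sum from decreasing. -/
theorem lo_le_lo_pick {i : Fin n} (hi : i ∈ S) {w : ℝ} :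
    lo w (f i) ≤ lo w (pick (some (!decide (w < 0))) S f) := by
  cases hp : pick (some (!decide (w < 0))) S f with
  | some b =>
    rcases eq_or_const_of_pick hp with ⟨hb, -⟩ | hc
    · obtain rfl := Option.some.inj hb
      rcases lt_or_ge w 0 with hw | hw
      · rcases f i with _ | _ | _ <;> simp [lo, hw, hw.le]
      · rcases f i with _ | _ | _ <;> simp [lo, hw, hw.not_gt]
    · rw [hc i hi]
  | none =>
    have h : f i ≠ some (!decide (w < 0)) := fun h => by simp [pick_of_mem hi h] at hp
    rcases lt_or_ge w 0 with hw | hw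
    · rcases hf : f i with _ | _ | _ <;> simp_all [lo, hw.le]
    · rcases hf : f i with _ | _ | _ <;> simp_all [lo, hw.not_gt]

/-- Replacing the values of an `AllNeg` row by one that prefers what decreases the weighted sum
keeps the greatest weighted sum from increasing. -/
theorem hi_pick_le_hi {i : Fin n} (hi' : i ∈ S) {w : ℝ} :
    hi w (pick (some (decide (w < 0))) S f) ≤ hi w (f i) := by
  cases hp : pick (some (decide (w < 0))) S f with
  | some b =>
    rcases eq_or_const_of_pick hp with ⟨hb, -⟩ | hc
    · obtain rfl := Option.some.inj hb
      rcases lt_or_ge w 0 with hw | hw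
      · rcases f i with _ | _ | _ <;> simp [hi, hw, hw.le]
      · rcases f i with _ | _ | _ <;> simp [hi, hw, hw.not_gt]
    · rw [hc i hi']
  | none =>
    have h : f i ≠ some (decide (w < 0)) := fun h => by simp [pick_of_mem hi' h] at hp
    rcases lt_or_ge w 0 with hw | hw
    · rcases hf : f i with _ | _ | _ <;> simp_all [hi, hw.le]
    · rcases hf : f i with _ | _ | _ <;> simp_all [hi, hw.not_gt]

end Pick

section SmallWitness

theorem exists_finset_witnesses {A B : Type} [Fintype A] (R : A → B → Prop) :
    ∃ W : Finset B, W.card ≤ Fintype.card A ∧ ∀ a, (∃ b, R a b) → ∃ b ∈ W, R a b := by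
  classical
  refine ⟨Finset.univ.biUnion fun a => if h : ∃ b, R a b then {h.choose} else ∅,
    Finset.card_biUnion_le.trans ((Finset.sum_le_card_nsmul _ _ 1 fun a _ => ?_).trans (by simp)),
    fun a h => ⟨h.choose, Finset.mem_biUnion.2 ⟨a, Finset.mem_univ a, by simp [h]⟩, h.choose_spec⟩⟩
  split_ifs <;> simp

variable {n : ℕ} {V K : Type} [Fintype V]

/-- In a family of partial instances where every failure of `AllPos` or `AllNeg` is witnessed by a
member, boundedly many positions suffice to witness all failures of atomic facts. At the other
positions of the same kind, all columns can be replaced by a single one without affecting any atomic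
fact: an `AllPos` member takes, if it does so anywhere, the value that increases the weighted sum,
an `AllNeg` member the value that decreases it, and the other members keep a value only if
it is their common value on all positions of that kind. -/
theorem exists_marks_of_certified (P : Perceptron n) (s : V → PInst n) (κ : Fin n → K)
    (hκ : ∀ i j, κ i = κ j → (P.w i < 0 ↔ P.w j < 0))
    (hP : ∀ x, AllPos P.toModel (s x) ∨ ∃ y, Subsumed (s x) (s y) ∧ AllNeg P.toModel (s y))
    (hN : ∀ x, AllNeg P.toModel (s x) ∨ ∃ y, Subsumed (s x) (s y) ∧ AllPos P.toModel (s y)) :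
    ∃ (δ : K → V → Option Bool) (W : Finset (Fin n)),
      W.card ≤ Fintype.card (V × V ⊕ V) ∧
      (∀ a, Holds P.toModel (fun x i => if i ∈ W then s x i else δ (κ i) x) a ↔
        Holds P.toModel s a) ∧
      ∀ x, (∀ i j, κ i = κ j → s x i = s x j) → ∀ i, δ (κ i) x = s x i := by
  classical
  -- the value that is best for the class of `x` at the position `i`
  let d : V → Fin n → Option Bool := fun x i =>
    if AllPos P.toModel (s x) then some (!decide (P.w i < 0))
    else if AllNeg P.toModel (s x) then some (decide (P.w i < 0)) else none
  have hd : ∀ x i j, κ i = κ j → d x i = d x j := fun x i j h => by simp only [d, hκ i j h]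
  let δ : K → V → Option Bool := fun κ₀ x =>
    if h : ∃ i, κ i = κ₀ then pick (d x h.choose) {j | κ j = κ₀} (s x) else none
  have hδ : ∀ i x, δ (κ i) x = pick (d x i) {j | κ j = κ i} (s x) := fun i x => by
    have h : ∃ j, κ j = κ i := ⟨i, rfl⟩
    simp only [δ, h, dif_pos, hd x _ _ h.choose_spec]
  have mem : ∀ i, i ∈ {j | κ j = κ i} := fun _ => rfl
  -- the marks witness the failures of inclusions and of fullness
  obtain ⟨W, hWc, hW⟩ := exists_finset_witnesses
    (Sum.elim (fun (p : V × V) i => s p.1 i ≠ none ∧ s p.1 i ≠ s p.2 i) fun x i => s x i = none)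
  let s' : V → PInst n := fun x i => if i ∈ W then s x i else δ (κ i) x
  have hs' : ∀ {x i}, i ∈ W → s' x i = s x i := fun hi => if_pos hi
  have hs'' : ∀ {x i}, i ∉ W → s' x i = pick (d x i) {j | κ j = κ i} (s x) := fun hi =>
    (if_neg hi).trans (hδ _ _)
  have sub : ∀ {x y}, Subsumed (s x) (s y) → Subsumed (s' x) (s' y) := by
    intro x y h i
    by_cases hi : i ∈ W
    · rw [hs' hi, hs' hi]; exact h i
    · rw [hs'' hi, hs'' hi]
      refine pick_mono (mem i) h fun hx => ?_
      by_cases h₁ : AllPos P.toModel (s x)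
      · simp only [d, h₁, h₁.mono h, if_true]
      · by_cases h₂ : AllNeg P.toModel (s x)
        · have h₃ : ¬ AllPos P.toModel (s y) := fun h₃ => h₃.not_allNeg (h₂.mono h)
          simp only [d, h₁, h₂, h₃, h₂.mono h, if_true, if_false]
        · simp [d, h₁, h₂] at hx
  have pos : ∀ {x}, AllPos P.toModel (s x) → AllPos P.toModel (s' x) := by
    intro x h
    rw [allPos_toModel] at h ⊢
    refine h.trans (Finset.sum_le_sum fun i _ => ?_)
    by_cases hi : i ∈ W
    · rw [hs' hi]
    · rw [hs'' hi, show d x i = _ from if_pos ((allPos_toModel P _).2 h)]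
      exact lo_le_lo_pick (mem i)
  have neg : ∀ {x}, AllNeg P.toModel (s x) → AllNeg P.toModel (s' x) := by
    intro x h
    have h' : ¬ AllPos P.toModel (s x) := fun h' => h'.not_allNeg h
    have hdx : ∀ i, d x i = some (decide (P.w i < 0)) := fun i => by simp only [d, h, h', if_true,
      if_false]
    rw [allNeg_toModel] at h ⊢
    refine (Finset.sum_le_sum fun i _ => ?_).trans_lt h
    by_cases hi : i ∈ W
    · rw [hs' hi]
    · rw [hs'' hi, hdx]
      exact hi_pick_le_hi (mem i)
  refine ⟨δ, W, hWc, fun a => ?_, fun x hx i => (hδ i x).trans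
    (pick_of_const (mem i) fun j hj => hx j i hj)⟩
  cases a with
  | sub x y =>
    refine ⟨fun h => ?_, sub⟩
    by_contra hn
    obtain ⟨i, hi, h₁, h₂⟩ := hW (.inl (x, y)) (by simpa [Holds, Subsumed] using hn)
    have := h i
    simp only [hi, if_true] at this
    exact h₂ (this h₁)
  | full x =>
    simp only [Holds, full_iff]
    constructor
    · intro h
      by_contra hn
      obtain ⟨i, hi, h₁⟩ := hW (.inr x) (by simpa using hn)
      exact h i ((hs' hi).trans h₁)
    · intro h i
      show s' x i ≠ none
      by_cases hi : i ∈ W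
      · rw [hs' hi]; exact h i
      · rw [hs'' hi]
        refine pick_ne_none (mem i) ?_ fun j _ => h j
        rcases (full_iff.2 h).allPos_or_allNeg P.toModel with h | h
        · simp [d, h]
        · by_cases h' : AllPos P.toModel (s x) <;> simp [d, h, h']
  | allPos x =>
    refine ⟨fun h => (hP x).resolve_right ?_, pos⟩
    rintro ⟨y, hxy, hy⟩
    exact (AllPos.mono h (sub hxy)).not_allNeg (neg hy)
  | allNeg x =>
    refine ⟨fun h => (hN x).resolve_right ?_, neg⟩
    rintro ⟨y, hxy, hy⟩
    exact (pos hy).not_allNeg (AllNeg.mono h (sub hxy))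

/-- The small witness property: for the truth of all atomic facts, all columns of a kind, except for
boundedly many ones, can be replaced by the same column, and the rows which are constant on
every kind stay as they are. -/
theorem exists_marks (P : Perceptron n) (s : V → PInst n) (κ : Fin n → K)
    (hκ : ∀ i j, κ i = κ j → (P.w i < 0 ↔ P.w j < 0)) :
    ∃ (δ : K → V → Option Bool) (W : Finset (Fin n)),
      W.card ≤ Fintype.card ((V × Option Bool) × (V × Option Bool) ⊕ V × Option Bool) ∧
      (∀ a, Holds P.toModel (fun x i => if i ∈ W then s x i else δ (κ i) x) a ↔
        Holds P.toModel s a) ∧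
      ∀ x, (∀ i j, κ i = κ j → s x i = s x j) → ∀ i, δ (κ i) x = s x i := by
  -- each member `x` is accompanied by an instance witnessing the failure of `AllPos`, and one
  -- witnessing the failure of `AllNeg`
  have hy : ∀ x, ∃ y, Subsumed (s x) y ∧ (AllPos P.toModel y ∨ AllNeg P.toModel y) ∧
      (AllPos P.toModel (s x) ∨ AllNeg P.toModel y) := by
    intro x
    by_cases h : AllPos P.toModel (s x)
    · exact ⟨_, .refl _, .inl h, .inl h⟩
    · simp only [allPos_iff, not_forall, Bool.not_eq_true] at h
      obtain ⟨y, hxy, hy⟩ := h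
      have : AllNeg P.toModel fun i => some (y i) :=
        ((full_some y).allPos_or_allNeg _).resolve_left fun h => by
          have := allPos_iff.1 h y (.refl _)
          simp [hy] at this
      exact ⟨_, hxy, .inr this, .inr this⟩
  have hz : ∀ x, ∃ z, Subsumed (s x) z ∧ (AllPos P.toModel z ∨ AllNeg P.toModel z) ∧
      (AllNeg P.toModel (s x) ∨ AllPos P.toModel z) := by
    intro x
    by_cases h : AllNeg P.toModel (s x)
    · exact ⟨_, .refl _, .inr h, .inl h⟩
    · simp only [AllNeg, not_forall, not_not] at h
      obtain ⟨y, hxy, hy⟩ := h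
      exact ⟨y, hxy, .inl (pos_iff.1 hy).2, .inr (pos_iff.1 hy).2⟩
  choose y hy₁ hy₂ hy₃ using hy
  choose z hz₁ hz₂ hz₃ using hz
  let s₁ : V × Option Bool → PInst n := fun p =>
    p.2.elim (s p.1) fun b => if b then y p.1 else z p.1
  obtain ⟨δ, W, h₁, h₂, h₃⟩ := exists_marks_of_certified P s₁ κ hκ
    (by
      rintro ⟨x, _ | _ | _⟩
      · exact (hy₃ x).imp_right fun h => ⟨(x, some true), hy₁ x, h⟩
      · exact (hz₂ x).imp_right fun h => ⟨(x, some false), .refl _, h⟩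
      · exact (hy₂ x).imp_right fun h => ⟨(x, some true), .refl _, h⟩)
    (by
      rintro ⟨x, _ | _ | _⟩
      · exact (hz₃ x).imp_right fun h => ⟨(x, some false), hz₁ x, h⟩
      · exact (hz₂ x).symm.imp_right fun h => ⟨(x, some false), .refl _, h⟩
      · exact (hy₂ x).symm.imp_right fun h => ⟨(x, some true), .refl _, h⟩)
  refine ⟨fun κ₀ x => δ κ₀ (x, none), W, h₁, fun a => ?_, fun x hx i => h₃ (x, none) hx i⟩
  have := h₂ (a.map fun x => (x, none))
  rw [holds_map, holds_map] at this
  exact this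

end SmallWitness

/-! ### Deciding atomic facts -/

theorem sumNonneg_encode {k : ℕ} (I : PtronInput k) (c : List (Option Bool))
    (hc : c.length = I.n + 1) : sumNonneg I.encode c = true ↔
      0 ≤ (List.zipWith (fun q c => SumState.coefVal c * q) I.numbers c).sum := by
  obtain ⟨p, m, b, hb, h₁, h₂⟩ := SumState.foldl_flatMap_encRat I.numbers c 0 0 1
    (by simp [PtronInput.numbers, hc]) one_pos
  have hb' : (0 : ℚ) < b := by exact_mod_cast hb
  rw [sumNonneg, I.encode_eq, List.foldl_append, h₁, SumState.foldl_of_ignored fun a ha s => ?_]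
  · simp only [Nat.cast_zero, sub_zero, zero_div, zero_add] at h₂
    rw [← h₂, le_div_iff₀ hb', zero_mul, sub_nonneg, Nat.cast_le, decide_eq_true_iff]
    rfl
  · rcases mem_encode_tail I ha with rfl | ⟨v, rfl⟩ <;> rfl

/-- The coefficient of a weight in the least value of `w · x`, if a partial instance has the
value `o` there and `neg` says whether the weight is negative. -/
def loCoef (neg : Bool) : Option Bool → Option Bool
  | some b => if b then some true else none
  | none => if neg then some true else none

/-- The coefficient of a weight in the greatest value of `w · x`, if a partial instance has the
value `o` there and `neg` says whether the weight is negative. -/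
def hiCoef (neg : Bool) : Option Bool → Option Bool
  | some b => if b then some true else none
  | none => if neg then none else some true

theorem coefVal_loCoef (w : ℚ) (o : Option Bool) :
    ((SumState.coefVal (loCoef (decide (w < 0)) o) * w : ℚ) : ℝ) = lo w o := by
  rcases o with _ | _ | _
  · rcases lt_or_ge w 0 with h | h
    · simp [loCoef, lo, SumState.coefVal, h, h.le]
    · simp [loCoef, lo, SumState.coefVal, h, h.not_gt]
  · simp [loCoef, lo, SumState.coefVal]
  · simp [loCoef, lo, SumState.coefVal]

theorem coefVal_hiCoef (w : ℚ) (o : Option Bool) :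
    ((SumState.coefVal (hiCoef (decide (w < 0)) o) * w : ℚ) : ℝ) = hi w o := by
  rcases o with _ | _ | _
  · rcases lt_or_ge w 0 with h | h
    · simp [hiCoef, hi, SumState.coefVal, h, h.le]
    · simp [hiCoef, hi, SumState.coefVal, h, h.not_gt]
  · simp [hiCoef, hi, SumState.coefVal]
  · simp [hiCoef, hi, SumState.coefVal]

/-- The comparison of a sum of weights with the threshold. The threshold is the first number of the
string, so that the leading coefficient `-1` subtracts it. -/
theorem sumNonneg_cons_encode {k : ℕ} (I : PtronInput k) (c : Fin I.n → Option Bool) :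
    sumNonneg I.encode (some false :: List.ofFn c) = true ↔
      (I.t : ℝ) ≤ ∑ i, ((SumState.coefVal (c i) * I.w i : ℚ) : ℝ) := by
  rw [sumNonneg_encode I _ (by simp), PtronInput.numbers, List.zipWith_cons_cons, List.sum_cons,
    show List.zipWith (fun q c => SumState.coefVal c * q) (List.ofFn I.w) (List.ofFn c) =
      List.ofFn fun i => SumState.coefVal (c i) * I.w i from
        List.ext_getElem (by simp) fun i h₁ h₂ => by simp, List.sum_ofFn, ← Rat.cast_sum,
    Rat.cast_le]
  simp [SumState.coefVal]

section CheckAtom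

variable {C V : Type} (f : C → V → Option Bool) (neg : C → Bool)

/-- Whether an atomic fact holds of the partial instances whose columns are the values of `f`
on a word, where `neg` tells the signs of the weights. -/
def checkAtom : Atom V → List Sym × List C → Bool
  | .sub x y, p => p.2.all fun c => decide (f c x ≠ none → f c x = f c y)
  | .full x, p => p.2.all fun c => decide (f c x ≠ none)
  | .allPos x, p => sumNonneg p.1 (some false :: p.2.map fun c => loCoef (neg c) (f c x))
  | .allNeg x, p => !sumNonneg p.1 (some false :: p.2.map fun c => hiCoef (neg c) (f c x))

theorem pt_checkAtom [Fintype C] (a : Atom V) : PT (checkAtom f neg a) := by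
  cases a with
  | sub x y => exact PT.snd.all _
  | full x => exact PT.snd.all _
  | allPos x => exact pt_sumNonneg.comp (PT.fst.pair ((PT.snd.map _).cons _))
  | allNeg x => exact (pt_sumNonneg.comp (PT.fst.pair ((PT.snd.map _).cons _))).not

theorem checkAtom_encode {k : ℕ} (I : PtronInput k) (g : Fin I.n → C)
    (hg : ∀ i, neg (g i) = decide (I.w i < 0)) (a : Atom V) :
    checkAtom f neg a (I.encode, List.ofFn g) = true ↔
      Holds I.perceptron.toModel (fun x i => f (g i) x) a := by
  cases a with
  | sub x y => simp [checkAtom, Holds, Subsumed, or_iff_not_imp_left]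
  | full x => simp [checkAtom, Holds, full_iff]
  | allPos x =>
    rw [checkAtom, List.map_ofFn, sumNonneg_cons_encode, Holds, allPos_toModel]
    simp only [comp_apply, hg, coefVal_loCoef]
    rfl
  | allNeg x =>
    rw [checkAtom, List.map_ofFn, Bool.not_eq_true', ← Bool.not_eq_true,
      sumNonneg_cons_encode, Holds, allNeg_toModel, not_le]
    simp only [comp_apply, hg, coefVal_hiCoef]
    rfl

end CheckAtom

/-! ### Deciding existential queries -/

section Decide

variable {k : ℕ} {ι : Type}

/-- The column at a cell: the values in the given partial instances, followed by the values in
the partial instances sought, which are the mark, or depend on the cell by `δ`. -/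
def columnAt (δ : (Fin k → Option Bool) × Bool → ι → Option Bool)
    (c : Cell k (ι → Option Bool)) : Fin k ⊕ ι → Option Bool :=
  Sum.elim c.1 (c.2.2.getD (δ (c.1, c.2.1)))

/-- Whether the atomic facts about the partial instances given by `δ` satisfy `T`. -/
noncomputable def checkQuery (T : (Atom (Fin k ⊕ ι) → Prop) → Prop)
    (δ : (Fin k → Option Bool) × Bool → ι → Option Bool)
    (p : List Sym × List (Cell k (ι → Option Bool))) : Bool :=
  existsB fun τ : {τ : Atom (Fin k ⊕ ι) → Bool // T fun a => τ a = true} =>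
    forallB fun a => checkAtom (columnAt δ) (fun c => c.2.1) a p == τ.1 a

theorem checkQuery_eq_true {T : (Atom (Fin k ⊕ ι) → Prop) → Prop}
    {δ : (Fin k → Option Bool) × Bool → ι → Option Bool}
    {p : List Sym × List (Cell k (ι → Option Bool))} : checkQuery T δ p = true ↔
      T fun a => checkAtom (columnAt δ) (fun c => c.2.1) a p = true := by
  simp only [checkQuery, existsB_eq_true, forallB_eq_true, beq_iff_eq]
  refine ⟨fun ⟨τ, h⟩ => by simpa only [h] using τ.2, fun h => ⟨⟨_, h⟩, fun _ => rfl⟩⟩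

theorem pt_checkQuery [Fintype ι] [DecidableEq ι] (T : (Atom (Fin k ⊕ ι) → Prop) → Prop)
    (δ : (Fin k → Option Bool) × Bool → ι → Option Bool) : PT (checkQuery T δ) := by
  classical
  refine PT.existsB fun τ => PT.forallB fun a => ?_
  cases τ.1 a with
  | true => exact (pt_checkAtom (columnAt δ) (fun c => c.2.1) a).congr fun p => by simp
  | false => exact (pt_checkAtom (columnAt δ) (fun c => c.2.1) a).not.congr fun p => by simp

/-- Existential queries are decided in polynomial time by trying all columns `δ` for the kinds
of features, and all marks at a bounded number of features. -/
theorem IsExistential.exists_pt {Q : ∀ ⦃n : ℕ⦄, Model n → (Fin k → PInst n) → Prop}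
    (h : IsExistential Q) : ∃ F : List Sym → Bool, PT F ∧
      ∀ I : PtronInput k, F I.encode = true ↔ Q I.perceptron.toModel I.e := by
  classical
  obtain ⟨ι, _, T, hT⟩ := h
  let upd : (ι → Option Bool) → Cell k (ι → Option Bool) → Cell k (ι → Option Bool) :=
    fun v c => (c.1, c.2.1, some v)
  let V := (Fin k ⊕ ι) × Option Bool
  refine ⟨fun s => existsB fun δ : (Fin k → Option Bool) × Bool → ι → Option Bool =>
    (someUpdate upd)^[Fintype.card (V × V ⊕ V)] (checkQuery T δ)
      (s, cells (ι → Option Bool) (List.finRange k) s), ?_, fun I => ?_⟩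
  · exact PT.existsB fun δ => ((pt_checkQuery T δ).iterate_someUpdate upd _).comp
      (PT.id.pair (pt_cells _))
  rw [existsB_eq_true, hT]
  have hcells : cells (ι → Option Bool) (List.finRange k) I.encode =
      List.ofFn fun i => (fun j => I.e j i, decide (I.w i < 0), none) := by
    simp [cells_encode]
  rw [hcells]
  constructor
  · rintro ⟨δ, h⟩
    obtain ⟨l, hl, hD⟩ := exists_of_iterate_someUpdate (upd := upd)
      (π := fun c : Cell k (ι → Option Bool) => (c.1, c.2.1)) (fun _ _ => rfl) _ h
    obtain ⟨g, rfl⟩ : ∃ g : Fin I.n → Cell k (ι → Option Bool), l = List.ofFn g := by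
      have hlen : l.length = I.n := by simpa using congrArg List.length hl
      exact ⟨fun i => l[i], List.ext_getElem (by simp [hlen]) fun i _ _ => by simp⟩
    have hg : ∀ i, ((g i).1, (g i).2.1) = (fun j => I.e j i, decide (I.w i < 0)) := by
      rw [List.map_ofFn, List.map_ofFn] at hl
      exact fun i => congrFun (List.ofFn_injective hl) i
    have hg₁ : ∀ i, (g i).1 = fun j => I.e j i := fun i => congrArg Prod.fst (hg i)
    have hg₂ : ∀ i, (g i).2.1 = decide (I.w i < 0) := fun i => congrArg Prod.snd (hg i)
    refine ⟨fun x i => columnAt δ (g i) (.inr x), ?_⟩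
    rw [checkQuery_eq_true] at hD
    convert hD using 2 with a
    rw [checkAtom_encode _ _ I g hg₂]
    refine iff_of_eq (congrFun (congrArg _ (funext fun x => ?_)) a)
    rcases x with x | x
    · funext i; simp [columnAt, hg₁]
    · rfl
  · rintro ⟨u, h⟩
    let κ : Fin I.n → (Fin k → Option Bool) × Bool := fun i =>
      (fun j => I.e j i, decide (I.w i < 0))
    obtain ⟨δ, W, hW, hh, hc⟩ := exists_marks I.perceptron (Sum.elim I.e u) κ fun i j hij => by
      simpa [PtronInput.perceptron, κ] using congrArg Prod.snd hij
    refine ⟨fun c x => δ c (.inr x), iterate_someUpdate_of_finset (fun i x => u x i) W hW ?_⟩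
    rw [checkQuery_eq_true]
    convert h using 2 with a
    rw [checkAtom_encode _ _ I _ fun i => by split_ifs <;> rfl, ← hh a]
    refine iff_of_eq (congrFun (congrArg _ (funext fun x => funext fun i => ?_)) a)
    rcases x with x | x
    · have := hc (.inl x) (fun i j hij => congrFun (congrArg Prod.fst hij) x) i
      by_cases hi : i ∈ W <;> simp [columnAt, upd, hi, this]
    · by_cases hi : i ∈ W <;> simp [columnAt, upd, hi, κ]

theorem Formula.IsBoolCombExistsFoilPlus.exists_pt {φ : Formula k}
    (h : φ.IsBoolCombExistsFoilPlus) : ∃ F : List Sym → Bool, PT F ∧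
      ∀ I : PtronInput k, F I.encode = true ↔ EvalPtron φ I := by
  induction h with
  | base h => exact h.isExistential.exists_pt
  | neg _ ih =>
    obtain ⟨F, hF, h⟩ := ih
    exact ⟨_, hF.not, fun I => by simpa [EvalPtron, Sat] using (h I).not⟩
  | or _ _ ih₁ ih₂ =>
    obtain ⟨F₁, hF₁, h₁⟩ := ih₁
    obtain ⟨F₂, hF₂, h₂⟩ := ih₂
    exact ⟨_, hF₁.or hF₂, fun I => by simpa [EvalPtron, Sat] using or_congr (h₁ I) (h₂ I)⟩
  | and _ _ ih₁ ih₂ =>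
    obtain ⟨F₁, hF₁, h₁⟩ := ih₁
    obtain ⟨F₂, hF₂, h₂⟩ := ih₂
    exact ⟨_, hF₁.and hF₂, fun I => by simpa [EvalPtron, Sat] using and_congr (h₁ I) (h₂ I)⟩

theorem Formula.IsForallFoilPlus.exists_pt {φ : Formula k} (h : φ.IsForallFoilPlus) :
    ∃ F : List Sym → Bool, PT F ∧ ∀ I : PtronInput k, F I.encode = true ↔ EvalPtron φ I := by
  obtain ⟨F, hF, h⟩ := h.isExistential_not.exists_pt
  exact ⟨_, hF.not, fun I => by simpa [EvalPtron] using (h I).not⟩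

end Decide

end Foil

theorem corollary5 :
    (∀ (k : ℕ) (φ : Foil.Formula k),
      φ.IsExistsFoilPlus ∨ φ.IsForallFoilPlus → Foil.EvalPtronInPolyTime φ) ∧
    (∀ (k : ℕ) (φ : Foil.Formula k),
      φ.IsBoolCombExistsFoilPlus → Foil.EvalPtronInPolyTime φ) := by
  refine ⟨fun k φ h => ?_, fun k φ h => ?_⟩
  · rcases h with h | h
    · obtain ⟨F, hF, h⟩ := (Foil.Formula.IsBoolCombExistsFoilPlus.base h).exists_pt
      exact hF.solvable h
    · obtain ⟨F, hF, h⟩ := h.exists_pt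
      exact hF.solvable h
  · obtain ⟨F, hF, h⟩ := h.exists_pt
    exact hF.solvable h
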